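/- Let $M$ and $N$ be connected, Hausdorff, second countable $C^\infty$ manifolds, possibly with boundary (without corners), of dimensions $m$ and $n$, and let $k\ge 0$ be an integer. Charts are smooth parametrisations $\varphi:U\to M$, $\psi:V\to N$ by open subsets $U,V$ of a Euclidean space or closed Euclidean half-space. Let $C^{k,1}(M,N)$ be the set of $C^k$ maps $f:M\to N$ whose $k$-th derivative is locally Lipschitz in all pairs of charts. For a compact set $K$ put $$\|F\|_K^{k,1}=\max\Big\{\max_{0\le j\le k}\,\sup_{x\in K}|D^jF(x)|_{\mathrm{op}},\ \sup_{x,y\in K,\,x\ne y}\frac{|D^kF(y)-D^kF(x)|_{\mathrm{op}}}{|y-x|}\Big\}.$$ For $f\in C^{k,1}(M,N)$, charts $\varphi:U\to M$, $\psi:V\to N$, a compact $K\subset U$ with $f(\varphi(K))\subset\psi(V)$ and $\epsilon\in(0,\infty]$, let $\mathcal N(f;K,\varphi,\psi,\epsilon)$ be the set of $h\in C^{k,1}(M,N)$ with $h(\varphi(K))\subset\psi(V)$ and $\|\psi^{-1}h\varphi-\psi^{-1}f\varphi\|_K^{k,1}<\epsilon$. The strong topology on $C^{k,1}(M,N)$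 is generated by the intersections $\bigcap_i\mathcal N(f;K_i,\varphi_i,\psi_i,\epsilon_i)$ for which $\{\varphi_i(K_i)\}_i$ is locally finite in $M$. For a locally Lipschitz $F:U\to\mathbb R^n$, the Clarke derivative $DF(x)$ is the convex hull of all limits $\lim_i DF(x_i)$ with $x_i\to x$ in $U$ and $F$ differentiable at each $x_i$. Let $\sigma_j(A)$ be the $j$-th largest singular value of $A$ (taken as $0$ for $j>\min(m,n)$). Define the following subsets of $C^{k,1}(M,N)$: - $\mathrm{Sub}^{k,1}$ (resp. $\mathrm{Imm}^{k,1}$): those $f$ such that for all charts with $f(\varphi(U))\subset\psi(V)$ and all $x\in U$, $\inf_{A\in D(\psi^{-1}f\varphi)(x)}\sigma_n(A)>0$ (resp. $\sigma_m(A)$ in place of $\sigma_n(A)$); the condition is void if $n=0$ (resp. $m=0$); - $\mathrm{Emb}^{k,1}$: those $f\in\mathrm{Imm}^{k,1}$ that are homeomorphisms onto their image; - $\mathrm{Prop}^{k,1}$: those $f$ for which preimages of compact sets are compact; - $C^{k,1}_\partial$: those $f$ with $f(\partial M)\subset\partial N$, with the subspace topology; - $\mathrm{Diff}^{k,1}$: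 those $f$ that are bijective with $f^{-1}\in C^{k,1}(N,M)$. Then: 1. $\mathrm{Diff}^{k,1}(M,N)\subset C^{k,1}_\partial(M,N)$, and $\mathrm{Diff}^{k,1}(M,N)$ is open in $C^{k,1}_\partial(M,N)$. 2. $\mathrm{Sub}^{k,1}$, $\mathrm{Imm}^{k,1}$, $\mathrm{Emb}^{k,1}$ and $\mathrm{Prop}^{k,1}$ are open in $C^{k,1}(M,N)$. 3. $\mathrm{Sub}^{k,1}\cap\mathrm{Emb}^{k,1}\cap\mathrm{Prop}^{k,1}\cap C^{k,1}_\partial\subset\mathrm{Diff}^{k,1}$, with equality if $k\ge1$. -/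

import Mathlib

open Set Filter Topology Function
open scoped Manifold ContDiff ENNReal

noncomputable section

namespace LipWhitney

/-- A model with corners over `ℝᵐ` is a model for manifolds possibly with boundary, without
corners, if it is modelled on the whole space or on a closed coordinate half-space. -/
def IsBoundaryModel {m : ℕ} {H : Type*} [TopologicalSpace H]
    (I : ModelWithCorners ℝ (EuclideanSpace ℝ (Fin m)) H) : Prop :=
  range I = univ ∨ ∃ i : Fin m, range I = {x | 0 ≤ x i}

/-- The extended seminorm `‖F‖^{k,1}_K`: the largest of the suprema over `K` of the operator norms
of the derivatives of order at most `k`, and the Lipschitz constant over `K` of the `k`-th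
derivative. Derivatives are taken within the (closed, convex) set `s`, which is the range of the
model with corners. -/
def lipSeminorm {E E' : Type*} [NormedAddCommGroup E] [NormedSpace ℝ E]
    [NormedAddCommGroup E'] [NormedSpace ℝ E'] (k : ℕ) (s K : Set E) (F : E → E') : ℝ≥0∞ :=
  (⨆ j ∈ Finset.range (k + 1), ⨆ x ∈ K, ‖iteratedFDerivWithin ℝ j F s x‖ₑ) ⊔
  (⨆ x ∈ K, ⨆ y ∈ K \ {x},
    ‖iteratedFDerivWithin ℝ k F s y - iteratedFDerivWithin ℝ k F s x‖ₑ / ‖y - x‖ₑ)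

/-- The Clarke derivative at `x` of `F : U → E'`: the convex hull of all limits of
`DF(u₀), DF(u₁), …` along sequences in `U` that converge to `x` and consist of points at which `F`
is differentiable. -/
def clarkeDeriv {E E' : Type*} [NormedAddCommGroup E] [NormedSpace ℝ E]
    [NormedAddCommGroup E'] [NormedSpace ℝ E'] (F : E → E') (U : Set E) (x : E) :
    Set (E →L[ℝ] E') :=
  convexHull ℝ {A | ∃ u : ℕ → E, (∀ i, u i ∈ U ∧ DifferentiableWithinAt ℝ F U (u i)) ∧
    Tendsto u atTop (𝓝 x) ∧ Tendsto (fun i => fderivWithin ℝ F U (u i)) atTop (𝓝 A)}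

section Manifolds

variable {m n : ℕ} {H H' : Type*} [TopologicalSpace H] [TopologicalSpace H']
  (I : ModelWithCorners ℝ (EuclideanSpace ℝ (Fin m)) H)
  (J : ModelWithCorners ℝ (EuclideanSpace ℝ (Fin n)) H')
  {M N : Type*} [TopologicalSpace M] [TopologicalSpace N] [ChartedSpace H M] [ChartedSpace H' N]

/-- The coordinate expression of `f` in the charts `φ` of `M` and `ψ` of `N` (charts map the
manifold to the model space here). -/
def localRep (φ : OpenPartialHomeomorph M H) (ψ : OpenPartialHomeomorph N H') (f : M → N) :
    EuclideanSpace ℝ (Fin m) → EuclideanSpace ℝ (Fin n) :=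
  ψ.extend J ∘ f ∘ (φ.extend I).symm

/-- The part of the coordinate domain of `φ` on which the coordinate expression of `f` in the
charts `φ`, `ψ` is defined. -/
def localDomain (φ : OpenPartialHomeomorph M H) (ψ : OpenPartialHomeomorph N H') (f : M → N) :
    Set (EuclideanSpace ℝ (Fin m)) :=
  {x ∈ (φ.extend I).target | f ((φ.extend I).symm x) ∈ ψ.source}

/-- `f` is `C^k`, and its `k`-th derivative is locally Lipschitz in any pair of smooth charts. -/
def IsCkLip (k : ℕ) (f : M → N) : Prop :=
  ContMDiff I J (k : WithTop ℕ∞) f ∧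
  ∀ φ ∈ IsManifold.maximalAtlas I ∞ M, ∀ ψ ∈ IsManifold.maximalAtlas J ∞ N,
    LocallyLipschitzOn (localDomain I φ ψ f)
      (iteratedFDerivWithin ℝ k (localRep I J φ ψ f) (range I))

variable (M N) in
/-- The set `C^{k,1}(M, N)`. It is a structure, so that it carries no topology by default. -/
structure CkLip (k : ℕ) where
  toFun : M → N
  isCkLip : IsCkLip I J k toFun

variable {k : ℕ}

/-- The elementary neighbourhood of `f` given by charts `φ`, `ψ`, a compact subset `K` of the
coordinate domain of `φ`, and `ε`. Membership of `h` includes that the coordinate expression of `h`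
is defined on `K`. -/
def elementaryNhd (f : CkLip I J M N k) (φ : OpenPartialHomeomorph M H)
    (ψ : OpenPartialHomeomorph N H') (K : Set (EuclideanSpace ℝ (Fin m))) (ε : ℝ≥0∞) :
    Set (CkLip I J M N k) :=
  {h | K ⊆ localDomain I φ ψ h.toFun ∧
    lipSeminorm k (range I) K (localRep I J φ ψ h.toFun - localRep I J φ ψ f.toFun) < ε}

/-- Basic sets: intersections of elementary neighbourhoods of one map `f`, over a family of
compact coordinate sets that is locally finite in `M`. -/
def IsBasicSet (S : Set (CkLip I J M N k)) : Prop :=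
  ∃ (f : CkLip I J M N k) (ι : Type) (φ : ι → OpenPartialHomeomorph M H)
    (ψ : ι → OpenPartialHomeomorph N H') (K : ι → Set (EuclideanSpace ℝ (Fin m)))
    (ε : ι → ℝ≥0∞),
    (∀ i, φ i ∈ IsManifold.maximalAtlas I ∞ M ∧ ψ i ∈ IsManifold.maximalAtlas J ∞ N ∧
      IsCompact (K i) ∧ K i ⊆ localDomain I (φ i) (ψ i) f.toFun ∧ 0 < ε i) ∧
    LocallyFinite (fun i => ((φ i).extend I).symm '' K i) ∧
    S = ⋂ i, elementaryNhd I J f (φ i) (ψ i) (K i) (ε i)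

/-- The strong topology on `C^{k,1}(M, N)`, generated by the basic sets. -/
instance strongTopology : TopologicalSpace (CkLip I J M N k) :=
  TopologicalSpace.generateFrom {S | IsBasicSet I J S}

variable (M N k)

/-- `C^{k,1}_∂(M, N)`: the maps that send the boundary to the boundary. -/
def boundaryMaps : Set (CkLip I J M N k) :=
  {f | MapsTo f.toFun (I.boundary M) (J.boundary N)}

/-- `f` has rank at least `r` in the sense of Clarke: in all charts `φ`, `ψ` in which the
coordinate expression of `f` is defined on the whole coordinate domain, and at each point `x`, the
`r`-th largest singular values of the elements of the Clarke derivative have a positive infimum.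
Mathlib indexes the decreasing sequence of singular values from `0` and continues it by zeros; the
condition is void for `r = 0`. -/
def HasClarkeRank (r : ℕ) (f : CkLip I J M N k) : Prop :=
  ∀ φ ∈ IsManifold.maximalAtlas I ∞ M, ∀ ψ ∈ IsManifold.maximalAtlas J ∞ N,
    MapsTo f.toFun φ.source ψ.source → ∀ x ∈ (φ.extend I).target,
      ∃ c : ℝ, 0 < c ∧
        ∀ A ∈ clarkeDeriv (localRep I J φ ψ f.toFun) (φ.extend I).target x,
          ∀ j < r, c ≤ A.toLinearMap.singularValues j

/-- `Sub^{k,1}(M, N)`. -/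
def submersions : Set (CkLip I J M N k) := {f | HasClarkeRank I J M N k n f}

/-- `Imm^{k,1}(M, N)`. -/
def immersions : Set (CkLip I J M N k) := {f | HasClarkeRank I J M N k m f}

/-- `Emb^{k,1}(M, N)`: immersions that are homeomorphisms onto their image. -/
def embeddings : Set (CkLip I J M N k) := {f ∈ immersions I J M N k | IsEmbedding f.toFun}

/-- `Prop^{k,1}(M, N)`. -/
def properMaps : Set (CkLip I J M N k) :=
  {f | ∀ K : Set N, IsCompact K → IsCompact (f.toFun ⁻¹' K)}

/-- `Diff^{k,1}(M, N)`. -/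
def diffeos : Set (CkLip I J M N k) :=
  {f | ∃ g : CkLip J I N M k, LeftInverse g.toFun f.toFun ∧ RightInverse g.toFun f.toFun}

end Manifolds

end LipWhitney

end

/-! Every class is described by Lipschitz estimates in charts that survive perturbations of small
Lipschitz constant. On convex compact coordinate sets the seminorm controls the Lipschitz constant
of a difference for every `k`: by definition if `k = 0`, through the first derivative otherwise
(`lipschitzOnWith_of_lipSeminorm_le`). A locally finite cover by coordinate balls then turns local
stability into openness.

For submersions and immersions, the Clarke derivative is convex and contains all limits of nearby
derivatives. Projecting the origin onto a convex set, together with compactness, gives a uniform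
`δ`: for each unit vector `v` one `w` in the unit ball satisfies `⟨w, Df(u) v⟩ ≥ δ` at all nearby
interior points `u` of differentiability; for submersions the roles of `v` and `w` are exchanged. An
averaged mean value inequality integrates this to a bound on increments (`PairBound`). That bound is
stable, and differentiating it recovers the rank condition in all charts
(`IsBoundaryModel.exists_forall_clarkeDeriv`).

Embeddings and proper maps are handled by metric perturbation arguments whose tolerances depend on
the member of the cover. Local injectivity comes from the fact that a map with the immersion bound
expands distances near each point.

A bi-Lipschitz homeomorphism preserves dimension, by Rademacher's theorem, and the boundary: blowing
up at a boundary point where the restriction to the boundary is differentiable would otherwise give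
a homeomorphism of a half-space onto the whole space that is linear on the bounding hyperplane,
which the intermediate value theorem forbids.

The diffeomorphisms cannot be treated through Clarke ranks when `k = 0`. Instead, a map near a
diffeomorphism `f` is a proper, locally expanding embedding, and is open on the interior, since
composing it with the local inverse of `f` gives a perturbation of the identity. If it also
preserves the boundary, the closure of the image of the interior is open and closed, so the map is
onto (`OpenOnInterior.surjective`). Its inverse is locally Lipschitz, hence `C^{k,1}` by
bootstrapping `Dg = (Df ∘ g)⁻¹`. A map in the intersection of the four classes has the same
properties; there openness comes from minimising the distance to a target point
(`PairBound.nhds_le_map`). -/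

set_option linter.unusedSectionVars false

namespace LipWhitney

/-! ### Singular values as lower bounds of a linear map and its adjoint -/

section SingularValues

open Module Module.End

variable {E F : Type*} [NormedAddCommGroup E] [InnerProductSpace ℝ E] [FiniteDimensional ℝ E]
  [NormedAddCommGroup F] [InnerProductSpace ℝ F] [FiniteDimensional ℝ F]

theorem sq_mul_norm_sq_le_of_le_eigenvalues {T : E →ₗ[ℝ] E} (hT : T.IsSymmetric) {c : ℝ}
    (h : ∀ i, c ≤ hT.eigenvalues rfl i) (x : E) : c * ‖x‖ ^ 2 ≤ inner ℝ (T x) x := by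
  set b := hT.eigenvectorBasis rfl with hb
  have h1 : inner ℝ (T x) x = ∑ i, hT.eigenvalues rfl i * (b.repr x i) ^ 2 := by
    rw [← b.repr.inner_map_map, PiLp.inner_apply]
    refine Finset.sum_congr rfl fun i _ => ?_
    rw [hT.eigenvectorBasis_apply_self_apply rfl]
    simp [pow_two, hb]
    ring
  have h2 : ‖x‖ ^ 2 = ∑ i, (b.repr x i) ^ 2 := by
    rw [← b.repr.norm_map, EuclideanSpace.norm_sq_eq]
    simp
  rw [h1, h2, Finset.mul_sum]
  exact Finset.sum_le_sum fun i _ => mul_le_mul_of_nonneg_right (h i) (sq_nonneg _)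

/-- The squares of the singular values are the eigenvalues of `T* T`, and `⟨T* T x, x⟩ = ‖T x‖²`.
Expanding in an eigenbasis gives one direction, testing on eigenvectors the other. -/
theorem le_singularValues_iff (T : E →ₗ[ℝ] F) {c : ℝ} (hc : 0 ≤ c) :
    (∀ j < finrank ℝ E, c ≤ T.singularValues j) ↔ ∀ x, c * ‖x‖ ≤ ‖T x‖ := by
  have key : ∀ x, inner ℝ ((T.adjoint ∘ₗ T) x) x = ‖T x‖ ^ 2 := fun x => by
    simp [LinearMap.adjoint_inner_left]
  constructor
  · intro h x
    have := sq_mul_norm_sq_le_of_le_eigenvalues T.isSymmetric_adjoint_comp_self (c := c ^ 2)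
      (fun i => by
        rw [← T.sq_singularValues_fin rfl i]
        exact pow_le_pow_left₀ hc (h i i.2) 2) x
    rw [key, ← mul_pow] at this
    exact le_of_sq_le_sq this (norm_nonneg _)
  · intro h j hj
    obtain ⟨v, hv⟩ := (T.hasEigenvalue_adjoint_comp_self_sq_singularValues hj).exists_hasEigenvector
    have h1 := key v
    rw [hv.apply_eq_smul, inner_smul_left, real_inner_self_eq_norm_sq] at h1
    have h2 := h v
    have h3 : 0 < ‖v‖ := norm_pos_iff.2 hv.2
    have h4 : (c * ‖v‖) ^ 2 ≤ (T.singularValues j * ‖v‖) ^ 2 := by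
      refine (pow_le_pow_left₀ (by positivity) h2 2).trans ?_
      rw [← h1, mul_pow]; simp
    exact le_of_mul_le_mul_right
      (le_of_sq_le_sq h4 (mul_nonneg (T.singularValues_nonneg j) h3.le)) h3

/-- If `v` is an eigenvector of `T* T` with positive eigenvalue, then `T v` is one of `T T*` with
the same eigenvalue. The position in the ordering is not tracked. -/
theorem exists_singularValues_adjoint_eq (T : E →ₗ[ℝ] F) {j : ℕ} (hj : 0 < T.singularValues j) :
    ∃ i, T.adjoint.singularValues i = T.singularValues j := by
  have hjE : j < finrank ℝ E := by
    by_contra! h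
    rw [T.singularValues_of_finrank_le h] at hj
    exact lt_irrefl _ hj
  obtain ⟨v, hv⟩ := (T.hasEigenvalue_adjoint_comp_self_sq_singularValues hjE).exists_hasEigenvector
  have h1 : T.adjoint (T v) = T.singularValues j ^ 2 • v := by simpa using hv.apply_eq_smul
  have h2 : T v ≠ 0 := fun h => by
    rw [h, map_zero] at h1
    exact (smul_ne_zero (pow_ne_zero 2 hj.ne') hv.2) h1.symm
  have h3 : HasEigenvalue (T.adjoint.adjoint ∘ₗ T.adjoint) (T.singularValues j ^ 2) := by
    refine hasEigenvalue_of_hasEigenvector (x := T v) (hasEigenvector_iff.2 ⟨?_, h2⟩)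
    rw [mem_eigenspace_iff]
    simp [h1]
  obtain ⟨i, hi⟩ := T.adjoint.isSymmetric_adjoint_comp_self.exists_eigenvalues_eq rfl h3
  refine ⟨i, ?_⟩
  rw [T.adjoint.singularValues_fin rfl]
  have : T.adjoint.isSymmetric_adjoint_comp_self.eigenvalues rfl i = T.singularValues j ^ 2 := by
    simpa using hi
  rw [this, Real.sqrt_sq hj.le]

theorem le_finrank_range_of_forall_pos {T : E →ₗ[ℝ] F} {n : ℕ}
    (h : ∀ j < n, 0 < T.singularValues j) : n ≤ finrank ℝ T.range := by
  by_contra! hlt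
  have := h _ hlt
  rw [T.singularValues_finrank_range_self] at this
  exact lt_irrefl _ this

/-- Since the rank is `n`, the positive singular values on both sides are exactly those of index
below `n`. Hence it suffices that each one of the adjoint occurs somewhere among those of `T`. -/
theorem le_singularValues_adjoint {T : E →ₗ[ℝ] F} {c : ℝ} {n : ℕ}
    (h : ∀ j < n, c ≤ T.singularValues j) (hn : finrank ℝ T.range = n) :
    ∀ j < n, c ≤ T.adjoint.singularValues j := by
  intro j hj
  have h1 : 0 < T.adjoint.singularValues j := by
    rw [LinearMap.singularValues_pos_iff_lt_finrank_range, LinearMap.finrank_range_adjoint, hn]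
    exact hj
  obtain ⟨i, hi⟩ := exists_singularValues_adjoint_eq _ h1
  rw [LinearMap.adjoint_adjoint] at hi
  rw [← hi] at h1 ⊢
  rw [LinearMap.singularValues_pos_iff_lt_finrank_range, hn] at h1
  exact h i h1

theorem le_singularValues_iff_adjoint (T : E →ₗ[ℝ] F) {c : ℝ} (hc : 0 < c) :
    (∀ j < finrank ℝ F, c ≤ T.singularValues j) ↔ ∀ y, c * ‖y‖ ≤ ‖T.adjoint y‖ := by
  rw [← le_singularValues_iff _ hc.le]
  constructor
  · intro h
    exact le_singularValues_adjoint h (le_antisymm (Submodule.finrank_le _)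
      (le_finrank_range_of_forall_pos fun j hj => hc.trans_le (h j hj)))
  · intro h
    have h1 : finrank ℝ T.adjoint.range = finrank ℝ F := by
      refine le_antisymm ?_ (le_finrank_range_of_forall_pos fun j hj => hc.trans_le (h j hj))
      rw [LinearMap.finrank_range_adjoint]
      exact Submodule.finrank_le _
    have := le_singularValues_adjoint h h1
    rwa [LinearMap.adjoint_adjoint] at this

end SingularValues

end LipWhitney

namespace LipWhitney

/-! ### Mean value inequalities for Lipschitz maps -/

section MeanValue

open MeasureTheory

variable {E : Type*} [NormedAddCommGroup E] [NormedSpace ℝ E] [FiniteDimensional ℝ E]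

/-- A mean value inequality for Lipschitz functions whose directional derivative is bounded below
at almost every point. -/
theorem mul_le_sub_of_ae_le_fderiv [MeasurableSpace E] [BorelSpace E] {μ : Measure E}
    [μ.IsAddHaarMeasure] {q : E → ℝ} {L : NNReal} (hq : LipschitzWith L q) {O : Set E}
    (hO : IsOpen O) (hOc : Convex ℝ O) {v : E} {κ : ℝ}
    (h : ∀ᵐ u ∂μ, u ∈ O → κ ≤ fderiv ℝ q u v) {y : E} {t : ℝ} (ht : 0 ≤ t)
    (hy : y ∈ O) (hyt : y + t • v ∈ O) : κ * t ≤ q (y + t • v) - q y := by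
  have hcont := hq.continuous
  -- a small ball around the segment
  obtain ⟨r₁, hr₁, hb₁⟩ := Metric.isOpen_iff.1 hO y hy
  obtain ⟨r₂, hr₂, hb₂⟩ := Metric.isOpen_iff.1 hO _ hyt
  -- The segment may lie in the exceptional null set, so the increment is averaged over all
  -- translates of the segment by a ball of radius `ρ`. The average is differentiable in the length
  -- parameter, and averaging costs at most `2 L ρ`.
  have main : ∀ ρ, 0 < ρ → ρ < min r₁ r₂ →
      κ * t ≤ q (y + t • v) - q y + 2 * L * ρ := by
    intro ρ hρ hρr
    have hsub : ∀ z ∈ Metric.ball y ρ, ∀ s ∈ Icc 0 t, z + s • v ∈ O := by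
      intro z hz s hs
      rcases eq_or_lt_of_le ht with rfl | ht'
      · obtain rfl : s = 0 := le_antisymm hs.2 hs.1
        simpa using hb₁ (Metric.ball_subset_ball (hρr.le.trans (min_le_left _ _)) hz)
      · have hz1 : z ∈ O := hb₁ (Metric.ball_subset_ball (hρr.le.trans (min_le_left _ _)) hz)
        have hz2 : z + t • v ∈ O := by
          refine hb₂ (Metric.ball_subset_ball (hρr.le.trans (min_le_right _ _)) ?_)
          simpa using hz
        have := hOc.add_smul_sub_mem hz1 hz2 (t := s / t)
          ⟨div_nonneg hs.1 ht, div_le_one_of_le₀ hs.2 ht⟩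
        simpa [smul_smul, div_mul_cancel₀ _ ht'.ne'] using this
    set B := Metric.ball y ρ with hB
    have hBfin : μ B < ⊤ := measure_ball_lt_top
    have hBpos : 0 < μ.real B := by
      refine ENNReal.toReal_pos (Metric.measure_ball_pos μ y hρ).ne' hBfin.ne
    have : IsFiniteMeasure (μ.restrict B) := ⟨by simpa using hBfin⟩
    have hint : ∀ s : ℝ, Integrable (fun z => q (z + s • v)) (μ.restrict B) := by
      intro s
      have hc : Continuous fun z => q (z + s • v) := by fun_prop
      exact (hc.continuousOn.integrableOn_compact
        (isCompact_closedBall y ρ)).mono_set Metric.ball_subset_closedBall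
    set a : ℝ → ℝ := fun s => ∫ z in B, q (z + s • v) ∂μ with ha
    have hae : ∀ s : ℝ, ∀ᵐ z ∂μ, DifferentiableAt ℝ q (z + s • v) := by
      intro s
      have := (measurePreserving_add_right μ (s • v)).quasiMeasurePreserving.ae
        (hq.ae_differentiableAt (μ := μ))
      exact this
    have hder : ∀ s : ℝ, HasDerivAt a (∫ z in B, fderiv ℝ q (z + s • v) v ∂μ) s := by
      intro s
      refine (hasDerivAt_integral_of_dominated_loc_of_lip
        (F := fun s z => q (z + s • v)) (bound := fun _ => L * ‖v‖) (s := univ) univ_mem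
        (Eventually.of_forall fun s => (hint s).aestronglyMeasurable) (hint s) ?_ ?_ ?_ ?_).2
      · have hm := (measurable_fderiv_apply_const ℝ q v).comp (measurable_add_const (s • v))
        exact hm.aestronglyMeasurable
      · refine Eventually.of_forall fun z => ?_
        rw [lipschitzOnWith_univ]
        refine LipschitzWith.of_dist_le_mul fun s₁ s₂ => ?_
        refine (hq.dist_le_mul _ _).trans ?_
        rw [dist_add_left, dist_eq_norm, ← sub_smul, norm_smul, Real.coe_nnabs, abs_of_nonneg
          (by positivity), dist_eq_norm]
        exact le_of_eq (by ring)
      · exact integrable_const _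
      · filter_upwards [ae_restrict_of_ae (hae s)] with z hz
        have h1 : HasDerivAt (fun s : ℝ => z + s • v) v s := by
          simpa using ((hasDerivAt_id s).smul_const v).const_add z
        exact hz.hasFDerivAt.comp_hasDerivAt s h1
    have hlow : ∀ s ∈ Icc 0 t, κ * μ.real B ≤ ∫ z in B, fderiv ℝ q (z + s • v) v ∂μ := by
      intro s hs
      have h1 : κ * μ.real B = ∫ z in B, κ ∂μ := by simp [mul_comm]
      rw [h1]
      refine integral_mono_ae (integrable_const _) ?_ ?_
      · refine Integrable.mono' (integrable_const (L * ‖v‖))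
          ((measurable_fderiv_apply_const ℝ q v).comp
            (measurable_add_const (s • v))).aestronglyMeasurable
          (Eventually.of_forall fun z => ?_)
        exact ((fderiv ℝ q _).le_opNorm v).trans
          (mul_le_mul_of_nonneg_right (norm_fderiv_le_of_lipschitz ℝ hq) (norm_nonneg _))
      · have h2 := (measurePreserving_add_right μ (s • v)).quasiMeasurePreserving.ae h
        filter_upwards [ae_restrict_of_ae h2, ae_restrict_mem measurableSet_ball] with z hz hzB
        exact hz (hsub z hzB s hs)
    have hmv : κ * μ.real B * (t - 0) ≤ a t - a 0 := by
      refine Convex.mul_sub_le_image_sub_of_le_deriv (convex_Icc 0 t)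
        (fun s _ => (hder s).continuousAt.continuousWithinAt)
        (fun s _ => (hder s).differentiableAt.differentiableWithinAt) ?_ 0 ⟨le_rfl, ht⟩ t
        ⟨ht, le_rfl⟩ ht
      intro s hs
      rw [(hder s).deriv]
      exact hlow s (interior_subset hs)
    have hup : a t - a 0 ≤ (q (y + t • v) - q y + 2 * L * ρ) * μ.real B := by
      have h0 : a t - a 0 = ∫ z in B, (q (z + t • v) - q (z + (0 : ℝ) • v)) ∂μ :=
        (integral_sub (hint t) (hint 0)).symm
      have h1 : (q (y + t • v) - q y + 2 * L * ρ) * μ.real B =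
        ∫ z in B, (q (y + t • v) - q y + 2 * L * ρ) ∂μ := by simp [mul_comm]
      rw [h0, h1]
      refine integral_mono_ae ((hint t).sub (hint 0)) (integrable_const _) ?_
      filter_upwards [ae_restrict_mem measurableSet_ball] with z hz
      have hz' : dist z y ≤ ρ := (Metric.mem_ball.1 hz).le
      have e1 := hq.dist_le_mul (z + t • v) (y + t • v)
      have e2 := hq.dist_le_mul z y
      rw [dist_add_right] at e1
      rw [Real.dist_eq] at e1 e2
      have e3 : (L : ℝ) * dist z y ≤ L * ρ := by gcongr
      have := abs_le.1 e1
      have := abs_le.1 e2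
      simp only [zero_smul, add_zero]
      linarith
    rw [sub_zero] at hmv
    have := hmv.trans hup
    refine le_of_mul_le_mul_right ?_ hBpos
    linarith
  have hlim : Tendsto (fun ρ : ℝ => q (y + t • v) - q y + 2 * L * ρ) (𝓝[>] 0)
      (𝓝 (q (y + t • v) - q y + 2 * L * 0)) :=
    Tendsto.mono_left (Continuous.tendsto (by fun_prop) 0) nhdsWithin_le_nhds
  rw [mul_zero, add_zero] at hlim
  refine ge_of_tendsto hlim ?_
  filter_upwards [Ioo_mem_nhdsGT (lt_min hr₁ hr₂)] with ρ hρ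
  exact main ρ hρ.1 hρ.2

/-- The mean value inequality on a convex set with nonempty interior, tested at the points of
differentiability in the interior. -/
theorem mul_le_inner_sub_of_le_inner_fderiv {F : Type*} [NormedAddCommGroup F]
    [InnerProductSpace ℝ F] {f : E → F} {L : NNReal} {C : Set E} (hf : LipschitzOnWith L f C)
    [FiniteDimensional ℝ F]
    (hC : Convex ℝ C) (hCi : (interior C).Nonempty) {v : E} {w : F} {κ : ℝ}
    (h : ∀ u ∈ interior C, DifferentiableAt ℝ f u → κ ≤ inner ℝ w (fderiv ℝ f u v))
    {y : E} {t : ℝ} (ht : 0 ≤ t) (hy : y ∈ C) (hyt : y + t • v ∈ C) :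
    κ * t ≤ inner ℝ w (f (y + t • v) - f y) := by
  let _ : MeasurableSpace E := borel E
  have : BorelSpace E := ⟨rfl⟩
  set μ : Measure E := Measure.addHaar
  have hlip : LipschitzOnWith (‖w‖₊ * L) (fun u => inner ℝ w (f u)) C := by
    refine LipschitzOnWith.of_dist_le_mul fun x hx y hy => ?_
    rw [Real.dist_eq, ← inner_sub_right]
    refine (abs_real_inner_le_norm _ _).trans ?_
    rw [NNReal.coe_mul, coe_nnnorm, mul_assoc, ← dist_eq_norm]
    gcongr
    exact hf.dist_le_mul _ hx _ hy
  -- The preceding inequality wants a globally Lipschitz function; extending the scalar component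
  -- does not change its derivatives in the interior of `C`.
  obtain ⟨q, hq, hqe⟩ := hlip.extend_real
  have hae : ∀ᵐ u ∂μ, u ∈ interior C → κ ≤ fderiv ℝ q u v := by
    filter_upwards [hf.ae_differentiableWithinAt_of_mem (μ := μ)] with u hu huC
    have hCn : C ∈ 𝓝 u := mem_interior_iff_mem_nhds.1 huC
    have hd : DifferentiableAt ℝ f u := (hu (interior_subset huC)).differentiableAt hCn
    have he : q =ᶠ[𝓝 u] fun u => inner ℝ w (f u) := by
      filter_upwards [hCn] with x hx using (hqe hx).symm
    have h1 : HasFDerivAt (fun u => inner ℝ w (f u)) ((innerSL ℝ w).comp (fderiv ℝ f u)) u :=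
      (innerSL ℝ w).hasFDerivAt.comp u hd.hasFDerivAt
    rw [he.fderiv_eq, h1.fderiv]
    simpa using h u huC hd
  have hint : ∀ y' ∈ interior C, ∀ t' : ℝ, 0 ≤ t' → y' + t' • v ∈ interior C →
      κ * t' ≤ inner ℝ w (f (y' + t' • v) - f y') := by
    intro y' hy' t' ht' hyt'
    rw [inner_sub_right]
    have := mul_le_sub_of_ae_le_fderiv hq isOpen_interior hC.interior hae ht' hy' hyt'
    rwa [← hqe (interior_subset hy'), ← hqe (interior_subset hyt')] at this
  -- Segments that touch the boundary are contracted towards the interior point `z`: the direction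
  -- `v` is kept, the length becomes `(1 - s) t`, and `s` tends to zero.
  obtain ⟨z, hz⟩ := hCi
  have hlim : ∀ x ∈ C, Tendsto (fun s : ℝ => f (x + s • (z - x))) (𝓝[>] 0) (𝓝 (f x)) := by
    intro x hx
    have h1 : Tendsto (fun s : ℝ => x + s • (z - x)) (𝓝[>] 0) (𝓝 x) := by
      refine Tendsto.mono_left ?_ nhdsWithin_le_nhds
      have : Continuous fun s : ℝ => x + s • (z - x) := by fun_prop
      simpa using this.tendsto 0
    refine (hf.continuousOn x hx).tendsto.comp (tendsto_nhdsWithin_iff.2 ⟨h1, ?_⟩)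
    filter_upwards [Ioc_mem_nhdsGT one_pos] with s hs
    exact interior_subset (hC.add_smul_sub_mem_interior hx hz hs)
  have hl : Tendsto (fun s : ℝ => κ * ((1 - s) * t)) (𝓝[>] 0) (𝓝 (κ * ((1 - 0) * t))) :=
    Tendsto.mono_left (Continuous.tendsto (by fun_prop) 0) nhdsWithin_le_nhds
  have hr : Tendsto (fun s : ℝ => inner ℝ w (f (y + t • v + s • (z - (y + t • v))) -
      f (y + s • (z - y)))) (𝓝[>] 0) (𝓝 (inner ℝ w (f (y + t • v) - f y))) :=
    tendsto_const_nhds.inner ((hlim _ hyt).sub (hlim _ hy))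
  rw [sub_zero, one_mul] at hl
  refine le_of_tendsto_of_tendsto hl hr ?_
  filter_upwards [Ioc_mem_nhdsGT one_pos] with s hs
  have e : y + t • v + s • (z - (y + t • v)) = y + s • (z - y) + ((1 - s) * t) • v := by
    module
  have h1 := hC.add_smul_sub_mem_interior hyt hz hs
  have h2 := hC.add_smul_sub_mem_interior hy hz hs
  rw [e] at h1 ⊢
  exact hint _ h2 _ (mul_nonneg (sub_nonneg.2 hs.2) ht) h1

end MeanValue

end LipWhitney

namespace LipWhitney

/-! ### Bounds on increments tested by pairs of vectors -/

section Pairs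

variable {E F : Type*} [NormedAddCommGroup E] [InnerProductSpace ℝ E]
  [NormedAddCommGroup F] [InnerProductSpace ℝ F]

variable (E F) in
/-- The sets of test pairs that detect injectivity: one for each unit vector of the source. -/
def immPairs : Set (Set (E × F)) := {s | ∃ v : E, ‖v‖ = 1 ∧ s = {p | p.1 = v ∧ ‖p.2‖ ≤ 1}}

variable (E F) in
/-- The sets of test pairs that detect surjectivity: one for each unit vector of the target. -/
def subPairs : Set (Set (E × F)) := {s | ∃ w : F, ‖w‖ = 1 ∧ s = {p | ‖p.1‖ ≤ 1 ∧ p.2 = w}}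

/-- Each of the sets of test pairs in `T` contains a pair `(v, w)` such that all increments of `f`
in direction `v` within `K` have component at least `δ` in direction `w`. -/
def PairBound (T : Set (Set (E × F))) (f : E → F) (K : Set E) (δ : ℝ) : Prop :=
  ∀ s ∈ T, ∃ p ∈ s, ∀ y ∈ K, ∀ t : ℝ, 0 ≤ t → y + t • p.1 ∈ K →
    δ * t ≤ inner ℝ p.2 (f (y + t • p.1) - f y)

theorem norm_le_one_of_mem_immPairs {s : Set (E × F)} (hs : s ∈ immPairs E F) {p : E × F}
    (hp : p ∈ s) : ‖p.1‖ ≤ 1 ∧ ‖p.2‖ ≤ 1 := by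
  obtain ⟨v, hv, rfl⟩ := hs
  exact ⟨hp.1 ▸ hv.le, hp.2⟩

theorem norm_le_one_of_mem_subPairs {s : Set (E × F)} (hs : s ∈ subPairs E F) {p : E × F}
    (hp : p ∈ s) : ‖p.1‖ ≤ 1 ∧ ‖p.2‖ ≤ 1 := by
  obtain ⟨v, hv, rfl⟩ := hs
  exact ⟨hp.1, hp.2 ▸ hv.le⟩

theorem PairBound.mono {T : Set (Set (E × F))} {f : E → F} {K K' : Set E} {δ : ℝ}
    (h : PairBound T f K δ) (hK : K' ⊆ K) : PairBound T f K' δ := fun s hs =>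
  let ⟨p, hp, H⟩ := h s hs
  ⟨p, hp, fun y hy t ht hyt => H y (hK hy) t ht (hK hyt)⟩

/-- Test vectors have norm at most one, so the perturbation changes a tested increment by at most `ε
t`; the same test pairs still work. -/
theorem PairBound.of_lipschitz_sub {T : Set (Set (E × F))}
    (hT : ∀ s ∈ T, ∀ p ∈ s, ‖p.1‖ ≤ 1 ∧ ‖p.2‖ ≤ 1) {f g : E → F} {K : Set E} {δ : ℝ}
    (h : PairBound T f K δ) {ε : NNReal} (hg : LipschitzOnWith ε (g - f) K) :
    PairBound T g K (δ - ε) := by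
  intro s hs
  obtain ⟨p, hp, H⟩ := h s hs
  obtain ⟨h1, h2⟩ := hT s hs p hp
  refine ⟨p, hp, fun y hy t ht hyt => ?_⟩
  have e1 := H y hy t ht hyt
  have e2 : ‖(g - f) (y + t • p.1) - (g - f) y‖ ≤ ε * t := by
    rw [← dist_eq_norm]
    refine (hg.dist_le_mul _ hyt _ hy).trans ?_
    rw [dist_eq_norm, add_sub_cancel_left, norm_smul, Real.norm_of_nonneg ht]
    have : t * ‖p.1‖ ≤ t := mul_le_of_le_one_right ht h1
    gcongr
  have e3 : |inner ℝ p.2 ((g - f) (y + t • p.1) - (g - f) y)| ≤ ε * t := by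
    refine (abs_real_inner_le_norm _ _).trans ?_
    calc ‖p.2‖ * ‖(g - f) (y + t • p.1) - (g - f) y‖ ≤ 1 * (ε * t) := by gcongr
      _ = ε * t := one_mul _
  have e4 : g (y + t • p.1) - g y =
      (f (y + t • p.1) - f y) + ((g - f) (y + t • p.1) - (g - f) y) := by
    simp only [Pi.sub_apply]; abel
  rw [e4, inner_add_right]
  have := (abs_le.1 e3).1
  linarith

/-- A map with the injectivity bound on a convex set expands distances. -/
theorem PairBound.mul_norm_sub_le {f : E → F} {K : Set E} {δ : ℝ}
    (h : PairBound (immPairs E F) f K δ) {y z : E} (hy : y ∈ K) (hz : z ∈ K) :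
    δ * ‖z - y‖ ≤ ‖f z - f y‖ := by
  rcases eq_or_ne z y with rfl | hne
  · simp
  have hpos : 0 < ‖z - y‖ := norm_pos_iff.2 (sub_ne_zero.2 hne)
  obtain ⟨p, ⟨hp1, hp2⟩, H⟩ := h _ ⟨‖z - y‖⁻¹ • (z - y), by
    rw [norm_smul, norm_inv, norm_norm, inv_mul_cancel₀ hpos.ne'], rfl⟩
  have e : y + ‖z - y‖ • p.1 = z := by
    rw [hp1, smul_smul, mul_inv_cancel₀ hpos.ne', one_smul]; abel
  have := H y hy ‖z - y‖ hpos.le (by rwa [e])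
  rw [e] at this
  refine this.trans ((real_inner_le_norm _ _).trans ?_)
  exact mul_le_of_le_one_left (norm_nonneg _) hp2

end Pairs

/-! ### From pointwise lower bounds to uniform test vectors -/

section Limits

variable {X Y : Type*} [NormedAddCommGroup X] [InnerProductSpace ℝ X] [FiniteDimensional ℝ X]
  [NormedAddCommGroup Y] [InnerProductSpace ℝ Y] [FiniteDimensional ℝ Y]

/-- The point of the closure of `D` nearest to the origin, normalised, defines a hyperplane
separating `D` from the origin at distance at least `c`. -/
theorem exists_forall_le_inner_of_convex {D : Set Y} (hD : Convex ℝ D) {c : ℝ} (hc : 0 < c)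
    (h : ∀ z ∈ D, c ≤ ‖z‖) : ∃ y : Y, ‖y‖ ≤ 1 ∧ ∀ z ∈ D, c ≤ inner ℝ y z := by
  rcases D.eq_empty_or_nonempty with rfl | hne
  · exact ⟨0, by simp, by simp⟩
  obtain ⟨w, hw, hmin⟩ := exists_norm_eq_iInf_of_complete_convex (K := closure D) hne.closure
    isClosed_closure.isComplete hD.closure 0
  rw [norm_eq_iInf_iff_real_inner_le_zero hD.closure hw] at hmin
  have hcw : c ≤ ‖w‖ := by
    have : closure D ⊆ {z | c ≤ ‖z‖} :=
      closure_minimal h (isClosed_le continuous_const continuous_norm)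
    exact this hw
  have hpos : 0 < ‖w‖ := hc.trans_le hcw
  refine ⟨‖w‖⁻¹ • w, by rw [norm_smul, norm_inv, norm_norm, inv_mul_cancel₀ hpos.ne'], ?_⟩
  intro z hz
  have h1 := hmin z (subset_closure hz)
  rw [zero_sub, inner_neg_left, inner_sub_right, real_inner_self_eq_norm_sq] at h1
  rw [inner_smul_left]
  refine hcw.trans ?_
  rw [RCLike.conj_to_real, inv_mul_eq_div, le_div_iff₀ hpos]
  nlinarith

/-- If all limits of sequences in the sets `𝒜 i` belong to a convex set of linear maps that are
uniformly bounded from below, then each unit vector has a test vector that works for all elements of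
one of the sets `𝒜 i`. -/
theorem exists_forall_le_inner_of_limits {𝒜 : ℕ → Set (X →L[ℝ] Y)} {L : ℝ}
    (hb : ∀ i, ∀ B ∈ 𝒜 i, ‖B‖ ≤ L) {D : Set (X →L[ℝ] Y)} (hD : Convex ℝ D)
    (hlim : ∀ B : ℕ → X →L[ℝ] Y, (∀ i, B i ∈ 𝒜 i) → ∀ φ : ℕ → ℕ, StrictMono φ → ∀ B₀,
      Tendsto (B ∘ φ) atTop (𝓝 B₀) → B₀ ∈ D)
    {c : ℝ} (hc : 0 < c) (hDc : ∀ B ∈ D, ∀ x, c * ‖x‖ ≤ ‖B x‖) :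
    ∃ i, ∀ x : X, ‖x‖ = 1 → ∃ y : Y, ‖y‖ ≤ 1 ∧ ∀ B ∈ 𝒜 i, c / 2 ≤ inner ℝ y (B x) := by
  -- A failing unit vector is chosen for each `i`, with limit `x₀`. The vector `y` separating `{B x₀
  -- | B ∈ D}` from the origin must fail for each of them; the failing operators have a limit `B₀`
  -- in `D` with `⟨y, B₀ x₀⟩ ≤ c / 2`, contrary to `⟨y, B₀ x₀⟩ ≥ c`.
  by_contra! hcon
  choose x hx hxy using hcon
  obtain ⟨x₀, hx₀, φ, hφ, hφx⟩ := (isCompact_sphere (0 : X) 1).tendsto_subseq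
    (x := x) (fun i => by simpa using hx i)
  have hx₀' : ‖x₀‖ = 1 := by simpa using hx₀
  obtain ⟨y, hy, hyD⟩ := exists_forall_le_inner_of_convex
    (D := (fun B : X →L[ℝ] Y => B x₀) '' D) (c := c)
    (hD.linear_image (ContinuousLinearMap.apply ℝ Y x₀).toLinearMap) hc (by
      rintro _ ⟨B, hB, rfl⟩
      simpa [hx₀'] using hDc B hB x₀)
  choose B hB hBy using fun i => hxy i y hy
  obtain ⟨B₀, -, ψ, hψ, hψB⟩ := (isCompact_closedBall (0 : X →L[ℝ] Y) L).tendsto_subseq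
    (x := B ∘ φ) (fun i => by simpa using hb _ _ (hB (φ i)))
  have hB₀ : B₀ ∈ D := hlim B hB (φ ∘ ψ) (hφ.comp hψ) B₀ hψB
  have h1 : c ≤ inner ℝ y (B₀ x₀) := hyD _ ⟨B₀, hB₀, rfl⟩
  have h2 : Tendsto (fun i => inner ℝ y (B (φ (ψ i)) (x (φ (ψ i))))) atTop
      (𝓝 (inner ℝ y (B₀ x₀))) :=
    tendsto_const_nhds.inner ((isBoundedBilinearMap_apply.continuous.tendsto (B₀, x₀)).comp
      (hψB.prodMk_nhds (hφx.comp hψ.tendsto_atTop)))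
  have h3 : inner ℝ y (B₀ x₀) ≤ c / 2 :=
    le_of_tendsto h2 (Eventually.of_forall fun i => (hBy _).le)
  linarith

end Limits

/-! ### Increment bounds from the Clarke derivative -/

section Clarke

variable {E F : Type*} [NormedAddCommGroup E] [InnerProductSpace ℝ E] [FiniteDimensional ℝ E]
  [NormedAddCommGroup F] [InnerProductSpace ℝ F] [FiniteDimensional ℝ F]
  {f : E → F} {R U : Set E} {x : E}

theorem mul_le_inner_sub_of_forall_interior (hR : Convex ℝ R) (hRi : R ⊆ closure (interior R))
    {L : NNReal} {r δ : ℝ} (hL : LipschitzOnWith L f (Metric.ball x r ∩ R)) {v : E} {w : F}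
    (h : ∀ u ∈ Metric.ball x r ∩ interior R, DifferentiableAt ℝ f u →
      δ ≤ inner ℝ w (fderiv ℝ f u v)) :
    ∀ y ∈ Metric.ball x r ∩ R, ∀ t : ℝ, 0 ≤ t → y + t • v ∈ Metric.ball x r ∩ R →
      δ * t ≤ inner ℝ w (f (y + t • v) - f y) := by
  intro y hy t ht hyt
  have hint : interior (Metric.ball x r ∩ R) = Metric.ball x r ∩ interior R := by
    rw [interior_inter, Metric.isOpen_ball.interior_eq]
  refine mul_le_inner_sub_of_le_inner_fderiv hL ((convex_ball x r).inter hR) ?_ ?_ ht hy hyt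
  · rw [hint]
    exact mem_closure_iff.1 (hRi hy.2) _ Metric.isOpen_ball hy.1
  · rwa [hint]

/-- The derivatives of `f` at the interior points of `R` at distance less than `r` from `x`. -/
def derivsNear (f : E → F) (R : Set E) (x : E) (r : ℝ) : Set (E →L[ℝ] F) :=
  {A | ∃ u ∈ Metric.ball x r ∩ interior R, DifferentiableAt ℝ f u ∧ fderiv ℝ f u = A}

theorem norm_le_of_mem_derivsNear {L : NNReal} {r : ℝ}
    (hL : LipschitzOnWith L f (Metric.ball x r ∩ R)) {A : E →L[ℝ] F}
    (hA : A ∈ derivsNear f R x r) : ‖A‖ ≤ L := by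
  obtain ⟨u, hu, -, rfl⟩ := hA
  refine norm_fderiv_le_of_lipschitzOn ℝ ?_ hL
  exact inter_mem (Metric.isOpen_ball.mem_nhds hu.1) (mem_interior_iff_mem_nhds.1 hu.2)

/-- At interior points of `R` the derivative within `U` is the full derivative, so points chosen in
shrinking balls form an admissible sequence for the Clarke derivative. -/
theorem mem_clarkeDeriv_of_tendsto {r : ℝ} (hrU : Metric.ball x r ∩ R ⊆ U)
    {ρ : ℕ → ℝ} (hρr : ∀ i, ρ i ≤ r) (hρ : Tendsto ρ atTop (𝓝 0)) {B : ℕ → E →L[ℝ] F}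
    (hB : ∀ i, B i ∈ derivsNear f R x (ρ i)) {B₀ : E →L[ℝ] F} {φ : ℕ → ℕ} (hφ : StrictMono φ)
    (h : Tendsto (B ∘ φ) atTop (𝓝 B₀)) : B₀ ∈ clarkeDeriv f U x := by
  choose u hu hd he using hB
  have hUn : ∀ i, U ∈ 𝓝 (u i) := fun i =>
    mem_of_superset (inter_mem (Metric.isOpen_ball.mem_nhds
      (Metric.ball_subset_ball (hρr i) (hu i).1)) (mem_interior_iff_mem_nhds.1 (hu i).2)) hrU
  refine subset_convexHull _ _ ⟨u ∘ φ, fun i => ⟨mem_of_mem_nhds (hUn _),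
    (hd _).differentiableWithinAt⟩, ?_, ?_⟩
  · refine Tendsto.comp ?_ hφ.tendsto_atTop
    rw [tendsto_iff_dist_tendsto_zero]
    exact squeeze_zero (fun _ => dist_nonneg) (fun i => (Metric.mem_ball.1 (hu i).1).le) hρ
  · refine h.congr fun i => ?_
    simp only [comp_apply]
    rw [fderivWithin_of_mem_nhds (hUn _), he]

theorem exists_ball_lipschitzOnWith (hU : U ∈ 𝓝[R] x) (hxU : x ∈ U)
    (hf : LocallyLipschitzOn U f) :
    ∃ r > 0, ∃ L : NNReal, Metric.ball x r ∩ R ⊆ U ∧ LipschitzOnWith L f (Metric.ball x r ∩ R) := by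
  obtain ⟨L, t, ht, hL⟩ := hf hxU
  have : t ∩ U ∈ 𝓝[R] x := inter_mem (nhdsWithin_le_of_mem hU ht) hU
  obtain ⟨r, hr, hrt⟩ := Metric.mem_nhdsWithin_iff.1 this
  exact ⟨r, hr, L, fun y hy => (hrt hy).2, hL.mono fun y hy => (hrt hy).1⟩

/-- Near a point at which all elements of the Clarke derivative are bounded from below, the map
satisfies the uniform injectivity bound. -/
theorem exists_pairBound_immPairs (hR : Convex ℝ R) (hRi : R ⊆ closure (interior R))
    (hU : U ∈ 𝓝[R] x) (hxU : x ∈ U) (hf : LocallyLipschitzOn U f) {c : ℝ}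
    (hc : 0 < c) (hA : ∀ A ∈ clarkeDeriv f U x, ∀ v, c * ‖v‖ ≤ ‖A v‖) :
    ∃ r > 0, ∃ δ > 0, PairBound (immPairs E F) f (Metric.ball x r ∩ R) δ := by
  obtain ⟨r, hr, L, hrU, hL⟩ := exists_ball_lipschitzOnWith hU hxU hf
  -- Radii that shrink to zero while staying inside the ball on which `f` is Lipschitz; the
  -- compactness argument selects one of them.
  set ρ : ℕ → ℝ := fun i => min r (1 / ((i : ℝ) + 1)) with hρ
  have hρr : ∀ i, ρ i ≤ r := fun i => min_le_left _ _
  have hρ0 : ∀ i, 0 < ρ i := fun i => lt_min hr (by positivity)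
  have hρl : Tendsto ρ atTop (𝓝 0) :=
    squeeze_zero (fun i => (hρ0 i).le) (fun i => min_le_right _ _) tendsto_one_div_add_atTop_nhds_zero_nat
  have hLρ : ∀ i, LipschitzOnWith L f (Metric.ball x (ρ i) ∩ R) := fun i =>
    hL.mono (inter_subset_inter_left _ (Metric.ball_subset_ball (hρr i)))
  obtain ⟨i, hi⟩ := exists_forall_le_inner_of_limits (𝒜 := fun i => derivsNear f R x (ρ i))
    (L := L) (D := clarkeDeriv f U x) (fun i B hB => norm_le_of_mem_derivsNear (hLρ i) hB)
    (convex_convexHull _ _)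
    (fun B hB φ hφ B₀ hB₀ => mem_clarkeDeriv_of_tendsto hrU hρr hρl hB hφ hB₀) hc hA
  refine ⟨ρ i, hρ0 i, c / 2, by positivity, ?_⟩
  rintro _ ⟨v, hv, rfl⟩
  obtain ⟨w, hw, H⟩ := hi v hv
  exact ⟨(v, w), ⟨rfl, hw⟩, mul_le_inner_sub_of_forall_interior hR hRi (hLρ i)
    fun u hu hd => H _ ⟨u, hu, hd, rfl⟩⟩

/-- The injectivity argument applied to adjoints: transposition is linear and isometric, so it
preserves convexity, limits and norm bounds, and exchanges the roles of the two test vectors. -/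
theorem exists_pairBound_subPairs (hR : Convex ℝ R) (hRi : R ⊆ closure (interior R))
    (hU : U ∈ 𝓝[R] x) (hxU : x ∈ U) (hf : LocallyLipschitzOn U f) {c : ℝ}
    (hc : 0 < c) (hA : ∀ A ∈ clarkeDeriv f U x, ∀ w, c * ‖w‖ ≤ ‖A.adjoint w‖) :
    ∃ r > 0, ∃ δ > 0, PairBound (subPairs E F) f (Metric.ball x r ∩ R) δ := by
  obtain ⟨r, hr, L, hrU, hL⟩ := exists_ball_lipschitzOnWith hU hxU hf
  set ρ : ℕ → ℝ := fun i => min r (1 / ((i : ℝ) + 1)) with hρ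
  have hρr : ∀ i, ρ i ≤ r := fun i => min_le_left _ _
  have hρ0 : ∀ i, 0 < ρ i := fun i => lt_min hr (by positivity)
  have hρl : Tendsto ρ atTop (𝓝 0) :=
    squeeze_zero (fun i => (hρ0 i).le) (fun i => min_le_right _ _) tendsto_one_div_add_atTop_nhds_zero_nat
  have hLρ : ∀ i, LipschitzOnWith L f (Metric.ball x (ρ i) ∩ R) := fun i =>
    hL.mono (inter_subset_inter_left _ (Metric.ball_subset_ball (hρr i)))
  obtain ⟨i, hi⟩ := exists_forall_le_inner_of_limits
    (𝒜 := fun i => {B | B.adjoint ∈ derivsNear f R x (ρ i)})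
    (L := L) (D := {B : F →L[ℝ] E | B.adjoint ∈ clarkeDeriv f U x})
    (fun i B hB => by
      rw [← LinearIsometryEquiv.norm_map ContinuousLinearMap.adjoint B]
      exact norm_le_of_mem_derivsNear (hLρ i) hB)
    (by
      intro A hA B hB a b ha hb hab
      have := convex_convexHull ℝ _ hA hB ha hb hab
      simpa [clarkeDeriv] using this)
    (fun B hB φ hφ B₀ hB₀ => mem_clarkeDeriv_of_tendsto hrU hρr hρl hB hφ
      ((ContinuousLinearMap.adjoint.continuous.tendsto B₀).comp hB₀)) hc
    (fun B hB w => by simpa using hA _ hB w)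
  refine ⟨ρ i, hρ0 i, c / 2, by positivity, ?_⟩
  rintro _ ⟨w, hw, rfl⟩
  obtain ⟨v, hv, H⟩ := hi w hw
  refine ⟨(v, w), ⟨hv, rfl⟩, mul_le_inner_sub_of_forall_interior hR hRi (hLρ i)
    fun u hu hd => ?_⟩
  have := H (fderiv ℝ f u).adjoint (by simpa using ⟨u, hu, hd, rfl⟩)
  rwa [ContinuousLinearMap.adjoint_inner_right, real_inner_comm] at this

end Clarke

end LipWhitney

namespace LipWhitney

/-! ### Back from increments to Clarke derivatives, in arbitrary charts -/

section ChartChange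

variable {m n : ℕ} {H H' : Type*} [TopologicalSpace H] [TopologicalSpace H']
  {I : ModelWithCorners ℝ (EuclideanSpace ℝ (Fin m)) H}
  {J : ModelWithCorners ℝ (EuclideanSpace ℝ (Fin n)) H'}
  {M N : Type*} [TopologicalSpace M] [TopologicalSpace N] [ChartedSpace H M] [ChartedSpace H' N]

/-- In a half-space the sign of the relevant coordinate of `v` decides which of `v` and `-v` points
inwards. One-sided difference quotients thus reach every direction at boundary points. -/
theorem IsBoundaryModel.forall_add_mem_or (hI : IsBoundaryModel I)
    {u : EuclideanSpace ℝ (Fin m)} (hu : u ∈ range I) (v : EuclideanSpace ℝ (Fin m)) :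
    (∀ t : ℝ, 0 ≤ t → u + t • v ∈ range I) ∨ (∀ t : ℝ, 0 ≤ t → u - t • v ∈ range I) := by
  rcases hI with h | ⟨i, h⟩
  · left; intro t _; rw [h]; trivial
  · rw [h] at hu ⊢
    have hu' : 0 ≤ u i := hu
    rcases le_total 0 (v i) with hv | hv
    · left; intro t ht
      change 0 ≤ (u + t • v) i
      simp only [PiLp.add_apply, PiLp.smul_apply, smul_eq_mul]
      positivity
    · right; intro t ht
      change 0 ≤ (u - t • v) i
      simp only [PiLp.sub_apply, PiLp.smul_apply, smul_eq_mul]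
      nlinarith

theorem tendsto_slope_of_hasFDerivWithinAt
    {E F : Type*} [NormedAddCommGroup E] [NormedSpace ℝ E] [NormedAddCommGroup F] [NormedSpace ℝ F]
    {f : E → F} {B : E →L[ℝ] F} {R : Set E} {u : E} (hF : HasFDerivWithinAt f B R u)
    {K : Set E} (hK : K ∈ 𝓝[R] u) {v : E} (hv : ∀ t : ℝ, 0 ≤ t → u + t • v ∈ R) :
    Tendsto (fun t : ℝ => t⁻¹ • (f (u + t • v) - f u)) (𝓝[>] 0) (𝓝 (B v)) ∧
      ∀ᶠ t : ℝ in 𝓝[>] 0, u + t • v ∈ K := by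
  have hmem : ∀ᶠ t : ℝ in 𝓝[>] 0, u + t • v ∈ R := by
    filter_upwards [self_mem_nhdsWithin] with t ht using hv t (le_of_lt ht)
  have hl : Tendsto (fun t : ℝ => u + t • v) (𝓝[>] 0) (𝓝 u) := by
    refine Tendsto.mono_left ?_ nhdsWithin_le_nhds
    have : Continuous fun t : ℝ => u + t • v := by fun_prop
    simpa using this.tendsto 0
  refine ⟨?_, (tendsto_nhdsWithin_iff.2 ⟨hl, hmem⟩).eventually hK⟩
  have hd : HasDerivWithinAt (fun t : ℝ => f (u + t • v)) (B v) (Ici 0) 0 := by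
    have h1 : HasDerivWithinAt (fun t : ℝ => u + t • v) v (Ici 0) 0 := by
      simpa using (((hasDerivAt_id (0 : ℝ)).smul_const v).const_add u).hasDerivWithinAt
    have hF' : HasFDerivWithinAt f B R (u + (0 : ℝ) • v) := by simpa using hF
    exact hF'.comp_hasDerivWithinAt 0 h1 fun t ht => hv t ht
  have := (hasDerivWithinAt_iff_tendsto_slope' (by simp : (0:ℝ) ∉ Ioi 0)).1
    (hd.mono Ioi_subset_Ici_self)
  refine this.congr fun t => ?_
  simp [slope_def_module]

/-- A bound on increments passes to the derivatives, at boundary points too. -/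
theorem IsBoundaryModel.le_inner_of_hasFDerivWithinAt (hI : IsBoundaryModel I)
    {F : EuclideanSpace ℝ (Fin m) → EuclideanSpace ℝ (Fin n)}
    {B : EuclideanSpace ℝ (Fin m) →L[ℝ] EuclideanSpace ℝ (Fin n)}
    {u : EuclideanSpace ℝ (Fin m)} (hu : u ∈ range I) (hF : HasFDerivWithinAt F B (range I) u)
    {K : Set (EuclideanSpace ℝ (Fin m))} (hK : K ∈ 𝓝[range I] u) {δ : ℝ}
    {v : EuclideanSpace ℝ (Fin m)} {w : EuclideanSpace ℝ (Fin n)}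
    (h : ∀ y ∈ K, ∀ t : ℝ, 0 ≤ t → y + t • v ∈ K → δ * t ≤ inner ℝ w (F (y + t • v) - F y)) :
    δ ≤ inner ℝ w (B v) := by
  have huK : u ∈ K := mem_of_mem_nhdsWithin hu hK
  rcases hI.forall_add_mem_or hu v with hv | hv
  · obtain ⟨h1, h2⟩ := tendsto_slope_of_hasFDerivWithinAt hF hK hv
    refine ge_of_tendsto (tendsto_const_nhds.inner h1 : Tendsto (fun t : ℝ => inner ℝ w
      (t⁻¹ • (F (u + t • v) - F u))) _ _) ?_
    filter_upwards [h2, self_mem_nhdsWithin] with t ht ht0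
    have ht0' : 0 < t := ht0
    rw [inner_smul_right, inv_mul_eq_div, le_div_iff₀ ht0']
    exact h u huK t ht0'.le ht
  -- Only `-v` is admissible here, so the bound is applied to the increment that starts at `u - t v`
  -- and ends at `u`.
  · obtain ⟨h1, h2⟩ := tendsto_slope_of_hasFDerivWithinAt hF hK (v := -v)
      (by simpa [sub_eq_add_neg] using hv)
    rw [map_neg] at h1
    have h3 : Tendsto (fun t : ℝ => inner ℝ w (-(t⁻¹ • (F (u + t • -v) - F u)))) (𝓝[>] 0)
      (𝓝 (inner ℝ w (B v))) := tendsto_const_nhds.inner (by simpa using h1.neg)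
    refine ge_of_tendsto h3 ?_
    filter_upwards [h2, self_mem_nhdsWithin] with t ht ht0
    have ht0' : 0 < t := ht0
    rw [← smul_neg, inner_smul_right, inv_mul_eq_div, le_div_iff₀ ht0', neg_sub]
    have := h (u + t • -v) ht t ht0'.le (by simpa using huK)
    simpa using this

/-- The derivative of an expanding map is bounded from below, at boundary points too. -/
theorem IsBoundaryModel.mul_norm_le_of_hasFDerivWithinAt (hI : IsBoundaryModel I)
    {F : EuclideanSpace ℝ (Fin m) → EuclideanSpace ℝ (Fin n)}
    {B : EuclideanSpace ℝ (Fin m) →L[ℝ] EuclideanSpace ℝ (Fin n)}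
    {u : EuclideanSpace ℝ (Fin m)} (hu : u ∈ range I) (hF : HasFDerivWithinAt F B (range I) u)
    {K : Set (EuclideanSpace ℝ (Fin m))} (hK : K ∈ 𝓝[range I] u) {δ : ℝ}
    (h : ∀ y ∈ K, ∀ z ∈ K, δ * ‖y - z‖ ≤ ‖F y - F z‖) (v : EuclideanSpace ℝ (Fin m)) :
    δ * ‖v‖ ≤ ‖B v‖ := by
  have huK : u ∈ K := mem_of_mem_nhdsWithin hu hK
  have key : ∀ v : EuclideanSpace ℝ (Fin m), (∀ t : ℝ, 0 ≤ t → u + t • v ∈ range I) →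
      δ * ‖v‖ ≤ ‖B v‖ := by
    intro v hv
    obtain ⟨h1, h2⟩ := tendsto_slope_of_hasFDerivWithinAt hF hK hv
    refine ge_of_tendsto h1.norm ?_
    filter_upwards [h2, self_mem_nhdsWithin] with t ht ht0
    have ht0' : 0 < t := ht0
    rw [norm_smul, norm_inv, Real.norm_of_nonneg ht0'.le, inv_mul_eq_div, le_div_iff₀ ht0']
    have := h _ ht u huK
    rw [add_sub_cancel_left, norm_smul, Real.norm_of_nonneg ht0'.le] at this
    linarith
  rcases hI.forall_add_mem_or hu v with hv | hv
  · exact key v hv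
  · simpa using key (-v) (by simpa [sub_eq_add_neg] using hv)

theorem continuousWithinAt_fderivWithin_extendCoordChange
    {φ φ' : OpenPartialHomeomorph M H} (hφ : φ ∈ IsManifold.maximalAtlas I ∞ M)
    (hφ' : φ' ∈ IsManifold.maximalAtlas I ∞ M) {u : EuclideanSpace ℝ (Fin m)}
    (hu : u ∈ (I.extendCoordChange φ φ').source) :
    ContinuousWithinAt (fderivWithin ℝ (I.extendCoordChange φ φ') (range I)) (range I) u := by
  have h1 := I.contDiffWithinAt_extendCoordChange hφ hφ' hu
  have huR : u ∈ range I := by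
    rw [I.extendCoordChange_source] at hu
    exact image_subset_range _ _ hu
  exact (h1.fderivWithin_right (m := 0) I.uniqueDiffOn (by simp) huR).continuousWithinAt

theorem isInvertible_fderivWithin_range_extendCoordChange
    {φ φ' : OpenPartialHomeomorph M H} (hφ : φ ∈ IsManifold.maximalAtlas I ∞ M)
    (hφ' : φ' ∈ IsManifold.maximalAtlas I ∞ M) {u : EuclideanSpace ℝ (Fin m)}
    (hu : u ∈ (I.extendCoordChange φ φ').source) :
    (fderivWithin ℝ (I.extendCoordChange φ φ') (range I) u).IsInvertible := by
  have h1 := I.isInvertible_fderivWithin_extendCoordChange (by simp) hφ hφ' hu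
  have h2 : fderivWithin ℝ (I.extendCoordChange φ φ') (I.extendCoordChange φ φ').source u =
      fderivWithin ℝ (I.extendCoordChange φ φ') (range I) u :=
    fderivWithin_of_mem_nhdsWithin
      (mem_of_superset self_mem_nhdsWithin (by
        rw [I.extendCoordChange_source]
        exact image_subset_range _ _)) (I.uniqueDiffOn_extendCoordChange_source u hu)
      ((I.contDiffWithinAt_extendCoordChange hφ hφ' hu).differentiableWithinAt (by simp))
  rwa [h2] at h1

theorem hasFDerivWithinAt_localRep_of_chartChange {f : M → N}
    {φ φ' : OpenPartialHomeomorph M H} (hφ : φ ∈ IsManifold.maximalAtlas I ∞ M)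
    (hφ' : φ' ∈ IsManifold.maximalAtlas I ∞ M)
    {ψ ψ' : OpenPartialHomeomorph N H'} (hψ : ψ ∈ IsManifold.maximalAtlas J ∞ N)
    (hψ' : ψ' ∈ IsManifold.maximalAtlas J ∞ N) (hfs : MapsTo f φ'.source ψ'.source)
    {q : M} (hq : q ∈ φ.source) (hq' : q ∈ φ'.source) (hfq : f q ∈ ψ.source)
    {A : EuclideanSpace ℝ (Fin m) →L[ℝ] EuclideanSpace ℝ (Fin n)}
    (hA : HasFDerivWithinAt (localRep I J φ' ψ' f) A (range I) (φ'.extend I q)) :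
    HasFDerivWithinAt (localRep I J φ ψ f)
      ((fderivWithin ℝ (J.extendCoordChange ψ' ψ) (range J) (ψ'.extend J (f q))).comp
        (A.comp (fderivWithin ℝ (I.extendCoordChange φ φ') (range I) (φ.extend I q))))
      (range I) (φ.extend I q) := by
  have hS : φ.extend I q ∈ (I.extendCoordChange φ φ').source := by
    rw [← OpenPartialHomeomorph.extend_image_source_inter]
    exact mem_image_of_mem _ ⟨hq, hq'⟩
  have hT : ψ'.extend J (f q) ∈ (J.extendCoordChange ψ' ψ).source := by
    rw [← OpenPartialHomeomorph.extend_image_source_inter]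
    exact mem_image_of_mem _ ⟨hfs hq', hfq⟩
  have hSq : I.extendCoordChange φ φ' (φ.extend I q) = φ'.extend I q := by
    simp [hq]
  have hFq : localRep I J φ' ψ' f (φ'.extend I q) = ψ'.extend J (f q) := by
    simp [localRep, hq']
  have dS := ((I.contDiffWithinAt_extendCoordChange hφ hφ' hS).differentiableWithinAt
    (by simp)).hasFDerivWithinAt
  have dT := ((J.contDiffWithinAt_extendCoordChange hψ' hψ hT).differentiableWithinAt
    (by simp)).hasFDerivWithinAt
  rw [← hSq] at hA
  have d1 := hA.comp (φ.extend I q) dS fun u _ => by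
    simp
  rw [← hFq, ← hSq] at dT
  have d2 := dT.comp (φ.extend I q) d1 fun u _ => by
    simp [localRep]
  rw [hSq, hFq] at d2
  refine d2.congr_of_eventuallyEq ?_ ?_
  · filter_upwards [I.extendCoordChange_source_mem_nhdsWithin hS] with u hu
    rw [← OpenPartialHomeomorph.extend_image_source_inter] at hu
    obtain ⟨z, ⟨hz, hz'⟩, rfl⟩ := hu
    simp [localRep, hz, hz', hfs hz']
  · simp [localRep, hq, hq', hfs hq']

/-- A bound on increments in one pair of charts passes to the elements of the Clarke derivative
in any pair of charts. -/
theorem IsBoundaryModel.exists_forall_clarkeDeriv (hI : IsBoundaryModel I) {f : M → N}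
    (hf : Continuous f)
    {φ φ' : OpenPartialHomeomorph M H} (hφ : φ ∈ IsManifold.maximalAtlas I ∞ M)
    (hφ' : φ' ∈ IsManifold.maximalAtlas I ∞ M)
    {ψ ψ' : OpenPartialHomeomorph N H'} (hψ : ψ ∈ IsManifold.maximalAtlas J ∞ N)
    (hψ' : ψ' ∈ IsManifold.maximalAtlas J ∞ N) (hfs : MapsTo f φ'.source ψ'.source)
    {p : M} (hp : p ∈ φ.source) (hp' : p ∈ φ'.source) (hfp : f p ∈ ψ.source)
    {K : Set (EuclideanSpace ℝ (Fin m))} (hK : K ∈ 𝓝[range I] (φ.extend I p)) {δ : ℝ}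
    {T : Set (Set (EuclideanSpace ℝ (Fin m) × EuclideanSpace ℝ (Fin n)))}
    (h : PairBound T (localRep I J φ ψ f) K δ) :
    ∃ P : EuclideanSpace ℝ (Fin n) →L[ℝ] EuclideanSpace ℝ (Fin n),
    ∃ Q : EuclideanSpace ℝ (Fin m) →L[ℝ] EuclideanSpace ℝ (Fin m),
      P.IsInvertible ∧ Q.IsInvertible ∧
      ∀ A ∈ clarkeDeriv (localRep I J φ' ψ' f) (φ'.extend I).target (φ'.extend I p),
        ∀ s ∈ T, ∃ a ∈ s, δ ≤ inner ℝ a.2 (P (A (Q a.1))) := by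
  have hS : φ.extend I p ∈ (I.extendCoordChange φ φ').source := by
    rw [← OpenPartialHomeomorph.extend_image_source_inter]
    exact mem_image_of_mem _ ⟨hp, hp'⟩
  have hT : ψ'.extend J (f p) ∈ (J.extendCoordChange ψ' ψ).source := by
    rw [← OpenPartialHomeomorph.extend_image_source_inter]
    exact mem_image_of_mem _ ⟨hfs hp', hfp⟩
  refine ⟨_, _, isInvertible_fderivWithin_range_extendCoordChange hψ' hψ hT,
    isInvertible_fderivWithin_range_extendCoordChange hφ hφ' hS, ?_⟩
  set P := fderivWithin ℝ (J.extendCoordChange ψ' ψ) (range J) (ψ'.extend J (f p)) with hP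
  set Q := fderivWithin ℝ (I.extendCoordChange φ φ') (range I) (φ.extend I p) with hQ
  intro A hA s hs
  obtain ⟨a, has, H⟩ := h s hs
  refine ⟨a, has, ?_⟩
  -- The pair `a` is the same for all points of `K`. Hence the desired inequality cuts out a
  -- half-space of operators, and it suffices to check the limits that generate the convex hull.
  have hconv : Convex ℝ {A : EuclideanSpace ℝ (Fin m) →L[ℝ] EuclideanSpace ℝ (Fin n) |
      δ ≤ inner ℝ a.2 (P (A (Q a.1)))} := by
    have : IsLinearMap ℝ fun A : EuclideanSpace ℝ (Fin m) →L[ℝ] EuclideanSpace ℝ (Fin n) =>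
        (inner ℝ a.2 (P (A (Q a.1))) : ℝ) :=
      ⟨fun A B => by simp [inner_add_right], fun c A => by simp [inner_smul_right]⟩
    exact convex_halfSpace_ge this δ
  refine convexHull_min ?_ hconv hA
  rintro A ⟨u', hu', hu'l, hAl⟩
  -- the corresponding points of `M`
  set q : ℕ → M := fun i => (φ'.extend I).symm (u' i) with hq
  have hq' : ∀ i, q i ∈ φ'.source := fun i => by
    have := (φ'.extend I).map_target (hu' i).1
    rwa [φ'.extend_source] at this
  have hqu : ∀ i, φ'.extend I (q i) = u' i := fun i => (φ'.extend I).right_inv (hu' i).1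
  have hql : Tendsto q atTop (𝓝 p) := by
    have h1 : ContinuousAt (φ'.extend I).symm (φ'.extend I p) := φ'.continuousAt_extend_symm hp'
    have h2 : Tendsto q atTop (𝓝 ((φ'.extend I).symm (φ'.extend I p))) := h1.tendsto.comp hu'l
    rwa [φ'.extend_left_inv hp'] at h2
  have e1 : ∀ᶠ i in atTop, q i ∈ φ.source := hql.eventually (φ.open_source.mem_nhds hp)
  have e2 : ∀ᶠ i in atTop, f (q i) ∈ ψ.source :=
    ((hf.tendsto p).comp hql).eventually (ψ.open_source.mem_nhds hfp)
  have hul : Tendsto (fun i => φ.extend I (q i)) atTop (𝓝[range I] (φ.extend I p)) := by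
    refine tendsto_nhdsWithin_iff.2 ⟨(φ.continuousAt_extend hp).tendsto.comp hql, ?_⟩
    exact Eventually.of_forall fun i => by simp
  have e3 : ∀ᶠ i in atTop, K ∈ 𝓝[range I] (φ.extend I (q i)) :=
    hul.eventually (eventually_eventually_nhdsWithin.2 hK)
  have hfl : Tendsto (fun i => ψ'.extend J (f (q i))) atTop (𝓝[range J] (ψ'.extend J (f p))) := by
    refine tendsto_nhdsWithin_iff.2
      ⟨(ψ'.continuousAt_extend (hfs hp')).tendsto.comp ((hf.tendsto p).comp hql), ?_⟩
    exact Eventually.of_forall fun i => by simp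
  -- Along the sequence the derivative in the charts `φ`, `ψ` is the given one composed with
  -- derivatives of the chart changes. These are continuous, so the inequality at the points `q i`
  -- passes to `P`, `A`, `Q`.
  have l1 := (continuousWithinAt_fderivWithin_extendCoordChange hψ' hψ hT).tendsto.comp hfl
  have l2 := (continuousWithinAt_fderivWithin_extendCoordChange hφ hφ' hS).tendsto.comp hul
  have l3 := (isBoundedBilinearMap_comp.continuous.tendsto (P, A.comp Q)).comp (l1.prodMk_nhds
    ((isBoundedBilinearMap_comp.continuous.tendsto (A, Q)).comp (hAl.prodMk_nhds l2)))
  have l4 : Tendsto _ atTop (𝓝 (inner ℝ a.2 (P (A (Q a.1))))) :=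
    (tendsto_const_nhds (x := a.2)).inner (((ContinuousLinearMap.apply ℝ _ a.1).continuous.tendsto _).comp l3)
  refine ge_of_tendsto l4 ?_
  filter_upwards [e1, e2, e3] with i h1 h2 h3
  have hd : HasFDerivWithinAt (localRep I J φ' ψ' f)
      (fderivWithin ℝ (localRep I J φ' ψ' f) (φ'.extend I).target (u' i)) (range I)
      (φ'.extend I (q i)) := by
    rw [hqu]
    refine (hu' i).2.hasFDerivWithinAt.mono_of_mem_nhdsWithin ?_
    have := φ'.extend_target_mem_nhdsWithin (I := I) (hq' i)
    rwa [hqu] at this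
  have := hasFDerivWithinAt_localRep_of_chartChange hφ hφ' hψ hψ' hfs h1 (hq' i) h2 hd
  exact hI.le_inner_of_hasFDerivWithinAt (by simp) this h3 H

variable [IsManifold I ∞ M] [IsManifold J ∞ N]

/-- Near each point, the coordinate expression of `f` in some pair of charts satisfies the bound on
increments given by `T`. -/
def HasPairBound (I : ModelWithCorners ℝ (EuclideanSpace ℝ (Fin m)) H)
    (J : ModelWithCorners ℝ (EuclideanSpace ℝ (Fin n)) H')
    (T : Set (Set (EuclideanSpace ℝ (Fin m) × EuclideanSpace ℝ (Fin n)))) (f : M → N) : Prop :=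
  ∀ p : M, ∃ φ ∈ IsManifold.maximalAtlas I ∞ M, ∃ ψ ∈ IsManifold.maximalAtlas J ∞ N,
    p ∈ φ.source ∧ f p ∈ ψ.source ∧ ∃ K ∈ 𝓝[range I] (φ.extend I p), ∃ δ > 0,
      PairBound T (localRep I J φ ψ f) K δ

/-- A lower bound for `P A Q` gives one for `A` that depends on `A` only through `δ`; this
uniformity is what the Clarke rank condition needs. Adding one to the norms keeps the denominator
positive. -/
theorem mul_norm_le_of_comp {E₁ E₂ E₃ E₄ : Type*} [NormedAddCommGroup E₁] [NormedSpace ℝ E₁]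
    [NormedAddCommGroup E₂] [NormedSpace ℝ E₂] [NormedAddCommGroup E₃] [NormedSpace ℝ E₃]
    [NormedAddCommGroup E₄] [NormedSpace ℝ E₄] {P : E₃ →L[ℝ] E₄} {Q : E₁ →L[ℝ] E₂}
    (hQ : Surjective Q) {A : E₂ →L[ℝ] E₃} {δ : ℝ} (hδ : 0 < δ)
    (h : ∀ v, ‖v‖ = 1 → δ ≤ ‖P (A (Q v))‖) (x : E₂) :
    δ / ((‖P‖ + 1) * (‖Q‖ + 1)) * ‖x‖ ≤ ‖A x‖ := by
  obtain ⟨v, rfl⟩ := hQ x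
  rcases eq_or_ne v 0 with rfl | hv
  · simp
  have hpos : 0 < ‖v‖ := norm_pos_iff.2 hv
  have h1 := h (‖v‖⁻¹ • v) (by rw [norm_smul, norm_inv, norm_norm, inv_mul_cancel₀ hpos.ne'])
  simp only [map_smul, norm_smul, norm_inv, norm_norm] at h1
  rw [inv_mul_eq_div, le_div_iff₀ hpos] at h1
  rw [div_mul_eq_mul_div, div_le_iff₀ (by positivity)]
  have h2 : ‖Q v‖ ≤ (‖Q‖ + 1) * ‖v‖ := (Q.le_opNorm v).trans (by gcongr; linarith)
  have h3 : ‖P (A (Q v))‖ ≤ (‖P‖ + 1) * ‖A (Q v)‖ := (P.le_opNorm _).trans (by gcongr; linarith)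
  calc δ * ‖Q v‖ ≤ δ * ((‖Q‖ + 1) * ‖v‖) := by gcongr
    _ = (‖Q‖ + 1) * (δ * ‖v‖) := by ring
    _ ≤ (‖Q‖ + 1) * ((‖P‖ + 1) * ‖A (Q v)‖) :=
      mul_le_mul_of_nonneg_left (h1.trans h3) (by positivity)
    _ = _ := by ring

theorem HasPairBound.hasClarkeRank_of_immPairs (hI : IsBoundaryModel I) {k : ℕ}
    {f : CkLip I J M N k} (hf : HasPairBound I J (immPairs _ _) f.toFun) :
    HasClarkeRank I J M N k m f := by
  intro φ' hφ' ψ' hψ' hfs x hx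
  obtain ⟨φ, hφ, ψ, hψ, hp, hfp, K, hK, δ, hδ, hb⟩ := hf ((φ'.extend I).symm x)
  have hp' : (φ'.extend I).symm x ∈ φ'.source := by
    simpa only [φ'.extend_source] using (φ'.extend I).map_target hx
  obtain ⟨P, Q, hP, hQ, H⟩ := hI.exists_forall_clarkeDeriv f.isCkLip.1.continuous hφ hφ' hψ hψ'
    hfs hp hp' hfp hK hb
  rw [(φ'.extend I).right_inv hx] at H
  refine ⟨δ / ((‖P‖ + 1) * (‖Q‖ + 1)), by positivity, fun A hA j hj => ?_⟩
  refine (le_singularValues_iff _ (by positivity)).2 (fun x => ?_) j (by simpa using hj)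
  refine mul_norm_le_of_comp hQ.surjective hδ (fun v hv => ?_) x
  obtain ⟨a, ⟨ha1, ha2⟩, ha⟩ := H A hA _ ⟨v, hv, rfl⟩
  rw [← ha1]
  refine ha.trans ((real_inner_le_norm _ _).trans ?_)
  exact mul_le_of_le_one_left (norm_nonneg _) ha2

theorem HasPairBound.hasClarkeRank_of_subPairs (hI : IsBoundaryModel I) {k : ℕ}
    {f : CkLip I J M N k} (hf : HasPairBound I J (subPairs _ _) f.toFun) :
    HasClarkeRank I J M N k n f := by
  intro φ' hφ' ψ' hψ' hfs x hx
  obtain ⟨φ, hφ, ψ, hψ, hp, hfp, K, hK, δ, hδ, hb⟩ := hf ((φ'.extend I).symm x)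
  have hp' : (φ'.extend I).symm x ∈ φ'.source := by
    simpa only [φ'.extend_source] using (φ'.extend I).map_target hx
  obtain ⟨P, Q, hP, hQ, H⟩ := hI.exists_forall_clarkeDeriv f.isCkLip.1.continuous hφ hφ' hψ hψ'
    hfs hp hp' hfp hK hb
  rw [(φ'.extend I).right_inv hx] at H
  refine ⟨δ / ((‖Q.adjoint‖ + 1) * (‖P.adjoint‖ + 1)), by positivity, fun A hA j hj => ?_⟩
  refine (le_singularValues_iff_adjoint _ (by positivity)).2 (fun x => ?_) j (by simpa using hj)
  -- For surjectivity the operator is transposed to `Q* A* P*`, so `P*` now takes the role that `Q`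
  -- has for immersions.
  have hPs : Surjective P.adjoint := by
    obtain ⟨e, rfl⟩ := hP
    intro y
    refine ⟨((e.symm : _ →L[ℝ] _).adjoint y), ?_⟩
    rw [← ContinuousLinearMap.comp_apply, ← ContinuousLinearMap.adjoint_comp]
    refine ext_inner_left ℝ fun z => ?_
    simp [ContinuousLinearMap.adjoint_inner_right]
  change _ ≤ ‖A.adjoint x‖
  refine mul_norm_le_of_comp (P := Q.adjoint) (Q := P.adjoint) hPs hδ (fun w hw => ?_) x
  obtain ⟨a, ⟨ha1, ha2⟩, ha⟩ := H A hA _ ⟨w, hw, rfl⟩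
  rw [← ha2]
  rw [← ContinuousLinearMap.adjoint_inner_left, ← ContinuousLinearMap.adjoint_inner_left,
    ← ContinuousLinearMap.adjoint_inner_left] at ha
  refine ha.trans ((real_inner_le_norm _ _).trans ?_)
  exact mul_le_of_le_one_right (norm_nonneg _) ha1

end ChartChange

end LipWhitney

namespace LipWhitney

/-! ### Coordinate expressions in preferred charts -/

section Representatives

variable {m n : ℕ} {H H' : Type*} [TopologicalSpace H] [TopologicalSpace H']
  {I : ModelWithCorners ℝ (EuclideanSpace ℝ (Fin m)) H}
  {J : ModelWithCorners ℝ (EuclideanSpace ℝ (Fin n)) H'}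
  {M N : Type*} [TopologicalSpace M] [TopologicalSpace N] [ChartedSpace H M] [ChartedSpace H' N]
  [IsManifold I ∞ M] [IsManifold J ∞ N]

/-- The coordinate expression of `f` around `p` in the preferred charts at `p` and `f p`. -/
noncomputable abbrev repAt (I : ModelWithCorners ℝ (EuclideanSpace ℝ (Fin m)) H)
    (J : ModelWithCorners ℝ (EuclideanSpace ℝ (Fin n)) H') (f : M → N) (p : M) :
    EuclideanSpace ℝ (Fin m) → EuclideanSpace ℝ (Fin n) :=
  localRep I J (chartAt H p) (chartAt H' (f p)) f

theorem localDomain_mem_nhdsWithin {f : M → N} (hf : Continuous f)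
    {φ : OpenPartialHomeomorph M H} {ψ : OpenPartialHomeomorph N H'} {x : EuclideanSpace ℝ (Fin m)}
    (hx : x ∈ localDomain I φ ψ f) : localDomain I φ ψ f ∈ 𝓝[range I] x := by
  obtain ⟨hx1, hx2⟩ := hx
  obtain ⟨p, hp, rfl⟩ : x ∈ φ.extend I '' φ.source := by
    rwa [← φ.extend_target_eq_image_source]
  rw [φ.extend_left_inv hp] at hx2
  refine inter_mem (φ.extend_target_mem_nhdsWithin hp) ?_
  have h1 : (φ.extend I).symm ⁻¹' (φ.source ∩ f ⁻¹' ψ.source) ∈ 𝓝 (φ.extend I p) :=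
    φ.extend_preimage_mem_nhds hp
      (inter_mem (φ.open_source.mem_nhds hp) ((ψ.open_source.preimage hf).mem_nhds hx2))
  exact mem_nhdsWithin_of_mem_nhds (mem_of_superset h1 fun y hy => hy.2)

theorem extend_mem_localDomain {f : M → N} {φ : OpenPartialHomeomorph M H}
    {ψ : OpenPartialHomeomorph N H'} {p : M} (hp : p ∈ φ.source) (hfp : f p ∈ ψ.source) :
    φ.extend I p ∈ localDomain I φ ψ f := by
  refine ⟨(φ.extend I).map_source (by rwa [φ.extend_source]), ?_⟩
  rwa [φ.extend_left_inv hp]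

theorem localDomain_subset_range {f : M → N} {φ : OpenPartialHomeomorph M H}
    {ψ : OpenPartialHomeomorph N H'} : localDomain I φ ψ f ⊆ range I :=
  fun _ hx => φ.extend_target_subset_range hx.1

/-- A map whose coordinate expressions are locally Lipschitz. -/
def LipInCharts (I : ModelWithCorners ℝ (EuclideanSpace ℝ (Fin m)) H)
    (J : ModelWithCorners ℝ (EuclideanSpace ℝ (Fin n)) H') (f : M → N) : Prop :=
  ∀ φ ∈ IsManifold.maximalAtlas I ∞ M, ∀ ψ ∈ IsManifold.maximalAtlas J ∞ N,
    LocallyLipschitzOn (localDomain I φ ψ f) (localRep I J φ ψ f)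

theorem ContMDiff.contDiffOn_localRep {k : WithTop ℕ∞} {f : M → N} (hf : ContMDiff I J k f)
    (hk : k ≤ (∞ : WithTop ℕ∞)) {φ : OpenPartialHomeomorph M H} (hφ : φ ∈ IsManifold.maximalAtlas I ∞ M)
    {ψ : OpenPartialHomeomorph N H'} (hψ : ψ ∈ IsManifold.maximalAtlas J ∞ N) :
    ContDiffOn ℝ k (localRep I J φ ψ f) (localDomain I φ ψ f) := by
  have hs : φ.source ∩ f ⁻¹' ψ.source ⊆ φ.source := inter_subset_left
  have := (contMDiffOn_iff_of_mem_maximalAtlas' (n := k)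
    (IsManifold.maximalAtlas_subset_of_le hk hφ) (IsManifold.maximalAtlas_subset_of_le hk hψ)
    hs (fun x hx => hx.2)).1 (hf.contMDiffOn (s := φ.source ∩ f ⁻¹' ψ.source))
  refine this.mono ?_
  rintro x ⟨hx1, hx2⟩
  refine ⟨(φ.extend I).symm x, ⟨?_, hx2⟩, (φ.extend I).right_inv hx1⟩
  simpa only [φ.extend_source] using (φ.extend I).map_target hx1

/-- For `k = 0` this is the definition, the zeroth derivative being the map up to an isometry. For
`k ≥ 1` a `C¹` map is locally Lipschitz because the range of the model is convex. -/
theorem IsCkLip.lipInCharts {k : ℕ} {f : M → N}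
    (hf : IsCkLip I J k f) : LipInCharts I J f := by
  intro φ hφ ψ hψ
  rcases k.eq_zero_or_pos with rfl | hk
  · intro x hx
    obtain ⟨L, t, ht, hL⟩ := hf.2 φ hφ ψ hψ hx
    refine ⟨L, t, ht, fun y hy z hz => ?_⟩
    have := hL hy hz
    rwa [iteratedFDerivWithin_zero_eq_comp, comp_apply, comp_apply,
      LinearIsometryEquiv.edist_map] at this
  · intro x hx
    have hC := ContMDiff.contDiffOn_localRep hf.1 (by exact_mod_cast le_top) hφ hψ
    have hn := localDomain_mem_nhdsWithin hf.1.continuous hx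
    have h1 : ContDiffWithinAt ℝ 1 (localRep I J φ ψ f) (range I) x :=
      ((hC x hx).of_le (by exact_mod_cast hk)).mono_of_mem_nhdsWithin hn
    obtain ⟨L, t, ht, hL⟩ := h1.exists_lipschitzOnWith I.convex_range
    exact ⟨L, t, nhdsWithin_mono _ localDomain_subset_range ht, hL⟩

theorem chartAt_restr_mem_maximalAtlas (p : M) {s : Set M} (hs : IsOpen s) :
    (chartAt H p).restr s ∈ IsManifold.maximalAtlas I ∞ M :=
  restr_mem_maximalAtlas _ (IsManifold.chart_mem_maximalAtlas p) hs

theorem range_subset_closure_interior : range I ⊆ closure (interior (range I)) :=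
  I.range_subset_closure_interior

/-- The rank condition speaks only of charts whose whole domain is mapped into the target chart, so
the preferred chart at `p` is restricted to the preimage of the target chart; the coordinate
expression is unaffected. -/
theorem exists_clarkeDeriv_repAt {k : ℕ} (f : CkLip I J M N k) (p : M) :
    ∃ U ∈ 𝓝[range I] (extChartAt I p p), extChartAt I p p ∈ U ∧
      LocallyLipschitzOn U (repAt I J f.toFun p) ∧ ∀ r : ℕ, HasClarkeRank I J M N k r f →
      ∃ c : ℝ, 0 < c ∧ ∀ A ∈ clarkeDeriv (repAt I J f.toFun p) U (extChartAt I p p),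
          ∀ j < r, c ≤ A.toLinearMap.singularValues j := by
  set φ := (chartAt H p).restr (f.toFun ⁻¹' (chartAt H' (f.toFun p)).source) with hφ
  have ho : IsOpen (f.toFun ⁻¹' (chartAt H' (f.toFun p)).source) :=
    (chartAt H' (f.toFun p)).open_source.preimage f.isCkLip.1.continuous
  have hp : p ∈ φ.source := by
    simp [hφ, ho.interior_eq]
  have hφm : φ ∈ IsManifold.maximalAtlas I ∞ M := chartAt_restr_mem_maximalAtlas p ho
  have hmaps : MapsTo f.toFun φ.source (chartAt H' (f.toFun p)).source := by
    intro q hq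
    simp only [hφ, OpenPartialHomeomorph.restr_source, ho.interior_eq] at hq
    exact hq.2
  have hloc : localDomain I φ (chartAt H' (f.toFun p)) f.toFun = (φ.extend I).target := by
    refine subset_antisymm (fun x hx => hx.1) fun x hx => ⟨hx, hmaps ?_⟩
    simpa only [φ.extend_source] using (φ.extend I).map_target hx
  have hpt : extChartAt I p p ∈ (φ.extend I).target :=
    (φ.extend I).map_source (by rwa [φ.extend_source])
  refine ⟨(φ.extend I).target, φ.extend_target_mem_nhdsWithin hp, hpt, ?_, ?_⟩
  · rw [← hloc]
    exact f.isCkLip.lipInCharts φ hφm _ (IsManifold.chart_mem_maximalAtlas _)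
  · intro r hr
    exact hr φ hφm _ (IsManifold.chart_mem_maximalAtlas _) hmaps _ hpt

theorem HasClarkeRank.exists_pairBound_immPairs {k : ℕ}
    {f : CkLip I J M N k} (hf : HasClarkeRank I J M N k m f) (p : M) :
    ∃ r > 0, ∃ δ > 0, PairBound (immPairs _ _) (repAt I J f.toFun p)
      (Metric.ball (extChartAt I p p) r ∩ range I) δ := by
  obtain ⟨U, hU, hpU, hL, H⟩ := exists_clarkeDeriv_repAt f p
  obtain ⟨c, hc, hA⟩ := H m hf
  exact LipWhitney.exists_pairBound_immPairs I.convex_range range_subset_closure_interior hU hpU hL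
    hc fun A hA' => (le_singularValues_iff _ hc.le).1 (by simpa using hA A hA')

theorem HasClarkeRank.exists_pairBound_subPairs {k : ℕ}
    {f : CkLip I J M N k} (hf : HasClarkeRank I J M N k n f) (p : M) :
    ∃ r > 0, ∃ δ > 0, PairBound (subPairs _ _) (repAt I J f.toFun p)
      (Metric.ball (extChartAt I p p) r ∩ range I) δ := by
  obtain ⟨U, hU, hpU, hL, H⟩ := exists_clarkeDeriv_repAt f p
  obtain ⟨c, hc, hA⟩ := H n hf
  exact LipWhitney.exists_pairBound_subPairs I.convex_range range_subset_closure_interior hU hpU hL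
    hc fun A hA' => (le_singularValues_iff_adjoint _ hc).1 (by simpa using hA A hA')

end Representatives

end LipWhitney

namespace LipWhitney

section Lipschitz

theorem _root_.LocallyLipschitzOn.congr {α β : Type*} [PseudoEMetricSpace α] [PseudoEMetricSpace β]
    {f g : α → β} {s : Set α} (hf : LocallyLipschitzOn s f) (h : EqOn g f s) :
    LocallyLipschitzOn s g := by
  intro x hx
  obtain ⟨K, t, ht, hK⟩ := hf hx
  refine ⟨K, t ∩ s, inter_mem ht self_mem_nhdsWithin, fun y hy z hz => ?_⟩
  rw [h hy.2, h hz.2]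
  exact hK hy.1 hz.1

theorem _root_.LocallyLipschitzOn.comp {α β γ : Type*} [PseudoEMetricSpace α]
    [PseudoEMetricSpace β] [PseudoEMetricSpace γ]
    {g : β → γ} {f : α → β} {s : Set α} {t : Set β} (hg : LocallyLipschitzOn t g)
    (hf : LocallyLipschitzOn s f) (hst : MapsTo f s t) : LocallyLipschitzOn s (g ∘ f) := by
  intro x hx
  obtain ⟨K, u, hu, hK⟩ := hf hx
  obtain ⟨L, v, hv, hL⟩ := hg (hst hx)
  have hc : ContinuousWithinAt f s x := hf.continuousOn x hx
  refine ⟨L * K, u ∩ f ⁻¹' v, inter_mem hu ?_, ?_⟩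
  · exact (tendsto_nhdsWithin_iff.2 ⟨hc, eventually_mem_nhdsWithin.mono fun _ h => hst h⟩) hv
  · exact (hL.mono (image_preimage_subset f v)).comp
      (hK.mono inter_subset_left) fun y hy => mem_image_of_mem _ hy.2

theorem _root_.LocallyLipschitzOn.prodMk {α β γ : Type*} [PseudoEMetricSpace α]
    [PseudoEMetricSpace β] [PseudoEMetricSpace γ]
    {f : α → β} {g : α → γ} {s : Set α} (hf : LocallyLipschitzOn s f)
    (hg : LocallyLipschitzOn s g) : LocallyLipschitzOn s fun x => (f x, g x) := by
  intro x hx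
  obtain ⟨K, u, hu, hK⟩ := hf hx
  obtain ⟨L, v, hv, hL⟩ := hg hx
  exact ⟨max K L, u ∩ v, inter_mem hu hv,
    (hK.mono inter_subset_left).prodMk (hL.mono inter_subset_right)⟩

end Lipschitz

/-! ### Calculus of `C^{k,1}` maps between normed spaces -/

section CkLipOn

variable {E E' F G : Type} [NormedAddCommGroup E] [NormedSpace ℝ E]
  [NormedAddCommGroup E'] [NormedSpace ℝ E']
  [NormedAddCommGroup F] [NormedSpace ℝ F] [NormedAddCommGroup G] [NormedSpace ℝ G]

/-- `s` is a relatively open subset of a convex set with nonempty interior. -/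
def IsLocallyConvexBody (s : Set E) : Prop :=
  ∃ R : Set E, Convex ℝ R ∧ (interior R).Nonempty ∧ s ⊆ R ∧ ∀ x ∈ s, s ∈ 𝓝[R] x

theorem IsLocallyConvexBody.uniqueDiffOn {s : Set E} (hs : IsLocallyConvexBody s) :
    UniqueDiffOn ℝ s := by
  obtain ⟨R, hR, hRi, hsR, h⟩ := hs
  intro x hx
  exact (uniqueDiffOn_convex hR hRi x (hsR hx)).mono_nhds (nhdsWithin_le_of_mem (h x hx))

theorem _root_.IsOpen.isLocallyConvexBody {s : Set E} (hs : IsOpen s) :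
    IsLocallyConvexBody s :=
  ⟨univ, convex_univ, by simp, subset_univ s, fun x hx => by
    simpa using hs.mem_nhds hx⟩

theorem IsLocallyConvexBody.locallyLipschitzOn {s : Set E} (hs : IsLocallyConvexBody s)
    {f : E → F} (hf : ContDiffOn ℝ 1 f s) : LocallyLipschitzOn s f := by
  obtain ⟨R, hR, hRi, hsR, h⟩ := hs
  intro x hx
  obtain ⟨K, t, ht, hK⟩ :=
    ((hf x hx).mono_of_mem_nhdsWithin (h x hx)).exists_lipschitzOnWith hR
  exact ⟨K, t, nhdsWithin_mono _ hsR ht, hK⟩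

/-- `f` is `C^k` on `s` with locally Lipschitz `k`-th derivative, defined by recursion on `k`. -/
def CkLipOn (s : Set E) : (k : ℕ) → ∀ {F : Type} [NormedAddCommGroup F] [NormedSpace ℝ F],
    (E → F) → Prop
  | 0, _, _, _, f => LocallyLipschitzOn s f
  | k + 1, _, _, _, f => DifferentiableOn ℝ f s ∧ CkLipOn s k (fderivWithin ℝ f s)

theorem CkLipOn.congr {s : Set E} {k : ℕ} {f g : E → F} (hf : CkLipOn s k f) (h : EqOn g f s) :
    CkLipOn s k g := by
  induction k generalizing F with
  | zero => exact LocallyLipschitzOn.congr hf h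
  | succ k ih =>
    exact ⟨hf.1.congr h, ih hf.2 fun x hx => fderivWithin_congr h (h hx)⟩

theorem CkLipOn.contDiffOn {s : Set E} {k : ℕ} {f : E → F} (hf : CkLipOn s k f) :
    ContDiffOn ℝ k f s := by
  induction k generalizing F with
  | zero => exact contDiffOn_zero.2 (LocallyLipschitzOn.continuousOn hf)
  | succ k ih =>
    push_cast
    exact contDiffOn_succ_of_fderivWithin hf.1 (by simp) (ih hf.2)

/-- Local convexity enters here: it makes `C¹` maps locally Lipschitz, so one more continuous
derivative implies the Lipschitz condition. -/
theorem CkLipOn.of_contDiffOn {s : Set E} (hs : IsLocallyConvexBody s) {k : ℕ} {f : E → F}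
    (hf : ContDiffOn ℝ (k + 1 : ℕ) f s) : CkLipOn s k f := by
  induction k generalizing F with
  | zero => exact hs.locallyLipschitzOn (by simpa using hf)
  | succ k ih =>
    push_cast at hf
    rw [contDiffOn_succ_iff_fderivWithin hs.uniqueDiffOn] at hf
    exact ⟨hf.1, ih (by exact_mod_cast hf.2.2)⟩

theorem CkLipOn.of_succ {s : Set E} (hs : IsLocallyConvexBody s) {k : ℕ} {f : E → F}
    (hf : CkLipOn s (k + 1) f) : CkLipOn s k f :=
  CkLipOn.of_contDiffOn hs hf.contDiffOn

theorem CkLipOn.of_le {s : Set E} (hs : IsLocallyConvexBody s) {k l : ℕ} (hkl : l ≤ k)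
    {f : E → F} (hf : CkLipOn s k f) : CkLipOn s l f := by
  induction k, hkl using Nat.le_induction with
  | base => exact hf
  | succ k _ ih => exact ih (hf.of_succ hs)

theorem CkLipOn.add {s : Set E} (hs : IsLocallyConvexBody s) {k : ℕ} {f g : E → F}
    (hf : CkLipOn s k f) (hg : CkLipOn s k g) : CkLipOn s k fun x => f x + g x := by
  induction k generalizing F with
  | zero =>
    have h : LocallyLipschitz fun p : F × F => p.1 + p.2 :=
      (contDiff_fst.add contDiff_snd : ContDiff ℝ 1 fun p : F × F => p.1 + p.2).locallyLipschitz
    exact (locallyLipschitzOn_univ.2 h).comp (LocallyLipschitzOn.prodMk hf hg) (mapsTo_univ _ _)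
  | succ k ih =>
    refine ⟨hf.1.add hg.1, (ih hf.2 hg.2).congr fun x hx => ?_⟩
    exact fderivWithin_fun_add (hs.uniqueDiffOn x hx) (hf.1 x hx) (hg.1 x hx)

/-- By the product rule the derivative is a sum of two bilinear expressions of the same kind in
other spaces, so the induction runs over all spaces at once. The chain rule below is reduced to this
case through composition of operators. -/
theorem CkLipOn.bilinear {s : Set E} (hs : IsLocallyConvexBody s) {k : ℕ} {E' : Type}
    [NormedAddCommGroup E'] [NormedSpace ℝ E'] (B : F →L[ℝ] G →L[ℝ] E')
    {f : E → F} {g : E → G} (hf : CkLipOn s k f) (hg : CkLipOn s k g) :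
    CkLipOn s k fun x => B (f x) (g x) := by
  induction k generalizing F G E' with
  | zero =>
    have h : LocallyLipschitz fun p : F × G => B p.1 p.2 :=
      (B.isBoundedBilinearMap.contDiff (n := 1)).locallyLipschitz
    exact (locallyLipschitzOn_univ.2 h).comp (LocallyLipschitzOn.prodMk hf hg) (mapsTo_univ _ _)
  | succ k ih =>
    refine ⟨fun x hx => (B.hasFDerivWithinAt_of_bilinear (hf.1 x hx).hasFDerivWithinAt
      (hg.1 x hx).hasFDerivWithinAt).differentiableWithinAt, ?_⟩
    have h1 := ih (B.precompR E) (hf.of_succ hs) hg.2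
    have h2 := ih (B.precompL E) hf.2 (hg.of_succ hs)
    refine (h1.add hs h2).congr fun x hx => ?_
    exact B.fderivWithin_of_bilinear (hf.1 x hx) (hg.1 x hx) (hs.uniqueDiffOn x hx)

theorem CkLipOn.comp {s : Set E} (hs : IsLocallyConvexBody s) {t : Set E'}
    {k : ℕ} {f : E → E'} {g : E' → F} (hg : CkLipOn t k g)
    (hf : CkLipOn s k f) (hst : MapsTo f s t) : CkLipOn s k (g ∘ f) := by
  induction k generalizing F with
  | zero => exact LocallyLipschitzOn.comp hg hf hst
  | succ k ih =>
    refine ⟨hg.1.comp hf.1 hst, ?_⟩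
    refine ((ih hg.2 (hf.of_succ hs)).bilinear hs (ContinuousLinearMap.compL ℝ E E' F)
      hf.2).congr fun x hx => ?_
    exact fderivWithin_comp x (hg.1 _ (hst hx)) (hf.1 x hx) hst (hs.uniqueDiffOn x hx)

/-- The inverse function theorem for `C^{k,1}` maps that are already known to have a locally
Lipschitz inverse. -/
theorem CkLipOn.inverse [CompleteSpace E] {s : Set E} {t : Set E'}
    (hs : IsLocallyConvexBody s) (ht : IsLocallyConvexBody t)
    {k : ℕ} {f : E → E'} {g : E' → E} (hf : CkLipOn s k f) (hg : LocallyLipschitzOn t g)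
    (hgt : MapsTo g t s) (hfg : ∀ y ∈ t, f (g y) = y)
    (hinv : 1 ≤ k → ∀ x ∈ s, (fderivWithin ℝ f s x).IsInvertible) : CkLipOn t k g := by
  -- Bootstrapping: `Dg` is operator inversion applied to `Df ∘ g`, so regularity `j` of `g` yields
  -- regularity `j + 1`, as long as `f` has it.
  have key : ∀ j ≤ k, CkLipOn t j g := by
    intro j
    induction j with
    | zero => exact fun _ => hg
    | succ j ih =>
      intro hj
      obtain ⟨k, rfl⟩ : ∃ k', k = k' + 1 := ⟨k - 1, by omega⟩
      have hder : ∀ y ∈ t, HasFDerivWithinAt g ((fderivWithin ℝ f s (g y)).inverse) t y := by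
        intro y hy
        obtain ⟨e, he⟩ := hinv (by omega) (g y) (hgt hy)
        rw [← he, ContinuousLinearMap.inverse_equiv]
        have h1 : HasFDerivWithinAt f (e : E →L[ℝ] E') s (g y) :=
          he ▸ (hf.1 _ (hgt hy)).hasFDerivWithinAt
        refine HasFDerivWithinAt.of_local_left_inverse (f := f) ?_ h1 hy ?_
        · exact tendsto_nhdsWithin_iff.2 ⟨hg.continuousOn y hy,
            eventually_mem_nhdsWithin.mono fun _ h => hgt h⟩
        · exact eventually_mem_nhdsWithin.mono hfg
      refine ⟨fun y hy => (hder y hy).differentiableWithinAt, ?_⟩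
      -- Inversion is smooth on the open set of invertible operators, hence `C^{j,1}` there.
      have hio : IsOpen {A : E →L[ℝ] E' | A.IsInvertible} := ContinuousLinearEquiv.isOpen
      have hi : CkLipOn {A : E →L[ℝ] E' | A.IsInvertible} j ContinuousLinearMap.inverse := by
        refine CkLipOn.of_contDiffOn hio.isLocallyConvexBody fun A hA => ?_
        exact (ContinuousLinearMap.IsInvertible.contDiffAt_map_inverse hA).contDiffWithinAt
      have h2 : CkLipOn s j (fderivWithin ℝ f s) := hf.2.of_le hs (by omega)
      have h3 := h2.comp ht (ih (by omega)) hgt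
      have h4 := hi.comp ht h3 fun y hy => hinv (by omega) _ (hgt hy)
      exact h4.congr fun y hy => (hder y hy).fderivWithin (ht.uniqueDiffOn y hy)
  exact key k le_rfl

/-- The `(k+1)`-st derivative is the `k`-th derivative of the first derivative up to the currying
isometry, so the recursion matches the iterated derivative. -/
theorem ckLipOn_iff {s : Set E} (hs : IsLocallyConvexBody s) {k : ℕ} {f : E → F} :
    CkLipOn s k f ↔ ContDiffOn ℝ k f s ∧ LocallyLipschitzOn s (iteratedFDerivWithin ℝ k f s) := by
  induction k generalizing F with
  | zero =>
    have e : iteratedFDerivWithin ℝ 0 f s =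
      (continuousMultilinearCurryFin0 ℝ E F).symm ∘ f := iteratedFDerivWithin_zero_eq_comp
    constructor
    · intro h
      refine ⟨h.contDiffOn, ?_⟩
      rw [e]
      exact (locallyLipschitzOn_univ.2
        (LinearIsometryEquiv.lipschitz _).locallyLipschitz).comp h (mapsTo_univ _ _)
    · rintro ⟨-, h⟩
      rw [e] at h
      have := (locallyLipschitzOn_univ.2 (LinearIsometryEquiv.lipschitz
        (continuousMultilinearCurryFin0 ℝ E F)).locallyLipschitz).comp h (mapsTo_univ _ _)
      exact LocallyLipschitzOn.congr this fun x _ => by simp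
  | succ k ih =>
    have e : ∀ x ∈ s, iteratedFDerivWithin ℝ (k + 1) f s x =
      ((continuousMultilinearCurryRightEquiv' ℝ k E F).symm ∘
          iteratedFDerivWithin ℝ k (fun y => fderivWithin ℝ f s y) s) x := fun x hx =>
      iteratedFDerivWithin_succ_eq_comp_right hs.uniqueDiffOn hx
    have e' : LocallyLipschitzOn s (iteratedFDerivWithin ℝ (k + 1) f s) ↔
        LocallyLipschitzOn s (iteratedFDerivWithin ℝ k (fderivWithin ℝ f s) s) := by
      constructor
      · intro h
        have h1 := LocallyLipschitzOn.congr h fun x hx => (e x hx).symm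
        have := (locallyLipschitzOn_univ.2 (LinearIsometryEquiv.lipschitz
          (continuousMultilinearCurryRightEquiv' ℝ k E F)).locallyLipschitz).comp h1
            (mapsTo_univ _ _)
        exact LocallyLipschitzOn.congr this fun x _ => by simp
      · intro h
        have := (locallyLipschitzOn_univ.2 (LinearIsometryEquiv.lipschitz
          (continuousMultilinearCurryRightEquiv' ℝ k E F).symm).locallyLipschitz).comp h
            (mapsTo_univ _ _)
        exact LocallyLipschitzOn.congr this e
    rw [e']
    push_cast
    rw [contDiffOn_succ_iff_fderivWithin hs.uniqueDiffOn]
    change _ ∧ _ ↔ _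
    rw [ih]
    simp only [WithTop.natCast_ne_top, false_imp_iff, true_and, and_assoc]

end CkLipOn

end LipWhitney

namespace LipWhitney

section LipAt

variable {E F G : Type*} [PseudoMetricSpace E] [PseudoMetricSpace F] [PseudoMetricSpace G]

/-- `f` is Lipschitz on a neighbourhood of `x` within `R`. -/
def LipAt (f : E → F) (R : Set E) (x : E) : Prop := ∃ L, ∃ t ∈ 𝓝[R] x, LipschitzOnWith L f t

theorem LipAt.congr {f g : E → F} {R : Set E} {x : E} (hf : LipAt f R x) (h : g =ᶠ[𝓝[R] x] f) :
    LipAt g R x := by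
  obtain ⟨L, t, ht, hL⟩ := hf
  refine ⟨L, t ∩ {y | g y = f y}, inter_mem ht h, fun y hy z hz => ?_⟩
  rw [hy.2, hz.2]
  exact hL hy.1 hz.1

theorem LipAt.comp {f : E → F} {g : F → G} {R : Set E} {R' : Set F} {x : E}
    (hg : LipAt g R' (f x)) (hf : LipAt f R x) (hx : x ∈ R) (hR : ∀ᶠ y in 𝓝[R] x, f y ∈ R') :
    LipAt (g ∘ f) R x := by
  obtain ⟨K, u, hu, hK⟩ := hf
  obtain ⟨L, v, hv, hL⟩ := hg
  have hc : ContinuousWithinAt f R x :=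
    (hK.continuousOn x (mem_of_mem_nhdsWithin hx hu)).mono_of_mem_nhdsWithin hu
  refine ⟨L * K, u ∩ f ⁻¹' v, inter_mem hu (tendsto_nhdsWithin_iff.2 ⟨hc, hR⟩ hv), ?_⟩
  exact (hL.mono (image_preimage_subset f v)).comp
    (hK.mono inter_subset_left) fun y hy => mem_image_of_mem _ hy.2

end LipAt

/-! ### Expanding maps and regularity of inverses on manifolds -/

section Inverse

variable {m n : ℕ} {H H' : Type*} [TopologicalSpace H] [TopologicalSpace H']
  {I : ModelWithCorners ℝ (EuclideanSpace ℝ (Fin m)) H}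
  {J : ModelWithCorners ℝ (EuclideanSpace ℝ (Fin n)) H'}
  {M N : Type*} [TopologicalSpace M] [TopologicalSpace N] [ChartedSpace H M] [ChartedSpace H' N]
  [IsManifold I ∞ M] [IsManifold J ∞ N]

theorem isLocallyConvexBody_localDomain {f : M → N} (hf : Continuous f)
    {φ : OpenPartialHomeomorph M H} {ψ : OpenPartialHomeomorph N H'} :
    IsLocallyConvexBody (localDomain I φ ψ f) :=
  ⟨range I, I.convex_range, I.nonempty_interior, localDomain_subset_range,
    fun _ hx => localDomain_mem_nhdsWithin hf hx⟩

/-- The coordinate domain is relatively open in the range of the model, so derivatives within either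
set agree on it and the normed-space calculus applies. -/
theorem isCkLip_iff_ckLipOn {k : ℕ} {f : M → N} :
    IsCkLip I J k f ↔ Continuous f ∧ ∀ φ ∈ IsManifold.maximalAtlas I ∞ M,
      ∀ ψ ∈ IsManifold.maximalAtlas J ∞ N,
        CkLipOn (localDomain I φ ψ f) k (localRep I J φ ψ f) := by
  have key : Continuous f → ∀ φ : OpenPartialHomeomorph M H, ∀ ψ : OpenPartialHomeomorph N H',
      EqOn (iteratedFDerivWithin ℝ k (localRep I J φ ψ f) (range I))
        (iteratedFDerivWithin ℝ k (localRep I J φ ψ f) (localDomain I φ ψ f))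
        (localDomain I φ ψ f) := by
    intro hf φ ψ x hx
    refine iteratedFDerivWithin_congr_set ?_ k
    refine nhdsWithin_eq_iff_eventuallyEq.1 ?_
    exact le_antisymm (nhdsWithin_le_of_mem (localDomain_mem_nhdsWithin hf hx))
      (nhdsWithin_mono _ localDomain_subset_range)
  constructor
  · intro h
    refine ⟨h.1.continuous, fun φ hφ ψ hψ => ?_⟩
    rw [ckLipOn_iff (isLocallyConvexBody_localDomain h.1.continuous)]
    exact ⟨ContMDiff.contDiffOn_localRep h.1 (by exact_mod_cast le_top) hφ hψ,
      (h.2 φ hφ ψ hψ).congr (key h.1.continuous φ ψ).symm⟩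
  · rintro ⟨hf, h⟩
    refine ⟨contMDiff_iff.2 ⟨hf, fun x y => ?_⟩, fun φ hφ ψ hψ => ?_⟩
    · have := (h _ (IsManifold.chart_mem_maximalAtlas x) _
        (IsManifold.chart_mem_maximalAtlas y)).contDiffOn
      refine this.mono fun z hz => ⟨hz.1, ?_⟩
      simpa using hz.2
    · have := h φ hφ ψ hψ
      rw [ckLipOn_iff (isLocallyConvexBody_localDomain hf)] at this
      exact this.2.congr (key hf φ ψ)

theorem LipInCharts.lipAt {f : M → N} (hL : LipInCharts I J f) (hf : Continuous f)
    {φ : OpenPartialHomeomorph M H} (hφ : φ ∈ IsManifold.maximalAtlas I ∞ M)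
    {ψ : OpenPartialHomeomorph N H'} (hψ : ψ ∈ IsManifold.maximalAtlas J ∞ N)
    {x : EuclideanSpace ℝ (Fin m)} (hx : x ∈ localDomain I φ ψ f) :
    LipAt (localRep I J φ ψ f) (range I) x := by
  obtain ⟨L, t, ht, h⟩ := hL φ hφ ψ hψ hx
  exact ⟨L, t, nhdsWithin_le_of_mem (localDomain_mem_nhdsWithin hf hx) ht, h⟩

theorem localRep_mem_localDomain {f : M → N} {g : N → M} (hgf : LeftInverse g f)
    {φ : OpenPartialHomeomorph M H} {ψ : OpenPartialHomeomorph N H'}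
    {x : EuclideanSpace ℝ (Fin m)} (hx : x ∈ localDomain I φ ψ f) :
    localRep I J φ ψ f x ∈ localDomain J ψ φ g ∧
      localRep J I ψ φ g (localRep I J φ ψ f x) = x := by
  obtain ⟨hx1, hx2⟩ := hx
  have h1 : (φ.extend I).symm x ∈ φ.source := by
    simpa only [φ.extend_source] using (φ.extend I).map_target hx1
  have h2 : (ψ.extend J).symm (ψ.extend J (f ((φ.extend I).symm x))) = f ((φ.extend I).symm x) :=
    ψ.extend_left_inv hx2
  refine ⟨⟨(ψ.extend J).map_source (by rwa [ψ.extend_source]), ?_⟩, ?_⟩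
  · change g ((ψ.extend J).symm (ψ.extend J (f ((φ.extend I).symm x)))) ∈ _
    rw [h2, hgf]
    exact h1
  · change φ.extend I (g ((ψ.extend J).symm (ψ.extend J (f ((φ.extend I).symm x))))) = x
    rw [h2, hgf]
    exact (φ.extend I).right_inv hx1

theorem continuousWithinAt_localRep {f : M → N} (hf : Continuous f)
    {φ : OpenPartialHomeomorph M H} {ψ : OpenPartialHomeomorph N H'}
    {x : EuclideanSpace ℝ (Fin m)} (hx : x ∈ localDomain I φ ψ f) :
    ContinuousWithinAt (localRep I J φ ψ f) (range I) x := by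
  have h1 : ContinuousAt (φ.extend I).symm x := φ.continuousAt_extend_symm' hx.1
  have h2 : ContinuousAt (ψ.extend J) (f ((φ.extend I).symm x)) := ψ.continuousAt_extend hx.2
  exact (h2.comp (f := f ∘ (φ.extend I).symm) (hf.continuousAt.comp h1)).continuousWithinAt

theorem tendsto_localRep {f : M → N} (hf : Continuous f)
    {φ : OpenPartialHomeomorph M H} {ψ : OpenPartialHomeomorph N H'}
    {x : EuclideanSpace ℝ (Fin m)} (hx : x ∈ localDomain I φ ψ f) :
    Tendsto (localRep I J φ ψ f) (𝓝[range I] x) (𝓝[range J] (localRep I J φ ψ f x)) :=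
  tendsto_nhdsWithin_iff.2 ⟨continuousWithinAt_localRep hf hx,
    Eventually.of_forall fun y => by simp [localRep]⟩

/-- If the inverse is locally Lipschitz, then the map is locally expanding. -/
theorem LipInCharts.exists_expanding {f : M → N} {g : N → M} (hf : Continuous f)
    (hg : Continuous g) (hgf : LeftInverse g f) (hL : LipInCharts J I g)
    {φ : OpenPartialHomeomorph M H} (hφ : φ ∈ IsManifold.maximalAtlas I ∞ M)
    {ψ : OpenPartialHomeomorph N H'} (hψ : ψ ∈ IsManifold.maximalAtlas J ∞ N)
    {x : EuclideanSpace ℝ (Fin m)} (hx : x ∈ localDomain I φ ψ f) :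
    ∃ K ∈ 𝓝[range I] x, ∃ δ > 0, ∀ y ∈ K, ∀ z ∈ K,
      δ * ‖y - z‖ ≤ ‖localRep I J φ ψ f y - localRep I J φ ψ f z‖ := by
  obtain ⟨L, t, ht, h⟩ := hL.lipAt hg hψ hφ (localRep_mem_localDomain hgf hx).1
  -- The expansion constant is `(L + 1)⁻¹` so that it is positive also for `L = 0`.
  refine ⟨localRep I J φ ψ f ⁻¹' t ∩ localDomain I φ ψ f,
    inter_mem (tendsto_localRep hf hx ht) (localDomain_mem_nhdsWithin hf hx), ((L : ℝ) + 1)⁻¹,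
    by positivity, ?_⟩
  rintro y ⟨hyt, hy⟩ z ⟨hzt, hz⟩
  have h1 := h.dist_le_mul _ hyt _ hzt
  rw [(localRep_mem_localDomain hgf hy).2, (localRep_mem_localDomain hgf hz).2, dist_eq_norm,
    dist_eq_norm] at h1
  rw [inv_mul_le_iff₀ (by positivity)]
  refine h1.trans (mul_le_mul_of_nonneg_right (by linarith) (norm_nonneg _))

/-- A map is locally expanding if near each point it expands distances in some pair of charts. -/
def LocallyExpanding (I : ModelWithCorners ℝ (EuclideanSpace ℝ (Fin m)) H)
    (J : ModelWithCorners ℝ (EuclideanSpace ℝ (Fin n)) H') (f : M → N) : Prop :=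
  ∀ p : M, ∃ φ ∈ IsManifold.maximalAtlas I ∞ M, ∃ ψ ∈ IsManifold.maximalAtlas J ∞ N,
    p ∈ φ.source ∧ f p ∈ ψ.source ∧ ∃ K ∈ 𝓝[range I] (φ.extend I p), ∃ δ > 0,
      ∀ y ∈ K, ∀ z ∈ K, δ * ‖y - z‖ ≤ ‖localRep I J φ ψ f y - localRep I J φ ψ f z‖

theorem lipAt_extendCoordChange {φ φ' : OpenPartialHomeomorph M H}
    (hφ : φ ∈ IsManifold.maximalAtlas I ∞ M) (hφ' : φ' ∈ IsManifold.maximalAtlas I ∞ M)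
    {p : M} (hp : p ∈ φ.source) (hp' : p ∈ φ'.source) :
    LipAt (I.extendCoordChange φ φ') (range I) (φ.extend I p) :=
  ((I.contDiffWithinAt_extendCoordChange' hφ hφ' hp hp').of_le
    (by exact_mod_cast le_top)).exists_lipschitzOnWith I.convex_range

/-- Expansion by `δ` makes the inverse Lipschitz with constant `δ⁻¹` in one pair of charts near each
point; composing with smooth chart changes carries this to every pair. -/
theorem LocallyExpanding.lipInCharts_inverse {f : M → N} {g : N → M}
    (hg : Continuous g) (hfg : RightInverse g f)
    (h : LocallyExpanding I J f) : LipInCharts J I g := by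
  intro ψ' hψ' φ' hφ' y hy
  obtain ⟨q, hq', rfl⟩ : y ∈ ψ'.extend J '' ψ'.source := by
    rw [← ψ'.extend_target_eq_image_source]; exact hy.1
  have hgq' : g q ∈ φ'.source := by
    have := hy.2
    rwa [ψ'.extend_left_inv hq'] at this
  obtain ⟨φ, hφ, ψ, hψ, hp, hfp, K, hK, δ, hδ, hexp⟩ := h (g q)
  rw [hfg] at hfp
  have hd := extend_mem_localDomain (I := J) hfp hp
  have hGq : localRep J I ψ φ g (ψ.extend J q) = φ.extend I (g q) := by
    simp [localRep, hfp]
  have h1 : LipAt (localRep J I ψ φ g) (range J) (ψ.extend J q) := by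
    refine ⟨δ⁻¹.toNNReal, localDomain J ψ φ g ∩ localRep J I ψ φ g ⁻¹' K,
      inter_mem (localDomain_mem_nhdsWithin hg hd) (tendsto_localRep hg hd (by rwa [hGq])), ?_⟩
    refine LipschitzOnWith.of_dist_le_mul ?_
    rintro y ⟨hy, hyK⟩ z ⟨hz, hzK⟩
    have := hexp _ hyK _ hzK
    rw [(localRep_mem_localDomain hfg hy).2, (localRep_mem_localDomain hfg hz).2] at this
    rw [dist_eq_norm, dist_eq_norm, Real.coe_toNNReal _ (by positivity), inv_mul_eq_div,
      le_div_iff₀ hδ, mul_comm]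
    exact this
  have hTq : J.extendCoordChange ψ' ψ (ψ'.extend J q) = ψ.extend J q := by
    simp [hq']
  have h2 : LipAt (localRep J I ψ φ g ∘ J.extendCoordChange ψ' ψ) (range J) (ψ'.extend J q) := by
    refine LipAt.comp (by rwa [hTq]) (lipAt_extendCoordChange hψ' hψ hq' hfp) (by simp) ?_
    exact Eventually.of_forall fun y => by simp
  have h3 : LipAt (I.extendCoordChange φ φ' ∘ (localRep J I ψ φ g ∘ J.extendCoordChange ψ' ψ))
      (range J) (ψ'.extend J q) := by
    refine LipAt.comp (R' := range I) ?_ h2 (by simp)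
      (Eventually.of_forall fun y => by simp [localRep])
    rw [comp_apply, hTq, hGq]
    exact lipAt_extendCoordChange hφ hφ' hp hgq'
  have h4 : LipAt (localRep J I ψ' φ' g) (range J) (ψ'.extend J q) := by
    refine h3.congr ?_
    have e1 : (ψ'.extend J).symm ⁻¹' (ψ'.source ∩ (ψ.source ∩ g ⁻¹' (φ.source ∩ φ'.source))) ∈
        𝓝 (ψ'.extend J q) := by
      refine ψ'.extend_preimage_mem_nhds hq' (inter_mem (ψ'.open_source.mem_nhds hq')
        (inter_mem (ψ.open_source.mem_nhds hfp) ?_))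
      exact hg.continuousAt.preimage_mem_nhds
        (inter_mem (φ.open_source.mem_nhds hp) (φ'.open_source.mem_nhds hgq'))
    filter_upwards [mem_nhdsWithin_of_mem_nhds e1] with z hz
    obtain ⟨-, hz2, hz3, hz4⟩ := hz
    have a1 : (ψ.extend J).symm (ψ.extend J ((ψ'.extend J).symm z)) = (ψ'.extend J).symm z :=
      ψ.extend_left_inv hz2
    change φ'.extend I (g ((ψ'.extend J).symm z)) =
      φ'.extend I ((φ.extend I).symm (φ.extend I (g ((ψ.extend J).symm (ψ.extend J
        ((ψ'.extend J).symm z))))))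
    rw [a1, φ.extend_left_inv hz3]
  obtain ⟨L, t, ht, hL⟩ := h4
  exact ⟨L, t, nhdsWithin_mono _ localDomain_subset_range ht, hL⟩

theorem injective_of_mul_norm_le {δ : ℝ} (hδ : 0 < δ)
    {B : EuclideanSpace ℝ (Fin m) →L[ℝ] EuclideanSpace ℝ (Fin n)}
    (hB : ∀ v, δ * ‖v‖ ≤ ‖B v‖) : Injective B.toLinearMap := by
  rw [injective_iff_map_eq_zero]
  intro v hv
  have h1 := hB v
  change B v = 0 at hv
  rw [hv, norm_zero] at h1
  exact norm_eq_zero.1 (le_antisymm (nonpos_of_mul_nonpos_right h1 hδ) (norm_nonneg _))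

theorem _root_.ContinuousLinearMap.isInvertible_of_mul_norm_le {δ : ℝ} (hδ : 0 < δ) (hmn : m = n)
    {B : EuclideanSpace ℝ (Fin m) →L[ℝ] EuclideanSpace ℝ (Fin n)}
    (hB : ∀ v, δ * ‖v‖ ≤ ‖B v‖) : B.IsInvertible := by
  have hinj := injective_of_mul_norm_le hδ hB
  refine ⟨(LinearEquiv.ofInjectiveOfFinrankEq B.toLinearMap hinj
    (by simp [hmn])).toContinuousLinearEquiv, ?_⟩
  exact ContinuousLinearMap.ext fun v => LinearMap.congr_fun
    (LinearEquiv.coe_ofInjectiveOfFinrankEq B.toLinearMap hinj (by simp [hmn])) v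

theorem finrank_le_of_mul_norm_le {δ : ℝ} (hδ : 0 < δ)
    {B : EuclideanSpace ℝ (Fin m) →L[ℝ] EuclideanSpace ℝ (Fin n)}
    (hB : ∀ v, δ * ‖v‖ ≤ ‖B v‖) : m ≤ n := by
  have hinj := injective_of_mul_norm_le hδ hB
  simpa using LinearMap.finrank_le_finrank_of_injective hinj

/-- The inverse of a `C^{k,1}` map is `C^{k,1}` if it is locally Lipschitz. -/
theorem IsCkLip.inverse (hI : IsBoundaryModel I) {k : ℕ} {f : M → N} {g : N → M}
    (hf : IsCkLip I J k f)
    (hg : Continuous g) (hgf : LeftInverse g f) (hfg : RightInverse g f)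
    (hL : LipInCharts J I g) (hmn : m = n) : IsCkLip J I k g := by
  have hf' := isCkLip_iff_ckLipOn.1 hf
  have hfc := hf'.1
  refine isCkLip_iff_ckLipOn.2 ⟨hg, fun ψ hψ φ hφ => ?_⟩
  refine CkLipOn.inverse (isLocallyConvexBody_localDomain hfc)
    (isLocallyConvexBody_localDomain hg) (hf'.2 φ hφ ψ hψ) (hL ψ hψ φ hφ)
    (fun y hy => (localRep_mem_localDomain hfg hy).1)
    (fun y hy => (localRep_mem_localDomain hfg hy).2) ?_
  intro hk x hx
  obtain ⟨K, hK, δ, hδ, hexp⟩ := hL.exists_expanding hfc hg hgf hφ hψ hx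
  refine ContinuousLinearMap.isInvertible_of_mul_norm_le hδ hmn
    (hI.mul_norm_le_of_hasFDerivWithinAt (localDomain_subset_range hx) ?_ hK hexp)
  have hd : DifferentiableWithinAt ℝ (localRep I J φ ψ f) (localDomain I φ ψ f) x :=
    (hf'.2 φ hφ ψ hψ).contDiffOn.differentiableOn (by exact_mod_cast (by omega : k ≠ 0)) x hx
  exact hd.hasFDerivWithinAt.mono_of_mem_nhdsWithin (localDomain_mem_nhdsWithin hfc hx)

/-- Rademacher's theorem provides an interior point of differentiability, and expansion makes the
derivative there injective. -/
theorem LocallyExpanding.finrank_le [Nonempty M] (hI : IsBoundaryModel I) {f : M → N}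
    (hf : Continuous f) (hL : LipInCharts I J f) (h : LocallyExpanding I J f) : m ≤ n := by
  obtain ⟨φ, hφ, ψ, hψ, hp, hfp, K, hK, δ, hδ, hexp⟩ := h (Classical.arbitrary M)
  obtain ⟨L, t, ht, hLt⟩ := hL.lipAt hf hφ hψ (extend_mem_localDomain hp hfp)
  obtain ⟨r, hr, hrt⟩ := Metric.mem_nhdsWithin_iff.1 (inter_mem ht hK)
  set O := Metric.ball (φ.extend I (Classical.arbitrary M)) r ∩ interior (range I) with hO
  have hOo : IsOpen O := Metric.isOpen_ball.inter isOpen_interior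
  have hOne : O.Nonempty := mem_closure_iff.1
    (range_subset_closure_interior (I := I) (by simp)) _ Metric.isOpen_ball (Metric.mem_ball_self hr)
  have hOt : O ⊆ t ∩ K := fun y hy => hrt ⟨hy.1, interior_subset hy.2⟩
  have hae := (hLt.mono (hOt.trans inter_subset_left)).ae_differentiableWithinAt_of_mem
    (μ := MeasureTheory.volume)
  have hpos : 0 < MeasureTheory.volume O := hOo.measure_pos _ hOne
  obtain ⟨u, huO, hu⟩ : ∃ u ∈ O, DifferentiableWithinAt ℝ (localRep I J φ ψ f) O u := by
    by_contra! hcon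
    refine hpos.ne' (MeasureTheory.measure_mono_null (fun u hu => ?_) (MeasureTheory.ae_iff.1 hae))
    simpa using ⟨hu, hcon u hu⟩
  have hd := (hu.differentiableAt (hOo.mem_nhds huO)).hasFDerivAt.hasFDerivWithinAt (s := range I)
  refine finrank_le_of_mul_norm_le hδ (hI.mul_norm_le_of_hasFDerivWithinAt
    (interior_subset huO.2) hd (K := K) ?_ hexp)
  exact mem_nhdsWithin_of_mem_nhds (mem_of_superset (hOo.mem_nhds huO) fun y hy => (hOt hy).2)

end Inverse

end LipWhitney

namespace LipWhitney

/-! ### Blow-ups of Lipschitz maps along an ultrafilter -/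

section BlowUp

variable {E F : Type*} [NormedAddCommGroup E] [NormedSpace ℝ E]
  [NormedAddCommGroup F] [NormedSpace ℝ F]

/-- The rescalings of `f` around `p`. -/
noncomputable def rescale (f : E → F) (p : E) (j : ℕ) (x : E) : F :=
  (j : ℝ) • (f (p + (j : ℝ)⁻¹ • x) - f p)

theorem norm_rescale_sub_le {f : E → F} {D : Set E} {L : NNReal} (hf : LipschitzOnWith L f D)
    {p : E} {j : ℕ} (hj : j ≠ 0) {x y : E} (hx : p + (j : ℝ)⁻¹ • x ∈ D)
    (hy : p + (j : ℝ)⁻¹ • y ∈ D) : ‖rescale f p j x - rescale f p j y‖ ≤ L * ‖x - y‖ := by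
  have h := hf.dist_le_mul _ hx _ hy
  rw [dist_eq_norm, dist_add_left, dist_eq_norm, ← smul_sub, norm_smul, norm_inv] at h
  rw [rescale, rescale, ← smul_sub, sub_sub_sub_cancel_right, norm_smul]
  have hj' : 0 < ‖(j : ℝ)‖ := by simpa using Nat.pos_of_ne_zero hj
  calc ‖(j : ℝ)‖ * _ ≤ ‖(j : ℝ)‖ * (L * (‖(j : ℝ)‖⁻¹ * ‖x - y‖)) := by gcongr
    _ = L * ‖x - y‖ := by field_simp

theorem rescale_zero (f : E → F) (p : E) (j : ℕ) : rescale f p j 0 = 0 := by simp [rescale]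

theorem eventually_hyperfilter_ne_zero : ∀ᶠ j in (hyperfilter ℕ : Filter ℕ), j ≠ 0 := by
  have : ∀ᶠ j : ℕ in atTop, j ≠ 0 := eventually_ne_atTop 0
  rw [← Nat.cofinite_eq_atTop] at this
  exact hyperfilter_le_cofinite this

/-- The Lipschitz bound keeps each sequence of rescalings bounded. An ultrafilter then gives limits
at all `x` simultaneously, without extraction of subsequences. -/
theorem exists_tendsto_rescale [FiniteDimensional ℝ F] {f : E → F} {D : Set E} {L : NNReal}
    (hf : LipschitzOnWith L f D) {p : E} (hp : p ∈ D) :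
    ∃ f' : E → F, ∀ x, (∀ᶠ j : ℕ in hyperfilter ℕ, p + (j : ℝ)⁻¹ • x ∈ D) →
      Tendsto (fun j => rescale f p j x) (hyperfilter ℕ) (𝓝 (f' x)) := by
  have key : ∀ x, ∃ z, (∀ᶠ j : ℕ in hyperfilter ℕ, p + (j : ℝ)⁻¹ • x ∈ D) →
      Tendsto (fun j => rescale f p j x) (hyperfilter ℕ) (𝓝 z) := by
    intro x
    by_cases hx : ∀ᶠ j : ℕ in hyperfilter ℕ, p + (j : ℝ)⁻¹ • x ∈ D
    · have hb : ∀ᶠ j in (hyperfilter ℕ : Filter ℕ),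
          rescale f p j x ∈ Metric.closedBall (0 : F) (L * ‖x‖) := by
        filter_upwards [hx, eventually_hyperfilter_ne_zero] with j hj hj0
        have := norm_rescale_sub_le hf hj0 hj (y := 0) (by simpa using hp)
        simpa [rescale_zero] using this
      obtain ⟨z, -, hz⟩ := (isCompact_closedBall (0 : F) (L * ‖x‖)).ultrafilter_le_nhds
        ((hyperfilter ℕ).map fun j => rescale f p j x) (by
          rw [Ultrafilter.coe_map, le_principal_iff]; exact hb)
      exact ⟨z, fun _ => hz⟩
    · exact ⟨0, fun h => absurd h hx⟩
  choose f' hf' using key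
  exact ⟨f', hf'⟩

/-- The rescalings of `f` and `g` are inverse to each other at every stage, and the uniform
Lipschitz bound for `f` allows the moving argument to be replaced by its limit `x`. -/
theorem rescale_limit_leftInverse {f : E → F} {g : F → E} {D : Set E} {V : Set F} {L : NNReal}
    (hf : LipschitzOnWith L f D) (hgV : MapsTo g V D) (hfg : ∀ y ∈ V, f (g y) = y) {p : E}
    {q : F} (hfp : f p = q) (hgq : g q = p) {y x z} (hy : ∀ᶠ j : ℕ in hyperfilter ℕ,
      q + (j : ℝ)⁻¹ • y ∈ V)
    (hgy : Tendsto (fun j => rescale g q j y) (hyperfilter ℕ) (𝓝 x))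
    (hx : ∀ᶠ j : ℕ in hyperfilter ℕ, p + (j : ℝ)⁻¹ • x ∈ D)
    (hfx : Tendsto (fun j => rescale f p j x) (hyperfilter ℕ) (𝓝 z)) : z = y := by
  have h1 : ∀ᶠ j in (hyperfilter ℕ : Filter ℕ),
      ‖rescale f p j x - y‖ ≤ L * ‖x - rescale g q j y‖ := by
    filter_upwards [hy, hx, eventually_hyperfilter_ne_zero] with j hjy hjx hj0
    have hj0' : (j : ℝ) ≠ 0 := by exact_mod_cast hj0
    have e1 : p + (j : ℝ)⁻¹ • rescale g q j y = g (q + (j : ℝ)⁻¹ • y) := by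
      simp [rescale, smul_smul, hj0', hgq]
    have e2 : rescale f p j (rescale g q j y) = y := by
      rw [rescale, e1, hfg _ hjy, hfp]
      simp [smul_smul, hj0']
    have := norm_rescale_sub_le hf hj0 hjx (y := rescale g q j y) (by rw [e1]; exact hgV hjy)
    rwa [e2] at this
  have h2 : Tendsto (fun j => (L : ℝ) * ‖x - rescale g q j y‖) (hyperfilter ℕ) (𝓝 0) := by
    have := ((tendsto_const_nhds (x := x)).sub hgy).norm.const_mul (L : ℝ)
    simpa using this
  have h3 : Tendsto (fun j => rescale f p j x - y) (hyperfilter ℕ) (𝓝 0) :=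
    tendsto_zero_iff_norm_tendsto_zero.2
      (squeeze_zero' (Eventually.of_forall fun _ => norm_nonneg _) h1 h2)
  have h4 := tendsto_nhds_unique h3 (hfx.sub_const y)
  exact (sub_eq_zero.1 h4.symm)

theorem norm_rescale_limit_sub_le {f : E → F} {D : Set E} {L : NNReal}
    (hf : LipschitzOnWith L f D) {p : E} {x y : E} {x' y' : F}
    (hx : ∀ᶠ j : ℕ in hyperfilter ℕ, p + (j : ℝ)⁻¹ • x ∈ D)
    (hy : ∀ᶠ j : ℕ in hyperfilter ℕ, p + (j : ℝ)⁻¹ • y ∈ D)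
    (hx' : Tendsto (fun j => rescale f p j x) (hyperfilter ℕ) (𝓝 x'))
    (hy' : Tendsto (fun j => rescale f p j y) (hyperfilter ℕ) (𝓝 y')) :
    ‖x' - y'‖ ≤ L * ‖x - y‖ := by
  refine le_of_tendsto (hx'.sub hy').norm ?_
  filter_upwards [hx, hy, eventually_hyperfilter_ne_zero] with j h1 h2 h3
  exact norm_rescale_sub_le hf h3 h1 h2

theorem tendsto_hyperfilter_inv : Tendsto (fun j : ℕ => (j : ℝ)⁻¹) (hyperfilter ℕ) (𝓝 0) := by
  have := tendsto_inv_atTop_nhds_zero_nat (𝕜 := ℝ)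
  rw [← Nat.cofinite_eq_atTop] at this
  exact this.mono_left hyperfilter_le_cofinite

end BlowUp

/-! ### No bi-Lipschitz flattening of a boundary point -/

section Hyperplane

variable {m : ℕ}

/-- A hyperplane image separates: a homeomorphism of a half-space onto the whole space cannot map
the boundary hyperplane linearly. -/
theorem false_of_halfSpace_inverse {i : Fin m}
    {f g : EuclideanSpace ℝ (Fin m) → EuclideanSpace ℝ (Fin m)}
    (hf : ContinuousOn f {x | 0 ≤ x i}) (hg : ∀ y, 0 ≤ g y i)
    (hfg : ∀ y, f (g y) = y) (hgf : ∀ x, 0 ≤ x i → g (f x) = x)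
    {S : Submodule ℝ (EuclideanSpace ℝ (Fin m))} (hS : ∀ x, x ∈ S ↔ x i = 0)
    (A : S →ₗ[ℝ] EuclideanSpace ℝ (Fin m)) (hA : ∀ s : S, f s = A s) : False := by
  have hSi : ∀ s : S, (s : EuclideanSpace ℝ (Fin m)) i = 0 := fun s => (hS s).1 s.2
  have hinj : Injective A := by
    intro s t hst
    rw [← hA, ← hA] at hst
    have := congrArg g hst
    rw [hgf _ (hSi s).ge, hgf _ (hSi t).ge] at this
    exact Subtype.ext this
  have hSker : S = LinearMap.ker
    (EuclideanSpace.proj i : EuclideanSpace ℝ (Fin m) →L[ℝ] ℝ).toLinearMap := by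
    ext x
    rw [hS]
    simp
  have hSdim : Module.finrank ℝ S + 1 = m := by
    have h1 := Module.Dual.finrank_ker_add_one_of_ne_zero (K := ℝ)
      (f := (EuclideanSpace.proj i : EuclideanSpace ℝ (Fin m) →L[ℝ] ℝ).toLinearMap) (by
        intro h
        have := LinearMap.congr_fun h (EuclideanSpace.single i 1)
        simp at this)
    rw [← hSker] at h1
    simpa using h1
  -- Injectivity makes the image of the bounding hyperplane a hyperplane again; `u` below spans its
  -- normal line.
  have hPdim : Module.finrank ℝ (LinearMap.range A)ᗮ = 1 := by
    have h1 := (LinearMap.range A).finrank_add_finrank_orthogonal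
    rw [LinearMap.finrank_range_of_inj hinj] at h1
    simp at h1
    omega
  obtain ⟨⟨u, huP⟩, hu0, hu⟩ := finrank_eq_one_iff'.1 hPdim
  have hu0' : u ≠ 0 := fun h => hu0 (Subtype.ext h)
  have hP : ∀ x, inner ℝ u x = 0 → x ∈ LinearMap.range A := by
    intro x hx
    rw [← (LinearMap.range A).orthogonal_orthogonal]
    rw [Submodule.mem_orthogonal]
    intro w hw
    obtain ⟨c, hc⟩ := hu ⟨w, hw⟩
    have hc' : c • u = w := congrArg Subtype.val hc
    rw [← hc', inner_smul_left, hx, mul_zero]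
  have hPu : ∀ s : S, inner ℝ u (A s) = 0 := fun s =>
    Submodule.inner_left_of_mem_orthogonal (LinearMap.mem_range_self A s) huP
  have huu : 0 < inner ℝ u u := by
    rw [real_inner_self_eq_norm_sq]; positivity
  have hconv : Convex ℝ {x : EuclideanSpace ℝ (Fin m) | 0 < x i} :=
    convex_halfSpace_gt (f := fun x : EuclideanSpace ℝ (Fin m) => x i)
      ⟨fun _ _ => rfl, fun _ _ => rfl⟩ 0
  -- A bounding point is mapped into the image hyperplane, which contains no nonzero multiple of its
  -- normal `u`.
  have hpos : ∀ c : ℝ, c ≠ 0 → 0 < g (c • u) i := by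
    intro c hc
    refine lt_of_le_of_ne (hg _) fun h => ?_
    have h1 : f (g (c • u)) = A ⟨g (c • u), (hS _).2 h.symm⟩ := hA ⟨_, (hS _).2 h.symm⟩
    have h2 := hPu ⟨g (c • u), (hS _).2 h.symm⟩
    rw [← h1, hfg, inner_smul_right] at h2
    exact (mul_ne_zero hc huu.ne') h2
  have hcont : ContinuousOn (fun x => inner ℝ u (f x)) {x : EuclideanSpace ℝ (Fin m) | 0 < x i} :=
    ContinuousOn.inner continuousOn_const (hf.mono fun x (hx : 0 < x i) => hx.le)
  -- On the connected open half-space `⟨u, f⟩` takes both signs, so it vanishes at some `x`. Then `f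
  -- x` is already the image of a bounding point, contradicting injectivity.
  have hivt := hconv.isPreconnected.intermediate_value (hpos (-1) (by norm_num))
    (hpos 1 (by norm_num)) hcont
  obtain ⟨x, hx, hx0⟩ := hivt (show (0 : ℝ) ∈ Icc _ _ by
    simp only [hfg, inner_smul_right]
    constructor <;> linarith)
  obtain ⟨s, hs⟩ := hP _ hx0
  have h1 := congrArg g hs
  rw [← hA, hgf _ (hSi s).ge, hgf x (le_of_lt hx)] at h1
  have hx' : 0 < x i := hx
  rw [← h1, hSi] at hx'
  exact lt_irrefl _ hx'

theorem exists_differentiableAt_of_lipschitzOnWith {E F : Type*} [NormedAddCommGroup E]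
    [NormedSpace ℝ E] [FiniteDimensional ℝ E] [NormedAddCommGroup F] [NormedSpace ℝ F]
    [FiniteDimensional ℝ F] {f : E → F} {L : NNReal} {O : Set E} (hO : IsOpen O)
    (hne : O.Nonempty) (hf : LipschitzOnWith L f O) : ∃ u ∈ O, DifferentiableAt ℝ f u := by
  let _ : MeasurableSpace E := borel E
  have : BorelSpace E := ⟨rfl⟩
  have hae := hf.ae_differentiableWithinAt_of_mem (μ := MeasureTheory.Measure.addHaar)
  have hpos : 0 < (MeasureTheory.Measure.addHaar : MeasureTheory.Measure E) O :=
    hO.measure_pos _ hne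
  by_contra! hcon
  refine hpos.ne' (MeasureTheory.measure_mono_null (fun u hu => ?_) (MeasureTheory.ae_iff.1 hae))
  rw [mem_ofPred_eq, Classical.not_imp]
  exact ⟨hu, fun h => hcon u hu (h.differentiableAt (hO.mem_nhds hu))⟩

/-- A relatively open subset of a half-space that meets the boundary is not bi-Lipschitz
homeomorphic to an open subset of the whole space. -/
theorem false_of_biLipschitz_halfSpace {i : Fin m}
    {f g : EuclideanSpace ℝ (Fin m) → EuclideanSpace ℝ (Fin m)}
    {D V : Set (EuclideanSpace ℝ (Fin m))} (hD : D ⊆ {x | 0 ≤ x i})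
    (hDo : ∀ x ∈ D, D ∈ 𝓝[{x | 0 ≤ x i}] x) (hV : IsOpen V) {L L' : NNReal}
    (hf : LipschitzOnWith L f D) (hg : LipschitzOnWith L' g V) (hfD : MapsTo f D V)
    (hgV : MapsTo g V D) (hgf : ∀ x ∈ D, g (f x) = x) (hfg : ∀ y ∈ V, f (g y) = y)
    {p : EuclideanSpace ℝ (Fin m)} (hp : p ∈ D) (hpi : p i = 0) : False := by
  set S : Submodule ℝ (EuclideanSpace ℝ (Fin m)) :=
    LinearMap.ker
    (EuclideanSpace.proj i : EuclideanSpace ℝ (Fin m) →L[ℝ] ℝ).toLinearMap with hSdef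
  have hS : ∀ x, x ∈ S ↔ x i = 0 := fun x => by simp [hSdef]
  have hSi : ∀ s : S, (s : EuclideanSpace ℝ (Fin m)) i = 0 := fun s => (hS s).1 s.2
  -- a point of differentiability on the flat boundary
  have hn : (fun s : S => p + (s : EuclideanSpace ℝ (Fin m))) ⁻¹' D ∈ 𝓝 (0 : S) := by
    have h1 : Tendsto (fun s : S => p + (s : EuclideanSpace ℝ (Fin m))) (𝓝 0)
        (𝓝[{x | 0 ≤ x i}] p) := by
      refine tendsto_nhdsWithin_iff.2 ⟨?_, Eventually.of_forall fun s => ?_⟩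
      · have : Continuous fun s : S => p + (s : EuclideanSpace ℝ (Fin m)) := by fun_prop
        simpa using this.tendsto 0
      · change 0 ≤ (p + (s : EuclideanSpace ℝ (Fin m))) i
        simp [hpi, hSi s]
    exact h1 (hDo p hp)
  obtain ⟨O, hOD, hO, h0⟩ := mem_nhds_iff.1 hn
  have hbL : LipschitzOnWith L (fun s : S => f (p + s)) O := by
    refine LipschitzOnWith.of_dist_le_mul fun s hs t ht => ?_
    refine (hf.dist_le_mul _ (hOD hs) _ (hOD ht)).trans (le_of_eq ?_)
    rw [dist_add_left]
    rfl
  obtain ⟨s₀, hs₀, hds⟩ := exists_differentiableAt_of_lipschitzOnWith hO ⟨0, h0⟩ hbL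
  set A := fderiv ℝ (fun s : S => f (p + s)) s₀ with hA
  set p₀ := p + (s₀ : EuclideanSpace ℝ (Fin m)) with hp₀
  have hp₀D : p₀ ∈ D := hOD hs₀
  have hp₀i : p₀ i = 0 := by simp [hp₀, hpi, hSi s₀]
  have hbase : ∀ x : EuclideanSpace ℝ (Fin m), Tendsto (fun j : ℕ => p₀ + (j : ℝ)⁻¹ • x)
      (hyperfilter ℕ) (𝓝 p₀) := fun x => by
    simpa using (tendsto_hyperfilter_inv.smul_const x).const_add p₀
  have hbase' : ∀ y : EuclideanSpace ℝ (Fin m), Tendsto (fun j : ℕ => f p₀ + (j : ℝ)⁻¹ • y)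
      (hyperfilter ℕ) (𝓝 (f p₀)) := fun x => by
    simpa using (tendsto_hyperfilter_inv.smul_const x).const_add (f p₀)
  have hDx : ∀ x : EuclideanSpace ℝ (Fin m), 0 ≤ x i →
      ∀ᶠ j : ℕ in hyperfilter ℕ, p₀ + (j : ℝ)⁻¹ • x ∈ D := by
    intro x hx
    refine (tendsto_nhdsWithin_iff.2 ⟨hbase x, Eventually.of_forall fun j => ?_⟩)
      (hDo p₀ hp₀D)
    change 0 ≤ (p₀ + (j : ℝ)⁻¹ • x) i
    simp only [PiLp.add_apply, PiLp.smul_apply, smul_eq_mul, hp₀i, zero_add]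
    positivity
  have hVy : ∀ y : EuclideanSpace ℝ (Fin m),
      ∀ᶠ j : ℕ in hyperfilter ℕ, f p₀ + (j : ℝ)⁻¹ • y ∈ V := fun y =>
    hbase' y (hV.mem_nhds (hfD hp₀D))
  -- Blowing up at the boundary point `p₀` of differentiability turns `D` into the half-space and
  -- `V` into the whole space.
  obtain ⟨f', hf'⟩ := exists_tendsto_rescale hf hp₀D
  obtain ⟨g', hg'⟩ := exists_tendsto_rescale hg (hfD hp₀D)
  have hg'i : ∀ y, 0 ≤ g' y i := by
    intro y
    have hcl : IsClosed {x : EuclideanSpace ℝ (Fin m) | 0 ≤ x i} :=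
      isClosed_le continuous_const (by fun_prop)
    refine hcl.mem_of_tendsto (hg' y (hVy y)) ?_
    filter_upwards [hVy y] with j hj
    have h1 : 0 ≤ g (f p₀ + (j : ℝ)⁻¹ • y) i := hD (hgV hj)
    simp only [rescale, hgf p₀ hp₀D, PiLp.smul_apply, PiLp.sub_apply, hp₀i,
      sub_zero, smul_eq_mul]
    positivity
  refine false_of_halfSpace_inverse (f := f') (g := g') (i := i) (S := S) ?_ hg'i ?_ ?_ hS
    A.toLinearMap ?_
  · refine LipschitzOnWith.continuousOn (K := L) (LipschitzOnWith.of_dist_le_mul ?_)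
    intro x hx y hy
    rw [dist_eq_norm, dist_eq_norm]
    exact norm_rescale_limit_sub_le hf (hDx x hx) (hDx y hy) (hf' x (hDx x hx)) (hf' y (hDx y hy))
  · intro y
    exact rescale_limit_leftInverse hf hgV hfg rfl (hgf p₀ hp₀D) (hVy y) (hg' y (hVy y))
      (hDx _ (hg'i y)) (hf' _ (hDx _ (hg'i y)))
  · intro x hx
    exact rescale_limit_leftInverse hg hfD hgf (hgf p₀ hp₀D) rfl (hDx x hx) (hf' x (hDx x hx))
      (hVy _) (hg' _ (hVy _))
  · intro s
    -- On the bounding hyperplane the rescalings converge to the derivative in the ordinary sense,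
    -- so the ultrafilter limit is linear there.
    have h1 := hf' (s : EuclideanSpace ℝ (Fin m)) (hDx _ (hSi s).ge)
    have h2 : Tendsto (fun j : ℕ => rescale f p₀ j (s : EuclideanSpace ℝ (Fin m))) atTop
        (𝓝 (A s)) := by
      have h3 := hds.hasFDerivAt.lim s (c := fun j : ℕ => (j : ℝ)) (l := atTop) (by
        simpa using tendsto_natCast_atTop_atTop (R := ℝ))
      refine h3.congr fun j => ?_
      simp [rescale, hp₀, add_assoc]
    rw [← Nat.cofinite_eq_atTop] at h2
    exact tendsto_nhds_unique h1 (h2.mono_left hyperfilter_le_cofinite)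

end Hyperplane

end LipWhitney

namespace LipWhitney

/-! ### Invariance of dimension and boundary for bi-Lipschitz homeomorphisms -/

section Interior

variable {m n : ℕ} {H H' : Type*} [TopologicalSpace H] [TopologicalSpace H']
  {I : ModelWithCorners ℝ (EuclideanSpace ℝ (Fin m)) H}
  {J : ModelWithCorners ℝ (EuclideanSpace ℝ (Fin n)) H'}
  {M N : Type*} [TopologicalSpace M] [TopologicalSpace N] [ChartedSpace H M] [ChartedSpace H' N]
  [IsManifold I ∞ M] [IsManifold J ∞ N]

theorem isInteriorPoint_iff_chartAt (p : M) {q : M} (hq : q ∈ (chartAt H p).source) :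
    I.IsInteriorPoint q ↔ (chartAt H p).extend I q ∈ interior (range I) := by
  rw [I.isInteriorPoint_iff_of_mem_atlas (n := (∞ : WithTop ℕ∞)) (by simp)
    (chart_mem_atlas H p) hq]
  refine ⟨fun h => (chartAt H p).interior_extend_target_subset_interior_range h, fun h => ?_⟩
  exact (chartAt H p).mem_interior_extend_target ((chartAt H p).map_source hq) h

theorem IsBoundaryModel.coord_eq_zero {i : Fin m} (hi : range I = {x | 0 ≤ x i})
    {x : EuclideanSpace ℝ (Fin m)} (hx : x ∈ range I) (hxi : x ∉ interior (range I)) :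
    x i = 0 := by
  by_contra hne
  have h0 : 0 ≤ x i := by rw [hi] at hx; exact hx
  refine hxi (mem_interior.2 ⟨{x | 0 < x i}, ?_, isOpen_lt continuous_const (by fun_prop),
    lt_of_le_of_ne h0 (Ne.symm hne)⟩)
  rw [hi]
  exact fun y (hy : 0 < y i) => hy.le

/-- A locally bi-Lipschitz homeomorphism does not map boundary points to interior points. -/
theorem isInteriorPoint_of_biLipschitz (hI : IsBoundaryModel I) (hmn : m = n)
    {f : M → N} {g : N → M} (hf : Continuous f) (hg : Continuous g) (hgf : LeftInverse g f)
    (hfg : RightInverse g f) (hLf : LipInCharts I J f) (hLg : LipInCharts J I g) {p : M}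
    (hp : J.IsInteriorPoint (f p)) : I.IsInteriorPoint p := by
  subst hmn
  by_contra hcon
  set φ := chartAt H p with hφ
  set ψ := chartAt H' (f p) with hψ
  have hpφ : p ∈ φ.source := mem_chart_source H p
  have hpψ : f p ∈ ψ.source := mem_chart_source H' (f p)
  have hφm : φ ∈ IsManifold.maximalAtlas I ∞ M := IsManifold.chart_mem_maximalAtlas p
  have hψm : ψ ∈ IsManifold.maximalAtlas J ∞ N := IsManifold.chart_mem_maximalAtlas (f p)
  rw [isInteriorPoint_iff_chartAt p hpφ] at hcon
  obtain ⟨i, hi⟩ : ∃ i, range I = {x | 0 ≤ x i} := by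
    rcases hI with h | h
    · rw [h] at hcon
      simp at hcon
    · exact h
  have hd : φ.extend I p ∈ localDomain I φ ψ f := extend_mem_localDomain hpφ hpψ
  have hd' : ψ.extend J (f p) ∈ localDomain J ψ φ g :=
    extend_mem_localDomain hpψ (by rwa [hgf p])
  obtain ⟨L, t, ht, hL⟩ := hLf.lipAt hf hφm hψm hd
  obtain ⟨L', t', ht', hL'⟩ := hLg.lipAt hg hψm hφm hd'
  have hW : φ.source ∩ f ⁻¹' (ψ.source ∩ J.interior N) ∩ φ.extend I ⁻¹' t ∩
      f ⁻¹' (ψ.extend J ⁻¹' t') ∈ 𝓝 p := by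
    refine inter_mem (inter_mem (inter_mem (φ.open_source.mem_nhds hpφ) ?_) ?_) ?_
    · exact hf.continuousAt.preimage_mem_nhds (inter_mem (ψ.open_source.mem_nhds hpψ)
        ((J.isOpen_interior (M := N) (n := (∞ : WithTop ℕ∞)) (by simp)).mem_nhds hp))
    · rw [← φ.map_extend_nhds hpφ] at ht
      exact ht
    · rw [← ψ.map_extend_nhds hpψ] at ht'
      exact hf.continuousAt.preimage_mem_nhds ht'
  obtain ⟨W, hWs, hWo, hpW⟩ := mem_nhds_iff.1 hW
  have hfW : f '' W = g ⁻¹' W := congrFun (image_eq_preimage_of_inverse hgf hfg) _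
  have hWφ : ∀ z ∈ W, z ∈ φ.source := fun z hz => (hWs hz).1.1.1
  have hWψ : ∀ z ∈ W, f z ∈ ψ.source := fun z hz => (hWs hz).1.1.2.1
  have hF : ∀ z ∈ W, localRep I J φ ψ f (φ.extend I z) = ψ.extend J (f z) := fun z hz => by
    simp [localRep, hWφ z hz]
  have hG : ∀ z ∈ W, localRep J I ψ φ g (ψ.extend J (f z)) = φ.extend I z := fun z hz => by
    simp [localRep, hWψ z hz, hgf z]
  refine false_of_biLipschitz_halfSpace (i := i) (f := localRep I J φ ψ f)
    (g := localRep J I ψ φ g) (D := φ.extend I '' W) (V := ψ.extend J '' (f '' W))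
    (L := L) (L' := L') (p := φ.extend I p)
    ?_ ?_ ?_ ?_ ?_ ?_ ?_ ?_ ?_ (mem_image_of_mem _ hpW) ?_
  · rw [← hi]
    rintro _ ⟨z, -, rfl⟩
    simp
  · rintro _ ⟨z, hz, rfl⟩
    rw [← hi, ← φ.map_extend_nhds (hWφ z hz)]
    exact image_mem_map (hWo.mem_nhds hz)
  -- The set `W` was chosen with image in the interior of `N`, where the chart is open into the full
  -- Euclidean space.
  · rw [isOpen_iff_mem_nhds]
    rintro _ ⟨_, ⟨z, hz, rfl⟩, rfl⟩
    rw [← ψ.map_extend_nhds_of_mem_interior_range (hWψ z hz)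
      ((isInteriorPoint_iff_chartAt (f p) (hWψ z hz)).1 (hWs hz).1.1.2.2)]
    refine image_mem_map ?_
    rw [hfW]
    exact (hWo.preimage hg).mem_nhds (by rwa [mem_preimage, hgf z])
  · refine hL.mono ?_
    rintro _ ⟨z, hz, rfl⟩
    exact (hWs hz).1.2
  · refine hL'.mono ?_
    rintro _ ⟨_, ⟨z, hz, rfl⟩, rfl⟩
    exact (hWs hz).2
  · rintro _ ⟨z, hz, rfl⟩
    rw [hF z hz]
    exact mem_image_of_mem _ (mem_image_of_mem _ hz)
  · rintro _ ⟨_, ⟨z, hz, rfl⟩, rfl⟩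
    rw [hG z hz]
    exact mem_image_of_mem _ hz
  · rintro _ ⟨z, hz, rfl⟩
    rw [hF z hz, hG z hz]
  · rintro _ ⟨_, ⟨z, hz, rfl⟩, rfl⟩
    rw [hG z hz, hF z hz]
  · exact IsBoundaryModel.coord_eq_zero hi (by simp) hcon

theorem LipInCharts.locallyExpanding {f : M → N} {g : N → M} (hf : Continuous f)
    (hg : Continuous g) (hgf : LeftInverse g f) (hL : LipInCharts J I g) :
    LocallyExpanding I J f := fun p =>
  ⟨_, IsManifold.chart_mem_maximalAtlas p, _, IsManifold.chart_mem_maximalAtlas (f p),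
    mem_chart_source _ p, mem_chart_source _ (f p),
    hL.exists_expanding hf hg hgf (IsManifold.chart_mem_maximalAtlas p)
      (IsManifold.chart_mem_maximalAtlas (f p))
      (extend_mem_localDomain (mem_chart_source _ p) (mem_chart_source _ (f p)))⟩

/-- Each of `f`, `g` is locally expanding because its inverse is locally Lipschitz, so each
dimension bounds the other. -/
theorem eq_of_biLipschitz [Nonempty M] (hI : IsBoundaryModel I) (hJ : IsBoundaryModel J)
    {f : M → N} {g : N → M} (hf : Continuous f) (hg : Continuous g) (hgf : LeftInverse g f)
    (hfg : RightInverse g f) (hLf : LipInCharts I J f) (hLg : LipInCharts J I g) : m = n := by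
  have : Nonempty N := ⟨f (Classical.arbitrary M)⟩
  exact le_antisymm ((hLg.locallyExpanding hf hg hgf).finrank_le hI hf hLf)
    ((hLf.locallyExpanding hg hf hfg).finrank_le hJ hg hLg)

theorem diffeos_subset_boundaryMaps [Nonempty M] (hI : IsBoundaryModel I)
    (hJ : IsBoundaryModel J) (k : ℕ) : diffeos I J M N k ⊆ boundaryMaps I J M N k := by
  rintro f ⟨g, hgf, hfg⟩ p hp
  have hmn := eq_of_biLipschitz hI hJ f.isCkLip.1.continuous g.isCkLip.1.continuous hgf hfg
    f.isCkLip.lipInCharts g.isCkLip.lipInCharts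
  rw [← J.compl_interior]
  rw [← I.compl_interior] at hp
  exact fun h => hp (isInteriorPoint_of_biLipschitz hI hmn f.isCkLip.1.continuous
    g.isCkLip.1.continuous hgf hfg f.isCkLip.lipInCharts g.isCkLip.lipInCharts h)

end Interior

end LipWhitney

namespace LipWhitney

/-! ### The seminorm and neighbourhoods in the strong topology -/

section Seminorm

variable {E F : Type*} [NormedAddCommGroup E] [NormedSpace ℝ E]
  [NormedAddCommGroup F] [NormedSpace ℝ F]

theorem enorm_iteratedFDerivWithin_le_lipSeminorm {k j : ℕ} (hj : j ≤ k) (s : Set E) {K : Set E}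
    (f : E → F) {x : E} (hx : x ∈ K) :
    ‖iteratedFDerivWithin ℝ j f s x‖ₑ ≤ lipSeminorm k s K f :=
  le_sup_of_le_left (le_iSup₂_of_le j (Finset.mem_range.2 (Nat.lt_succ_of_le hj))
    (le_iSup₂_of_le x hx le_rfl))

theorem enorm_le_lipSeminorm (k : ℕ) (s : Set E) {K : Set E} (f : E → F) {x : E} (hx : x ∈ K) :
    ‖f x‖ₑ ≤ lipSeminorm k s K f := by
  refine le_trans (le_of_eq ?_) (enorm_iteratedFDerivWithin_le_lipSeminorm k.zero_le s f hx)
  rw [← ofReal_norm, ← ofReal_norm, norm_iteratedFDerivWithin_zero]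

theorem lipSeminorm_zero (k : ℕ) (s K : Set E) : lipSeminorm k s K (0 : E → F) = 0 := by
  have h : ∀ j x, iteratedFDerivWithin ℝ j (0 : E → F) s x = 0 := fun j x => by
    rw [iteratedFDerivWithin_zero]; rfl
  have h' : ∀ j, ‖(0 : ContinuousMultilinearMap ℝ (fun _ : Fin j => E) F)‖ₑ = 0 := fun j => by
    rw [← ofReal_norm, norm_zero, ENNReal.ofReal_zero]
  simp [lipSeminorm, h, h']

/-- On a convex set the seminorm bounds the Lipschitz constant of the map itself. -/
theorem lipschitzOnWith_of_lipSeminorm_le {k : ℕ} {s K : Set E} {f : E → F} {ε : NNReal}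
    (hs : UniqueDiffOn ℝ s) (hKs : K ⊆ s) (hK : Convex ℝ K)
    (hf : 1 ≤ k → ∀ x ∈ K, DifferentiableWithinAt ℝ f s x) (h : lipSeminorm k s K f ≤ ε) :
    LipschitzOnWith ε f K := by
  -- For `k = 0` the difference quotients in the seminorm are those of the map itself; for `k ≥ 1`
  -- the first derivative is bounded and convexity gives the mean value inequality.
  rcases k.eq_zero_or_pos with rfl | hk
  · intro x hx y hy
    rcases eq_or_ne x y with rfl | hxy
    · simp
    have h1 : ‖iteratedFDerivWithin ℝ 0 f s x - iteratedFDerivWithin ℝ 0 f s y‖ₑ / ‖x - y‖ₑ ≤ ε :=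
      (le_sup_of_le_right (le_iSup₂_of_le y hy (le_iSup₂ (f := fun z (_ : z ∈ K \ {y}) =>
        ‖iteratedFDerivWithin ℝ 0 f s z - iteratedFDerivWithin ℝ 0 f s y‖ₑ / ‖z - y‖ₑ)
        x ⟨hx, hxy⟩))).trans h
    rw [ENNReal.div_le_iff (by simpa [sub_eq_zero] using hxy) (by simp)] at h1
    rw [iteratedFDerivWithin_zero_eq_comp, comp_apply, comp_apply, ← map_sub] at h1
    rw [edist_eq_enorm_sub, edist_eq_enorm_sub]
    rwa [← ofReal_norm (f x - f y), ← LinearIsometryEquiv.norm_map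
      (continuousMultilinearCurryFin0 ℝ E F).symm, ofReal_norm]
  · refine hK.lipschitzOnWith_of_nnnorm_hasFDerivWithin_le
      (fun x hx => (hf hk x hx).hasFDerivWithinAt.mono hKs) fun x hx => ?_
    have h1 := (enorm_iteratedFDerivWithin_le_lipSeminorm (Nat.succ_le_of_lt hk) s f hx).trans h
    rw [← ofReal_norm, Nat.succ_eq_add_one, zero_add,
      norm_iteratedFDerivWithin_one f (hs x (hKs hx)), ofReal_norm] at h1
    exact_mod_cast h1

end Seminorm

/-- Uniform continuity at a compact set, where only one of the two points is confined to it: the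
values of the perturbed map may leave `C`. -/
theorem exists_forall_dist_lt_of_continuousOn {X Y : Type*} [PseudoMetricSpace X]
    [PseudoMetricSpace Y] {g : X → Y} {T C : Set X} (hg : ContinuousOn g T) (hC : IsCompact C)
    (hCT : C ⊆ T) {η : ℝ} (hη : 0 < η) :
    ∃ ε > 0, ∀ a ∈ C, ∀ b ∈ T, dist b a < ε → dist (g b) (g a) < η := by
  have hC' : IsCompact ((↑) ⁻¹' C : Set T) := by
    rw [Subtype.isCompact_iff, Subtype.image_preimage_coe, inter_eq_right.2 hCT]
    exact hC
  have := hC'.uniformContinuousAt_of_continuousAt (T.domRestrict g)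
    (fun a _ => (continuousOn_iff_continuous_domRestrict.1 hg).continuousAt) (Metric.dist_mem_uniformity hη)
  obtain ⟨ε, hε, h⟩ := Metric.mem_uniformity_dist.1 this
  refine ⟨ε, hε, fun a ha b hb hab => ?_⟩
  rw [dist_comm] at hab ⊢
  exact h (a := ⟨a, hCT ha⟩) (b := ⟨b, hb⟩) hab ha

theorem exists_metricSpace_eq (X : Type*) [t : TopologicalSpace X]
    [TopologicalSpace.MetrizableSpace X] :
    ∃ d : MetricSpace X, d.toPseudoMetricSpace.toUniformSpace.toTopologicalSpace = t :=
  ⟨TopologicalSpace.metrizableSpaceMetric X, rfl⟩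

section Charts

variable {m n : ℕ} {H H' : Type*} [TopologicalSpace H] [TopologicalSpace H']
  {I : ModelWithCorners ℝ (EuclideanSpace ℝ (Fin m)) H}
  {J : ModelWithCorners ℝ (EuclideanSpace ℝ (Fin n)) H'}
  {M N : Type*} [TopologicalSpace M] [MetricSpace N] [ChartedSpace H M] [ChartedSpace H' N]
  [IsManifold I ∞ M] [IsManifold J ∞ N]

theorem CkLip.differentiableWithinAt_localRep {k : ℕ} (f : CkLip I J M N k) (hk : 1 ≤ k)
    {φ : OpenPartialHomeomorph M H} (hφ : φ ∈ IsManifold.maximalAtlas I ∞ M)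
    {ψ : OpenPartialHomeomorph N H'} (hψ : ψ ∈ IsManifold.maximalAtlas J ∞ N)
    {x : EuclideanSpace ℝ (Fin m)} (hx : x ∈ localDomain I φ ψ f.toFun) :
    DifferentiableWithinAt ℝ (localRep I J φ ψ f.toFun) (range I) x :=
  ((ContMDiff.contDiffOn_localRep f.isCkLip.1 (by exact_mod_cast le_top) hφ hψ x hx
    ).differentiableWithinAt (by exact_mod_cast (Nat.one_le_iff_ne_zero.1 hk))
    ).mono_of_mem_nhdsWithin (localDomain_mem_nhdsWithin f.isCkLip.1.continuous hx)

theorem continuousOn_localRep {f : M → N} (hf : Continuous f) (φ : OpenPartialHomeomorph M H)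
    (ψ : OpenPartialHomeomorph N H') :
    ContinuousOn (localRep I J φ ψ f) (localDomain I φ ψ f) := fun _ hx =>
  (continuousWithinAt_localRep hf hx).mono localDomain_subset_range

/-- In the strong topology one can control locally finitely many coordinate expressions: their
uniform distance and the Lipschitz constant of the difference. -/
theorem exists_isOpen_forall_lipschitz_sub {k : ℕ} (f : CkLip I J M N k) {ι : Type}
    {φ : ι → OpenPartialHomeomorph M H} {ψ : ι → OpenPartialHomeomorph N H'}
    {K : ι → Set (EuclideanSpace ℝ (Fin m))}
    (hφ : ∀ i, φ i ∈ IsManifold.maximalAtlas I ∞ M)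
    (hψ : ∀ i, ψ i ∈ IsManifold.maximalAtlas J ∞ N)
    (hK : ∀ i, IsCompact (K i)) (hKc : ∀ i, Convex ℝ (K i))
    (hKf : ∀ i, K i ⊆ localDomain I (φ i) (ψ i) f.toFun)
    (hfin : LocallyFinite fun i => ((φ i).extend I).symm '' K i)
    {η : ι → NNReal} (hη : ∀ i, 0 < η i) :
    ∃ S : Set (CkLip I J M N k), IsOpen S ∧ f ∈ S ∧ ∀ h ∈ S, ∀ i,
      K i ⊆ localDomain I (φ i) (ψ i) h.toFun ∧
      (∀ x ∈ K i, dist (h.toFun (((φ i).extend I).symm x)) (f.toFun (((φ i).extend I).symm x)) < η i) ∧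
      LipschitzOnWith (η i) (localRep I J (φ i) (ψ i) h.toFun - localRep I J (φ i) (ψ i) f.toFun)
        (K i) := by
  have hFt : ∀ (h : CkLip I J M N k) i, ∀ x ∈ localDomain I (φ i) (ψ i) h.toFun,
      localRep I J (φ i) (ψ i) h.toFun x ∈ ((ψ i).extend J).target := fun h i x hx =>
    ((ψ i).extend J).map_source (by rw [(ψ i).extend_source]; exact hx.2)
  -- The seminorm measures distance in the coordinates of `ψ i`; this modulus converts it to
  -- distance in `N`.
  have key : ∀ i, ∃ ε > 0, ∀ a ∈ localRep I J (φ i) (ψ i) f.toFun '' K i,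
      ∀ b ∈ ((ψ i).extend J).target, dist b a < ε →
      dist (((ψ i).extend J).symm b) (((ψ i).extend J).symm a) < η i := fun i =>
    exists_forall_dist_lt_of_continuousOn ((ψ i).continuousOn_extend_symm)
      ((hK i).image_of_continuousOn ((continuousOn_localRep f.isCkLip.1.continuous _ _).mono (hKf i)))
      (image_subset_iff.2 fun x hx => hFt f i x (hKf i hx)) (hη i)
  choose ε hε hεd using key
  refine ⟨⋂ i, elementaryNhd I J f (φ i) (ψ i) (K i) (min (η i) (ENNReal.ofReal (ε i))),
    TopologicalSpace.isOpen_generateFrom_of_mem ⟨f, ι, φ, ψ, K, _, fun i => ⟨hφ i, hψ i, hK i, hKf i, ?_⟩,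
      hfin, rfl⟩, mem_iInter.2 fun i => ⟨hKf i, ?_⟩, fun h hh i => ?_⟩
  · exact lt_min (by exact_mod_cast hη i) (ENNReal.ofReal_pos.2 (hε i))
  · rw [sub_self, lipSeminorm_zero]
    exact lt_min (by exact_mod_cast hη i) (ENNReal.ofReal_pos.2 (hε i))
  obtain ⟨hKh, hlt⟩ := mem_iInter.1 hh i
  refine ⟨hKh, fun x hx => ?_, ?_⟩
  · have h1 := (enorm_le_lipSeminorm k (range I) _ hx).trans_lt (hlt.trans_le (min_le_right _ _))
    have h2 := hεd i _ (mem_image_of_mem _ hx) _ (hFt h i x (hKh hx)) ?_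
    · have e : ∀ g : CkLip I J M N k, x ∈ localDomain I (φ i) (ψ i) g.toFun →
          ((ψ i).extend J).symm (localRep I J (φ i) (ψ i) g.toFun x) =
          g.toFun (((φ i).extend I).symm x) := fun g hg => (ψ i).extend_left_inv hg.2
      rwa [e h (hKh hx), e f (hKf i hx)] at h2
    · rw [dist_eq_norm]
      rwa [← ofReal_norm, ENNReal.ofReal_lt_ofReal_iff (hε i)] at h1
  · refine lipschitzOnWith_of_lipSeminorm_le I.uniqueDiffOn
      ((hKf i).trans localDomain_subset_range) (hKc i) (fun hk x hx => ?_)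
      (hlt.le.trans (min_le_left _ _))
    exact (h.differentiableWithinAt_localRep hk (hφ i) (hψ i) (hKh hx)).sub
      (f.differentiableWithinAt_localRep hk (hφ i) (hψ i) (hKf i hx))

end Charts

/-! ### Locally finite covers by coordinate balls -/

section Cover

variable {m : ℕ} {H : Type*} [TopologicalSpace H]
  {I : ModelWithCorners ℝ (EuclideanSpace ℝ (Fin m)) H}
  {M : Type*} [TopologicalSpace M] [ChartedSpace H M]

variable (I) in
/-- The preimage of a ball under the preferred chart at `p`. -/
def chartBall (p : M) (r : ℝ) : Set M :=
  (extChartAt I p).source ∩ extChartAt I p ⁻¹' Metric.ball (extChartAt I p p) r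

variable (I) in
/-- A closed ball in the preferred chart at `p`. -/
def modelBall (p : M) (r : ℝ) : Set (EuclideanSpace ℝ (Fin m)) :=
  Metric.closedBall (extChartAt I p p) r ∩ range I

theorem isOpen_chartBall (p : M) (r : ℝ) : IsOpen (chartBall I p r) := by
  rw [chartBall, extChartAt_source]
  exact isOpen_extChartAt_preimage p Metric.isOpen_ball

theorem isCompact_modelBall (p : M) (r : ℝ) : IsCompact (modelBall I p r) :=
  (isCompact_closedBall _ _).inter_right I.isClosed_range

theorem convex_modelBall (p : M) (r : ℝ) : Convex ℝ (modelBall I p r) :=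
  (convex_closedBall _ _).inter I.convex_range

theorem modelBall_mono (p : M) {r R : ℝ} (h : r ≤ R) : modelBall I p r ⊆ modelBall I p R :=
  inter_subset_inter_left _ (Metric.closedBall_subset_closedBall h)

theorem mem_chartBall_self (p : M) {r : ℝ} (hr : 0 < r) : p ∈ chartBall I p r :=
  ⟨mem_extChartAt_source p, Metric.mem_ball_self hr⟩

theorem extChartAt_mem_modelBall {p q : M} {r : ℝ} (hq : q ∈ chartBall I p r) :
    extChartAt I p q ∈ modelBall I p r :=
  ⟨Metric.ball_subset_closedBall hq.2, by simp [extChartAt, OpenPartialHomeomorph.extend]⟩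

theorem exists_modelBall_subset (p : M) {s : Set (EuclideanSpace ℝ (Fin m))}
    (hs : s ∈ 𝓝[range I] (extChartAt I p p)) : ∃ r > 0, modelBall I p r ⊆ s := by
  obtain ⟨r, hr, h⟩ := Metric.mem_nhdsWithin_iff.1 hs
  exact ⟨r / 2, half_pos hr, fun x hx =>
    h ⟨Metric.closedBall_subset_ball (half_lt_self hr) hx.1, hx.2⟩⟩

theorem hasBasis_chartBall (p : M) {R : ℝ} (hR : 0 < R) :
    (𝓝 p).HasBasis (fun r => 0 < r ∧ r < R) (chartBall I p) := by
  refine ⟨fun U => ⟨fun hU => ?_, fun ⟨r, hr, h⟩ =>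
    mem_of_superset ((isOpen_chartBall p r).mem_nhds (mem_chartBall_self p hr.1)) h⟩⟩
  rw [← map_extChartAt_symm_nhdsWithin_range (I := I) p, mem_map] at hU
  obtain ⟨r, hr, h⟩ := exists_modelBall_subset p hU
  refine ⟨min r (R / 2), ⟨lt_min hr (half_pos hR), (min_le_right _ _).trans_lt (half_lt_self hR)⟩,
    fun q hq => ?_⟩
  have := h (modelBall_mono p (min_le_left _ _) (extChartAt_mem_modelBall hq))
  rwa [mem_preimage, (extChartAt I p).left_inv hq.1] at this

/-- A locally finite cover by coordinate balls of prescribed maximal sizes, with a shrinking to a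
cover by compact sets. -/
theorem exists_locallyFinite_chartBall_cover [T2Space M] [SecondCountableTopology M]
    (I : ModelWithCorners ℝ (EuclideanSpace ℝ (Fin m)) H) {R : M → ℝ}
    (hR : ∀ p, 0 < R p) (hRt : ∀ p, modelBall I p (R p) ⊆ (extChartAt I p).target) :
    ∃ (ι : Type) (_ : Countable ι) (c : ι → M) (r : ι → ℝ) (C : ι → Set M),
      (∀ i, 0 < r i) ∧ (∀ i, r i ≤ R (c i)) ∧ (∀ i, IsCompact (C i)) ∧
      (∀ i, C i ⊆ chartBall I (c i) (r i)) ∧ ⋃ i, C i = univ ∧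
      LocallyFinite fun i => (extChartAt I (c i)).symm '' modelBall I (c i) (r i) := by
  have : LocallyCompactSpace M := Manifold.locallyCompact_of_finiteDimensional I
  obtain ⟨α, c, r, hr, hcov, hfin⟩ := refinement_of_locallyCompact_sigmaCompact_of_nhds_basis
    (fun p : M => hasBasis_chartBall (I := I) p (hR p))
  have hα : Countable α := countable_univ_iff.1
    (hfin.countable_univ fun i => ⟨c i, mem_chartBall_self (c i) (hr i).1⟩)
  obtain ⟨C, hCu, hCc, hCs⟩ := exists_iUnion_eq_closed_subset (fun i => isOpen_chartBall (c i) (r i))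
    hfin.point_finite hcov
  have hcomp : ∀ i, IsCompact (C i) := fun i => by
    have : IsCompact ((extChartAt I (c i)).symm '' modelBall I (c i) (r i)) :=
      (isCompact_modelBall _ _).image_of_continuousOn ((continuousOn_extChartAt_symm (c i)).mono
        ((modelBall_mono _ (hr i).2.le).trans (hRt _)))
    refine this.of_isClosed_subset (hCc i) fun q hq => ?_
    exact ⟨_, extChartAt_mem_modelBall (hCs i hq), (extChartAt I (c i)).left_inv (hCs i hq).1⟩
  -- Radii are reduced once more so that the closed balls of radius `r'` lie in the open ones, whose
  -- local finiteness they inherit, and still cover the `C i`.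
  have hsh : ∀ i, ∃ r' ∈ Ioo 0 (r i), extChartAt I (c i) '' C i ⊆
      Metric.ball (extChartAt I (c i) (c i)) r' := fun i =>
    exists_pos_lt_subset_ball (hr i).1 ((hcomp i).image_of_continuousOn
      ((continuousOn_extChartAt (c i)).mono fun q hq => (hCs i hq).1)).isClosed
      (image_subset_iff.2 fun q hq => (hCs i hq).2)
  choose r' hr' hCr' using hsh
  have hfin' : LocallyFinite fun i => (extChartAt I (c i)).symm '' modelBall I (c i) (r' i) := by
    refine hfin.subset fun i => ?_
    rintro _ ⟨x, hx, rfl⟩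
    have hxt := hRt _ (modelBall_mono _ ((hr' i).2.le.trans (hr i).2.le) hx)
    refine ⟨(extChartAt I (c i)).map_target hxt, ?_⟩
    rw [mem_preimage, (extChartAt I (c i)).right_inv hxt]
    exact Metric.closedBall_subset_ball (hr' i).2 hx.1
  -- Reindexing by a subset of `ℕ` puts the index set in `Type`, as required for basic sets.
  obtain ⟨e, he⟩ := exists_injective_nat α
  let s := Equiv.ofInjective e he
  refine ⟨range e, inferInstance, c ∘ s.symm, r' ∘ s.symm, C ∘ s.symm, fun i => (hr' _).1,
    fun i => (hr' _).2.le.trans (hr _).2.le, fun i => hcomp _,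
    fun i q hq => ⟨(hCs _ hq).1, hCr' _ (mem_image_of_mem _ hq)⟩, ?_,
    hfin'.comp_injective s.symm.injective⟩
  rw [← hCu]
  exact s.symm.surjective.iUnion_comp C

end Cover

end LipWhitney

namespace LipWhitney

/-! ### Perturbing embeddings and proper maps -/

section Perturbation

variable {X Y : Type*} [TopologicalSpace X] [MetricSpace Y] {ι : Type*}

/-- A compact `Q` minus an open neighbourhood of `p` has closed image, which misses `h p` by
injectivity. So only the preimages of small neighbourhoods need to be trapped in a compact set. -/
theorem comap_nhds_le_of_isCompact {h : X → Y} (hc : Continuous h) (hi : Injective h) {p : X}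
    {Q : Set X} (hQ : IsCompact Q) (hpQ : Q ∈ comap h (𝓝 (h p))) : comap h (𝓝 (h p)) ≤ 𝓝 p := by
  refine fun U hU => ?_
  obtain ⟨U', hU'U, hU'o, hpU'⟩ := mem_nhds_iff.1 hU
  have h1 : IsClosed (h '' (Q \ U')) := ((hQ.diff hU'o).image hc).isClosed
  have h2 : h p ∉ h '' (Q \ U') := by
    rintro ⟨q, hq, hqp⟩
    exact hq.2 (hi hqp ▸ hpU')
  filter_upwards [hpQ, preimage_mem_comap (h1.isOpen_compl.mem_nhds h2)] with q hq hq'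
  by_contra hqU
  exact hq' ⟨q, ⟨hq, fun hqU' => hqU (hU'U hqU')⟩, rfl⟩

/-- A map that is injective on the members of a locally finite cover and close enough to an
embedding is an embedding. -/
theorem exists_pos_forall_isEmbedding {f : X → Y} (hf : IsEmbedding f) {C V L : ι → Set X}
    (hC : ∀ i, IsCompact (C i)) (hV : ∀ i, IsOpen (V i)) (hL : ∀ i, IsCompact (L i))
    (hCV : ∀ i, C i ⊆ V i) (hVL : ∀ i, V i ⊆ L i) (hcov : ⋃ i, C i = univ)
    (hfin : LocallyFinite L) :
    ∃ ε : ι → NNReal, (∀ i, 0 < ε i) ∧ ∀ h : X → Y, Continuous h →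
      (∀ i, ∀ q ∈ C i, dist (h q) (f q) < ε i) → (∀ i, InjOn h (V i)) → IsEmbedding h := by
  -- The factor three leaves room for two approximation errors and the distance of the two values of
  -- `h`.
  have key : ∀ i, ∃ ε : NNReal, 0 < ε ∧ ∀ q ∈ C i, ∀ q', dist (f q) (f q') < 3 * ε → q' ∈ V i := by
    intro i
    obtain ⟨O, hO, hOV⟩ := hf.isInducing.isOpen_iff.1 (hV i)
    obtain ⟨δ, hδ, hδO⟩ := ((hC i).image hf.continuous).exists_thickening_subset_open hO
      (image_subset_iff.2 (hOV ▸ hCV i))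
    refine ⟨Real.toNNReal (δ / 3), Real.toNNReal_pos.2 (by positivity), fun q hq q' hqq' => ?_⟩
    rw [← hOV]
    refine hδO (Metric.mem_thickening_iff.2 ⟨_, mem_image_of_mem f hq, ?_⟩)
    rw [dist_comm]
    rw [Real.coe_toNNReal _ (by positivity)] at hqq'
    linarith
  choose ε hε hεV using key
  refine ⟨ε, hε, fun h hc hd hinj => ?_⟩
  have hmem : ∀ p, ∃ i, p ∈ C i := fun p => mem_iUnion.1 (hcov ▸ mem_univ p)
  -- Working with the index of larger tolerance puts both points into the same `V i`, where `h` is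
  -- injective.
  have hlt : ∀ i j q q', q ∈ C i → q' ∈ C j → h q = h q' → ε j ≤ ε i → q = q' := by
    intro i j q q' hq hq' hqq' hji
    have h1 := hd i q hq
    have h2 := hd j q' hq'
    have h3 : (ε j : ℝ) ≤ ε i := hji
    have h4 : (0 : ℝ) < ε i := hε i
    refine hinj i (hCV i hq) (hεV i q hq q' ?_) hqq'
    have := dist_triangle4 (f q) (h q) (h q') (f q')
    rw [hqq', dist_self, dist_comm (f q) (h q')] at this
    rw [hqq'] at h1
    linarith
  have hi : Injective h := by
    intro q q' hqq'
    obtain ⟨i, hi⟩ := hmem q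
    obtain ⟨j, hj⟩ := hmem q'
    rcases le_total (ε j) (ε i) with hij | hij
    · exact hlt i j q q' hi hj hqq' hij
    · exact (hlt j i q' q hj hi hqq'.symm hij).symm
  refine ⟨isInducing_iff_nhds.2 fun p => le_antisymm (map_le_iff_le_comap.1 hc.continuousAt) ?_, hi⟩
  obtain ⟨i, hip⟩ := hmem p
  have hpf : {j | p ∈ V j}.Finite := (hfin.point_finite p).subset fun j hj => hVL j hj
  -- If `h y` is near `h p` and `y ∈ C j`, comparing tolerances gives either `y ∈ V i`, or `p ∈ V
  -- j`, which happens for finitely many `j` only.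
  refine comap_nhds_le_of_isCompact hc hi ((hL i).union (hpf.isCompact_biUnion fun j _ => hC j)) ?_
  refine mem_of_superset (preimage_mem_comap (Metric.ball_mem_nhds (h p) (show (0 : ℝ) < ε i from hε i)))
    fun y hy => ?_
  obtain ⟨j, hjy⟩ := hmem y
  have h1 := hd i p hip
  have h2 := hd j y hjy
  have h3 : dist (h y) (h p) < ε i := hy
  have h4 := dist_triangle4 (f y) (h y) (h p) (f p)
  rw [dist_comm (f y) (h y)] at h4
  rcases le_total (ε j) (ε i) with hij | hij
  · have hij' : (ε j : ℝ) ≤ ε i := hij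
    exact Or.inl (hVL i (hεV i p hip y (by rw [dist_comm]; linarith)))
  · have hij' : (ε i : ℝ) ≤ ε j := hij
    exact Or.inr (mem_biUnion (show j ∈ {j | p ∈ V j} from hεV j y hjy p (by linarith)) hjy)

/-- A map close enough to a proper map is proper. -/
theorem exists_pos_forall_isCompact_preimage [LocallyCompactSpace Y] [Countable ι] {f : X → Y}
    (hf : ∀ K : Set Y, IsCompact K → IsCompact (f ⁻¹' K)) {C : ι → Set X}
    (hC : ∀ i, IsCompact (C i)) (hcov : ⋃ i, C i = univ) :
    ∃ ε : ι → NNReal, (∀ i, 0 < ε i) ∧ ∀ h : X → Y, Continuous h →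
      (∀ i, ∀ q ∈ C i, dist (h q) (f q) < ε i) → ∀ K : Set Y, IsCompact K → IsCompact (h ⁻¹' K) := by
  obtain ⟨e, he⟩ := exists_injective_nat ι
  -- The tolerances tend to zero along the index set. For compact `K` all but finitely many are
  -- below the thickening radius `δ`, and the finitely many remaining `C i` are compact.
  refine ⟨fun i => ((e i : NNReal) + 1)⁻¹, fun i => by positivity, fun h hc hd K hK => ?_⟩
  obtain ⟨δ, hδ, hKδ⟩ := hK.exists_isCompact_cthickening
  have hfin : {i | δ ≤ ((e i : ℝ) + 1)⁻¹}.Finite := by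
    obtain ⟨n, hn⟩ := exists_nat_gt δ⁻¹
    refine ((finite_lt_nat n).preimage he.injOn).subset fun i hi => ?_
    have h1 : (e i : ℝ) + 1 ≤ δ⁻¹ := by
      rw [← inv_inv ((e i : ℝ) + 1)]
      exact inv_anti₀ hδ hi
    have : (e i : ℝ) < n := by linarith
    exact_mod_cast this
  refine ((hf _ hKδ).union (hfin.isCompact_biUnion fun i _ => hC i)).of_isClosed_subset
    (hK.isClosed.preimage hc) fun q hq => ?_
  obtain ⟨i, hi⟩ := mem_iUnion.1 (hcov ▸ mem_univ q)
  by_cases hiδ : δ ≤ ((e i : ℝ) + 1)⁻¹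
  · exact Or.inr (mem_biUnion (show i ∈ {i | δ ≤ ((e i : ℝ) + 1)⁻¹} from hiδ) hi)
  · refine Or.inl (Metric.mem_cthickening_of_dist_le _ _ _ _ hq ?_)
    have := hd i q hi
    rw [dist_comm]
    push_cast at this
    linarith

end Perturbation

end LipWhitney

namespace LipWhitney

/-! ### Local openness in Euclidean space -/

section LocalOpenness

variable {E F : Type*} [NormedAddCommGroup E] [InnerProductSpace ℝ E] [FiniteDimensional ℝ E]
  [NormedAddCommGroup F] [InnerProductSpace ℝ F]

/-- A Lipschitz map with the bounds on increments for injectivity and for surjectivity is open. -/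
theorem PairBound.nhds_le_map {f : E → F} {K : Set E} {δ δ' : ℝ} {L : NNReal} {x : E}
    (hf : LipschitzOnWith L f K) (hK : K ∈ 𝓝 x) (hδ : 0 < δ)
    (h : PairBound (immPairs E F) f K δ) (hδ' : 0 < δ') (h' : PairBound (subPairs E F) f K δ') :
    𝓝 (f x) ≤ map f (𝓝 x) := by
  refine le_map fun s hs => ?_
  obtain ⟨r, hr, hrs⟩ := Metric.mem_nhds_iff.1 (inter_mem hK hs)
  set ρ := r / 2
  have hρ : 0 < ρ := half_pos hr
  have hB : Metric.closedBall x ρ ⊆ K ∩ s :=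
    (Metric.closedBall_subset_ball (half_lt_self hr)).trans hrs
  -- On the sphere of radius `ρ` the values of `f` are at distance at least `δ ρ` from `f x`, so the
  -- distance to `z` is minimised inside the ball.
  refine Metric.mem_nhds_iff.2 ⟨δ * ρ / 2, by positivity, fun z hz => ?_⟩
  have hz' : ‖f x - z‖ < δ * ρ / 2 := by rwa [← dist_eq_norm, dist_comm]
  have hx : x ∈ Metric.closedBall x ρ := Metric.mem_closedBall_self hρ.le
  obtain ⟨y, hy, hmin⟩ := (isCompact_closedBall x ρ).exists_isMinOn ⟨x, hx⟩
    (f := fun y => ‖f y - z‖)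
    (((hf.continuousOn.mono fun y hy => (hB hy).1).sub continuousOn_const).norm)
  have hyz : ‖f y - z‖ ≤ ‖f x - z‖ := hmin hx
  have hyb : y ∈ Metric.ball x ρ := by
    have h1 := h.mul_norm_sub_le (hB hx).1 (hB hy).1
    have h2 : ‖f y - f x‖ ≤ ‖f y - z‖ + ‖f x - z‖ := by
      rw [norm_sub_rev (f x)]; exact norm_sub_le_norm_sub_add_norm_sub _ _ _
    rw [mem_ball_iff_norm]
    nlinarith
  refine ⟨y, (hB hy).2, ?_⟩
  by_contra hne
  set a := z - f y
  have ha : 0 < ‖a‖ := norm_pos_iff.2 (sub_ne_zero.2 (Ne.symm hne))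
  obtain ⟨p, ⟨hp1, hp2⟩, H⟩ := h' _ ⟨‖a‖⁻¹ • a, by
    rw [norm_smul, norm_inv, norm_norm, inv_mul_cancel₀ ha.ne'], rfl⟩
  -- If the minimum is not zero, moving by `t` along `p.1` lowers the squared distance by at least
  -- `2 δ' t ‖a‖ - L² t²`, which is positive for such `t`.
  have hev : ∀ᶠ t : ℝ in 𝓝[>] 0, y + t • p.1 ∈ Metric.ball x ρ ∧ t * (L : ℝ) ^ 2 < 2 * (‖a‖ * δ') ∧
      0 < t := by
    refine Eventually.and ?_ (Eventually.and ?_ self_mem_nhdsWithin)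
    · have hc : Continuous fun t : ℝ => y + t • p.1 := by fun_prop
      exact mem_nhdsWithin_of_mem_nhds
        (hc.continuousAt.preimage_mem_nhds (Metric.isOpen_ball.mem_nhds (by simpa using hyb)))
    · have hc : Continuous fun t : ℝ => t * (L : ℝ) ^ 2 := by fun_prop
      exact mem_nhdsWithin_of_mem_nhds (hc.continuousAt.preimage_mem_nhds
        (Iio_mem_nhds (by simpa using by positivity)))
  obtain ⟨t, ht1, ht2, ht⟩ := hev.exists
  have ht1' := Metric.ball_subset_closedBall ht1
  set u := f (y + t • p.1) - f y
  have h1 : δ' * t * ‖a‖ ≤ inner ℝ a u := by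
    have := H y (hB hy).1 t ht.le (hB ht1').1
    rw [hp2, real_inner_smul_left, inv_mul_eq_div, le_div_iff₀ ha] at this
    exact this
  have h2 : ‖u‖ ≤ L * t := by
    have := hf.dist_le_mul _ (hB ht1').1 _ (hB hy).1
    rw [dist_eq_norm, dist_eq_norm, add_sub_cancel_left, norm_smul, Real.norm_of_nonneg ht.le] at this
    refine this.trans (mul_le_mul_of_nonneg_left ?_ L.2)
    exact mul_le_of_le_one_right ht.le hp1
  have h3 : ‖a‖ ≤ ‖a - u‖ := by
    have h4 : ‖f y - z‖ ≤ ‖f (y + t • p.1) - z‖ := hmin ht1'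
    rw [norm_sub_rev (f y), norm_sub_rev (f _)] at h4
    simpa only [a, u, sub_sub_sub_cancel_right, sub_sub_sub_cancel_right, sub_sub,
      add_sub_cancel] using h4
  have h5 := norm_sub_sq_real a u
  have h6 : ‖u‖ ^ 2 ≤ (L * t) ^ 2 := by gcongr
  have h7 : ‖a‖ ^ 2 ≤ ‖a - u‖ ^ 2 := by gcongr
  nlinarith

end LocalOpenness

/-- A perturbation of a map with a Lipschitz right inverse by a map with small Lipschitz constant
is open. -/
theorem nhds_le_map_of_lipschitz_sub {E F : Type*} [NormedAddCommGroup E]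
    [NormedAddCommGroup F] [NormedSpace ℝ F] [CompleteSpace F] {f h : E → F} {g : F → E} {K : Set E}
    {T : Set F} {x : E} {l : Filter E} {ε c : NNReal} (hT : T ∈ 𝓝 (f x)) (hg : LipschitzOnWith c g T)
    (hgl : Tendsto g (𝓝 (f x)) l) (hgx : g (f x) = x)
    (hgT : ∀ y ∈ T, g y ∈ K ∧ f (g y) = y) (hh : LipschitzOnWith ε (h - f) K) (hεc : ε * c < 1) :
    𝓝 (h x) ≤ map h l := by
  -- On `T` the map `h ∘ g` is the identity plus `(h - f) ∘ g`, whose Lipschitz constant is at most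
  -- `ε c < 1`.
  have key : ApproximatesLinearOn (h ∘ g) (ContinuousLinearEquiv.refl ℝ F : F →L[ℝ] F) T (ε * c) := by
    intro y hy z hz
    have h1 := hh.dist_le_mul _ (hgT y hy).1 _ (hgT z hz).1
    have h2 := hg.dist_le_mul _ hy _ hz
    rw [dist_eq_norm, dist_eq_norm] at h1 h2
    simp only [Pi.sub_apply, (hgT y hy).2, (hgT z hz).2] at h1
    have e : (h ∘ g) y - (h ∘ g) z - (ContinuousLinearEquiv.refl ℝ F : F →L[ℝ] F) (y - z) =
        h (g y) - y - (h (g z) - z) := by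
      simp only [comp_apply, ContinuousLinearEquiv.coe_refl, ContinuousLinearMap.coe_id', id_eq]
      abel
    rw [e]
    refine h1.trans ?_
    rw [NNReal.coe_mul, mul_assoc]
    rw [← dist_eq_norm] at h2 ⊢
    exact mul_le_mul_of_nonneg_left h2 ε.2
  have hmap := key.map_nhds_eq (ContinuousLinearEquiv.refl ℝ F).toNonlinearRightInverse hT ?_
  · rw [comp_apply, hgx] at hmap
    rw [← hmap, ← map_map]
    exact map_mono hgl
  · rcases subsingleton_or_nontrivial F with hF | hF
    · exact Or.inl hF
    · refine Or.inr (hεc.trans_le ?_)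
      simp [ContinuousLinearEquiv.toNonlinearRightInverse]

/-! ### Maps open on the interior, and surjectivity -/

section Interior

variable {m n : ℕ} {H H' : Type*} [TopologicalSpace H] [TopologicalSpace H']
  {I : ModelWithCorners ℝ (EuclideanSpace ℝ (Fin m)) H}
  {J : ModelWithCorners ℝ (EuclideanSpace ℝ (Fin n)) H'}
  {M N : Type*} [TopologicalSpace M] [TopologicalSpace N] [ChartedSpace H M] [ChartedSpace H' N]
  [IsManifold I ∞ M] [IsManifold J ∞ N]

/-- A map is open on the interior if it maps neighbourhoods of interior points to neighbourhoods of
interior points. -/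
def OpenOnInterior (I : ModelWithCorners ℝ (EuclideanSpace ℝ (Fin m)) H)
    (J : ModelWithCorners ℝ (EuclideanSpace ℝ (Fin n)) H') (h : M → N) : Prop :=
  ∀ p, I.IsInteriorPoint p → J.IsInteriorPoint (h p) ∧ 𝓝 (h p) ≤ map h (𝓝 p)

/-- All coordinate values of `h` lie in the range of `J`; openness in coordinates therefore makes
that range a neighbourhood, and the image point is interior at no extra cost. -/
theorem isInteriorPoint_and_nhds_le_map {h : M → N} (hc : Continuous h)
    {φ : OpenPartialHomeomorph M H} {p : M} (hp : p ∈ φ.source) {q : N}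
    (hq : h p ∈ (chartAt H' q).source)
    (hF : 𝓝 (localRep I J φ (chartAt H' q) h (φ.extend I p)) ≤
      map (localRep I J φ (chartAt H' q) h) (𝓝[range I] (φ.extend I p))) :
    J.IsInteriorPoint (h p) ∧ 𝓝 (h p) ≤ map h (𝓝 p) := by
  set ψ := chartAt H' q
  set F := localRep I J φ ψ h
  have hFp : F (φ.extend I p) = ψ.extend J (h p) := by
    simp only [F, localRep, comp_apply, φ.extend_left_inv hp]
  rw [hFp] at hF
  have hr : range J ∈ 𝓝 (ψ.extend J (h p)) :=
    hF (mem_map.2 (univ_mem' fun y => by simp [F, localRep]))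
  refine ⟨(isInteriorPoint_iff_chartAt q hq).2 (mem_interior_iff_mem_nhds.2 hr), ?_⟩
  rw [← ψ.map_extend_symm_nhdsWithin_range hq (I := J), nhdsWithin_eq_nhds.2 hr]
  refine (map_mono hF).trans ?_
  rw [← φ.map_extend_nhds hp, map_map, map_map]
  refine le_of_eq (map_congr ?_)
  filter_upwards [φ.open_source.mem_nhds hp,
    hc.continuousAt.preimage_mem_nhds (ψ.open_source.mem_nhds hq)] with z hz hz'
  simp only [comp_apply, F, localRep, φ.extend_left_inv hz]
  exact ψ.extend_left_inv hz'

/-- Near a boundary point the interior is locally a convex half-ball, so it remains connected and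
dense after removal of the boundary. This carries the open-closed argument across boundary points.
-/
theorem exists_isPreconnected_interior_dense (p : M) : ∃ W ∈ 𝓝 p, ∃ W₀ ⊆ I.interior M,
    IsPreconnected W₀ ∧ W ⊆ closure W₀ := by
  obtain ⟨r, hr, hrt⟩ := exists_modelBall_subset p (extChartAt_target_mem_nhdsWithin (I := I) p)
  set B := Metric.ball (extChartAt I p p) r ∩ interior (range I) with hB
  have hBt : B ⊆ (extChartAt I p).target := fun x hx =>
    hrt ⟨Metric.ball_subset_closedBall hx.1, interior_subset hx.2⟩
  refine ⟨chartBall I p r, (isOpen_chartBall p r).mem_nhds (mem_chartBall_self p hr),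
    (extChartAt I p).symm '' B, ?_, ?_, fun q hq => ?_⟩
  · rintro _ ⟨x, hx, rfl⟩
    refine (isInteriorPoint_iff_chartAt p ?_).2 ?_
    · simpa only [extChartAt_source] using (extChartAt I p).map_target (hBt hx)
    · change (extChartAt I p) ((extChartAt I p).symm x) ∈ _
      rw [(extChartAt I p).right_inv (hBt hx)]
      exact hx.2
  · exact (((convex_ball _ _).inter I.convex_range.interior).isPreconnected).image _
      ((continuousOn_extChartAt_symm p).mono hBt)
  · have h1 : extChartAt I p q ∈ closure B :=
      Metric.isOpen_ball.inter_closure ⟨hq.2, range_subset_closure_interior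
        (extChartAt_mem_modelBall hq).2⟩
    have h2 := mem_closure_image (continuousAt_extChartAt_symm' hq.1) h1
    rwa [(extChartAt I p).left_inv hq.1] at h2

theorem OpenOnInterior.isOpen_image {h : M → N} (ho : OpenOnInterior I J h) :
    IsOpen (h '' I.interior M) := by
  refine isOpen_iff_mem_nhds.2 ?_
  rintro _ ⟨p, hp, rfl⟩
  exact (ho p hp).2 (image_mem_map
    ((I.isOpen_interior (M := M) (n := (∞ : WithTop ℕ∞)) (by simp)).mem_nhds hp))

/-- A boundary-preserving map with closed range that is open on the interior is surjective if the
target is connected. -/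
theorem OpenOnInterior.surjective [Nonempty M] [ConnectedSpace N] {h : M → N}
    (ho : OpenOnInterior I J h) (hcl : IsClosed (range h))
    (hb : MapsTo h (I.boundary M) (J.boundary N)) : Surjective h := by
  set A := h '' I.interior M with hA
  have hAo : IsOpen A := ho.isOpen_image
  have hAr : closure A ⊆ range h := hcl.closure_subset_iff.2 (image_subset_range _ _)
  -- A limit point of `A` is a value of `h`; if it is interior, it cannot come from a boundary
  -- point.
  have hAi : closure A ∩ J.interior N ⊆ A := by
    rintro y ⟨hyA, hy⟩
    obtain ⟨x, rfl⟩ := hAr hyA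
    refine mem_image_of_mem _ ?_
    by_contra hx
    rw [← mem_compl_iff, I.compl_interior] at hx
    have := hb hx
    rw [← J.compl_interior] at this
    exact this hy
  have hAclopen : IsClopen (closure A) := by
    refine ⟨isClosed_closure, isOpen_iff_mem_nhds.2 fun y hy => ?_⟩
    obtain ⟨W, hW, W₀, hW₀, hc, hWW⟩ := exists_isPreconnected_interior_dense (I := J) y
    refine mem_of_superset hW (hWW.trans (closure_mono ?_))
    -- The set `A` is open, relatively closed in the interior of `N`, and meets the connected set
    -- `W₀`, hence contains it.
    refine hc.subset_of_closure_inter_subset hAo ?_ fun z hz => hAi ⟨hz.1, hW₀ hz.2⟩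
    obtain ⟨z, hzW, hzA⟩ := mem_closure_iff_nhds.1 hy W hW
    obtain ⟨z', hz'A, hz'⟩ := mem_closure_iff.1 (hWW hzW) A hAo hzA
    exact ⟨z', hz', hz'A⟩
  have hne : (closure A).Nonempty := by
    obtain ⟨W, hW, W₀, hW₀, -, hWW⟩ :=
      exists_isPreconnected_interior_dense (I := I) (Classical.arbitrary M)
    obtain ⟨x, hx⟩ := closure_nonempty_iff.1 ⟨_, hWW (mem_of_mem_nhds hW)⟩
    exact ⟨h x, subset_closure (mem_image_of_mem _ (hW₀ hx))⟩
  intro y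
  exact hAr (hAclopen.eq_univ hne ▸ mem_univ y)

end Interior

end LipWhitney

namespace LipWhitney

/-! ### Openness of the classes in the strong topology -/

section Openness

variable {m n : ℕ} {H H' : Type*} [TopologicalSpace H] [TopologicalSpace H']
  {I : ModelWithCorners ℝ (EuclideanSpace ℝ (Fin m)) H}
  {J : ModelWithCorners ℝ (EuclideanSpace ℝ (Fin n)) H'}
  {M N : Type*} [TopologicalSpace M] [MetricSpace N] [ChartedSpace H M] [ChartedSpace H' N]
  [IsManifold I ∞ M] [IsManifold J ∞ N]

theorem modelBall_mem_nhdsWithin {p q : M} {r : ℝ} (hq : q ∈ chartBall I p r) :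
    modelBall I p r ∈ 𝓝[range I] (extChartAt I p q) :=
  mem_nhdsWithin.2 ⟨_, Metric.isOpen_ball, hq.2, inter_subset_inter_left _ Metric.ball_subset_closedBall⟩

/-- The map `h` is `η i`-close to `f` on the coordinate ball at `c i` of radius `r i`, together with
the Lipschitz constant of the difference of the coordinate expressions. -/
def IsCloseOn {ι : Type} (I : ModelWithCorners ℝ (EuclideanSpace ℝ (Fin m)) H)
    (J : ModelWithCorners ℝ (EuclideanSpace ℝ (Fin n)) H') (f h : M → N) (c : ι → M) (r : ι → ℝ)
    (η : ι → NNReal) : Prop :=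
  ∀ i, modelBall I (c i) (r i) ⊆ localDomain I (chartAt H (c i)) (chartAt H' (f (c i))) h ∧
    (∀ q ∈ chartBall I (c i) (r i), dist (h q) (f q) < η i) ∧
    LipschitzOnWith (η i) (localRep I J (chartAt H (c i)) (chartAt H' (f (c i))) h - repAt I J f (c i))
      (modelBall I (c i) (r i))

theorem IsCloseOn.apply_mem_source {ι : Type} {f h : M → N} {c : ι → M} {r : ι → ℝ}
    {η : ι → NNReal} (hfh : IsCloseOn I J f h c r η) {i : ι} {q : M}
    (hq : q ∈ chartBall I (c i) (r i)) : h q ∈ (chartAt H' (f (c i))).source := by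
  have := ((hfh i).1 (extChartAt_mem_modelBall hq)).2
  rwa [← extChartAt, (extChartAt I (c i)).left_inv hq.1] at this

/-- Locally finite covers by small coordinate balls, on which the strong topology gives uniform
control. -/
theorem exists_chartBall_cover [T2Space M] [SecondCountableTopology M] {k : ℕ}
    (f : CkLip I J M N k) {A : M → Set (EuclideanSpace ℝ (Fin m))}
    (hA : ∀ p, A p ∈ 𝓝[range I] (extChartAt I p p)) :
    ∃ (ι : Type) (_ : Countable ι) (c : ι → M) (r : ι → ℝ) (C : ι → Set M),
      (∀ i, modelBall I (c i) (r i) ⊆ A (c i) ∩ (extChartAt I (c i)).target) ∧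
      (∀ i, IsCompact (C i)) ∧ (∀ i, C i ⊆ chartBall I (c i) (r i)) ∧ ⋃ i, C i = univ ∧
      LocallyFinite (fun i => (extChartAt I (c i)).symm '' modelBall I (c i) (r i)) ∧
      ∀ η : ι → NNReal, (∀ i, 0 < η i) → ∃ S : Set (CkLip I J M N k), IsOpen S ∧ f ∈ S ∧
        ∀ h ∈ S, IsCloseOn I J f.toFun h.toFun c r η := by
  have hd : ∀ p, ∃ r > 0, modelBall I p r ⊆
      A p ∩ localDomain I (chartAt H p) (chartAt H' (f.toFun p)) f.toFun := fun p =>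
    exists_modelBall_subset p (inter_mem (hA p) (localDomain_mem_nhdsWithin f.isCkLip.1.continuous
      (extend_mem_localDomain (mem_chart_source H p) (mem_chart_source H' (f.toFun p)))))
  choose R hR hRd using hd
  obtain ⟨ι, hι, c, r, C, -, hrR, hC, hCV, hcov, hfin⟩ :=
    exists_locallyFinite_chartBall_cover I hR (fun p x hx => (hRd p hx).2.1)
  have hKd : ∀ i, modelBall I (c i) (r i) ⊆
      A (c i) ∩ localDomain I (chartAt H (c i)) (chartAt H' (f.toFun (c i))) f.toFun := fun i =>
    (modelBall_mono _ (hrR i)).trans (hRd (c i))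
  refine ⟨ι, hι, c, r, C, fun i x hx => ⟨(hKd i hx).1, (hKd i hx).2.1⟩, hC, hCV, hcov, hfin,
    fun η hη => ?_⟩
  obtain ⟨S, hS, hfS, h⟩ := exists_isOpen_forall_lipschitz_sub f
    (fun i => IsManifold.chart_mem_maximalAtlas (c i))
    (fun i => IsManifold.chart_mem_maximalAtlas (f.toFun (c i)))
    (fun i => isCompact_modelBall (c i) (r i)) (fun i => convex_modelBall _ _)
    (fun i x hx => (hKd i hx).2) hfin hη
  refine ⟨S, hS, hfS, fun g hg i => ⟨(h g hg i).1, fun q hq => ?_, (h g hg i).2.2⟩⟩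
  have := (h g hg i).2.1 _ (extChartAt_mem_modelBall hq)
  rwa [← extChartAt, (extChartAt I (c i)).left_inv hq.1] at this

/-- The coordinate expressions of `f` in the preferred charts expand distances. -/
def ExpandingAt (I : ModelWithCorners ℝ (EuclideanSpace ℝ (Fin m)) H)
    (J : ModelWithCorners ℝ (EuclideanSpace ℝ (Fin n)) H') (f : M → N) (p : M) : Prop :=
  ∃ K ∈ 𝓝[range I] (extChartAt I p p), ∃ δ > 0, ∀ y ∈ K, ∀ z ∈ K,
    δ * ‖y - z‖ ≤ ‖repAt I J f p y - repAt I J f p z‖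

theorem HasClarkeRank.expandingAt {k : ℕ} {f : CkLip I J M N k}
    (hf : HasClarkeRank I J M N k m f) (p : M) :
    ExpandingAt I J f.toFun p := by
  obtain ⟨r, hr, δ, hδ, h⟩ := hf.exists_pairBound_immPairs p
  exact ⟨_, inter_mem (mem_nhdsWithin_of_mem_nhds (Metric.ball_mem_nhds _ hr)) self_mem_nhdsWithin, δ, hδ,
    fun y hy z hz => h.mul_norm_sub_le hz hy⟩

theorem locallyExpanding_of_expandingAt {f : M → N} (hf : ∀ p, ExpandingAt I J f p) :
    LocallyExpanding I J f := fun p =>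
  ⟨_, IsManifold.chart_mem_maximalAtlas p, _, IsManifold.chart_mem_maximalAtlas (f p),
    mem_chart_source _ p, mem_chart_source _ (f p), hf p⟩

theorem mul_norm_sub_le_of_lipschitz_sub {E F : Type*} [NormedAddCommGroup E]
    [NormedAddCommGroup F] {f h : E → F} {K : Set E} {δ : ℝ} {ε : NNReal}
    (hh : LipschitzOnWith ε (h - f) K) (hf : ∀ y ∈ K, ∀ z ∈ K, δ * ‖y - z‖ ≤ ‖f y - f z‖)
    {y z : E} (hy : y ∈ K) (hz : z ∈ K) : (δ - ε) * ‖y - z‖ ≤ ‖h y - h z‖ := by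
  have h1 := hf y hy z hz
  have h2 := hh.dist_le_mul y hy z hz
  rw [dist_eq_norm, dist_eq_norm] at h2
  simp only [Pi.sub_apply] at h2
  have h3 : ‖f y - f z‖ ≤ ‖h y - h z‖ + ‖h y - f y - (h z - f z)‖ := by
    refine (norm_sub_le _ _).trans' (le_of_eq ?_)
    congr 1
    abel
  linarith

variable [T2Space M] [SecondCountableTopology M] {k : ℕ}

/-- A tolerance of half the local constant `δ` leaves a positive increment bound on every ball of
the cover. -/
theorem exists_isOpen_forall_hasPairBound
    {T : Set (Set (EuclideanSpace ℝ (Fin m) × EuclideanSpace ℝ (Fin n)))}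
    (hT : ∀ s ∈ T, ∀ p ∈ s, ‖p.1‖ ≤ 1 ∧ ‖p.2‖ ≤ 1) (f : CkLip I J M N k)
    (hf : ∀ p, ∃ r > 0, ∃ δ > 0, PairBound T (repAt I J f.toFun p)
      (Metric.ball (extChartAt I p p) r ∩ range I) δ) :
    ∃ S : Set (CkLip I J M N k), IsOpen S ∧ f ∈ S ∧ ∀ h ∈ S, HasPairBound I J T h.toFun := by
  choose R hR δ hδ hb using hf
  obtain ⟨ι, -, c, r, C, hA, -, hCV, hcov, -, hS⟩ := exists_chartBall_cover f
    fun p => inter_mem (mem_nhdsWithin_of_mem_nhds (Metric.ball_mem_nhds (extChartAt I p p) (hR p)))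
      self_mem_nhdsWithin
  obtain ⟨S, hSo, hfS, hS⟩ := hS (fun i => Real.toNNReal (δ (c i) / 2))
    fun i => Real.toNNReal_pos.2 (half_pos (hδ _))
  refine ⟨S, hSo, hfS, fun h hh p => ?_⟩
  obtain ⟨i, hi⟩ := mem_iUnion.1 (hcov ▸ mem_univ p)
  have hp := hCV i hi
  refine ⟨_, IsManifold.chart_mem_maximalAtlas (c i), _,
    IsManifold.chart_mem_maximalAtlas (f.toFun (c i)), by simpa using hp.1,
    (hS h hh).apply_mem_source hp, _, modelBall_mem_nhdsWithin hp, _, ?_,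
    PairBound.of_lipschitz_sub hT ((hb (c i)).mono fun x hx => (hA i hx).1) (hS h hh i).2.2⟩
  rw [Real.coe_toNNReal _ (half_pos (hδ _)).le]
  linarith [hδ (c i)]

theorem isOpen_submersions (hI : IsBoundaryModel I) : IsOpen (submersions I J M N k) := by
  refine isOpen_iff_forall_mem_open.2 fun f hf => ?_
  obtain ⟨S, hSo, hfS, hS⟩ := exists_isOpen_forall_hasPairBound
    (fun _ hs _ hp => norm_le_one_of_mem_subPairs hs hp) f
    (HasClarkeRank.exists_pairBound_subPairs hf)
  exact ⟨S, fun h hh => (hS h hh).hasClarkeRank_of_subPairs hI, hSo, hfS⟩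

theorem isOpen_immersions (hI : IsBoundaryModel I) : IsOpen (immersions I J M N k) := by
  refine isOpen_iff_forall_mem_open.2 fun f hf => ?_
  obtain ⟨S, hSo, hfS, hS⟩ := exists_isOpen_forall_hasPairBound
    (fun _ hs _ hp => norm_le_one_of_mem_immPairs hs hp) f
    (HasClarkeRank.exists_pairBound_immPairs hf)
  exact ⟨S, fun h hh => (hS h hh).hasClarkeRank_of_immPairs hI, hSo, hfS⟩

/-- Local expansion survives the perturbation and supplies the injectivity on balls that the metric
argument needs. Assuming expansion instead of a Clarke rank covers diffeomorphisms with `k = 0` too.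
-/
theorem exists_isOpen_forall_isEmbedding (f : CkLip I J M N k) (hf : IsEmbedding f.toFun)
    (hfe : ∀ p, ExpandingAt I J f.toFun p) :
    ∃ S : Set (CkLip I J M N k), IsOpen S ∧ f ∈ S ∧
      ∀ h ∈ S, IsEmbedding h.toFun ∧ LocallyExpanding I J h.toFun := by
  choose K hK δ hδ hb using hfe
  obtain ⟨ι, -, c, r, C, hA, hC, hCV, hcov, hfin, hS⟩ := exists_chartBall_cover f hK
  obtain ⟨ε, hε, hemb⟩ := exists_pos_forall_isEmbedding hf hC (fun i => isOpen_chartBall (c i) (r i))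
    (fun i => (isCompact_modelBall (c i) (r i)).image_of_continuousOn
      ((continuousOn_extChartAt_symm (c i)).mono fun x hx => (hA i hx).2)) hCV
    (fun i q hq => ⟨_, extChartAt_mem_modelBall hq, (extChartAt I (c i)).left_inv hq.1⟩) hcov hfin
  obtain ⟨S, hSo, hfS, hS⟩ := hS (fun i => min (ε i) (Real.toNNReal (δ (c i) / 2)))
    fun i => lt_min (hε i) (Real.toNNReal_pos.2 (half_pos (hδ _)))
  refine ⟨S, hSo, hfS, fun h hh => ?_⟩
  have hpos : ∀ i, 0 < δ (c i) - (min (ε i) (Real.toNNReal (δ (c i) / 2)) : NNReal) := fun i => by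
    have : ((min (ε i) (Real.toNNReal (δ (c i) / 2)) : NNReal) : ℝ) ≤ δ (c i) / 2 := by
      rw [NNReal.coe_min, Real.coe_toNNReal _ (half_pos (hδ _)).le]
      exact min_le_right _ _
    linarith [hδ (c i)]
  have hexp : ∀ i, ∀ y ∈ modelBall I (c i) (r i), ∀ z ∈ modelBall I (c i) (r i), _ :=
    fun i y hy z hz => mul_norm_sub_le_of_lipschitz_sub (hS h hh i).2.2
      (fun y hy z hz => hb (c i) y (hA i hy).1 z (hA i hz).1) hy hz
  refine ⟨hemb _ h.isCkLip.1.continuous (fun i q hq => ?_) fun i q hq q' hq' hqq' => ?_, fun p => ?_⟩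
  · exact ((hS h hh i).2.1 q (hCV i hq)).trans_le (min_le_left (ε i) _)
  · have h1 := hexp i _ (extChartAt_mem_modelBall hq) _ (extChartAt_mem_modelBall hq')
    have e : ∀ z ∈ chartBall I (c i) (r i), localRep I J (chartAt H (c i))
        (chartAt H' (f.toFun (c i))) h.toFun (extChartAt I (c i) z) =
        (chartAt H' (f.toFun (c i))).extend J (h.toFun z) := fun z hz =>
      congrArg (fun w => (chartAt H' (f.toFun (c i))).extend J (h.toFun w))
        ((extChartAt I (c i)).left_inv hz.1)
    rw [e q hq, e q' hq', hqq', sub_self, norm_zero] at h1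
    have h2 : ‖extChartAt I (c i) q - extChartAt I (c i) q'‖ ≤ 0 :=
      nonpos_of_mul_nonpos_right h1 (hpos i)
    exact (extChartAt I (c i)).injOn hq.1 hq'.1 (sub_eq_zero.1 (norm_le_zero_iff.1 h2))
  · obtain ⟨i, hi⟩ := mem_iUnion.1 (hcov ▸ mem_univ p)
    have hp := hCV i hi
    exact ⟨_, IsManifold.chart_mem_maximalAtlas (c i), _,
      IsManifold.chart_mem_maximalAtlas (f.toFun (c i)), by simpa using hp.1,
      (hS h hh).apply_mem_source hp, _, modelBall_mem_nhdsWithin hp, _, hpos i, hexp i⟩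

theorem isOpen_embeddings (hI : IsBoundaryModel I) : IsOpen (embeddings I J M N k) := by
  refine isOpen_iff_forall_mem_open.2 fun f hf => ?_
  obtain ⟨S, hSo, hfS, hS⟩ := exists_isOpen_forall_isEmbedding f hf.2
    (HasClarkeRank.expandingAt hf.1)
  exact ⟨S ∩ immersions I J M N k, fun h hh => ⟨hh.2, (hS h hh.1).1⟩,
    hSo.inter (isOpen_immersions hI), hfS, hf.1⟩

theorem isOpen_properMaps : IsOpen (properMaps I J M N k) := by
  refine isOpen_iff_forall_mem_open.2 fun f hf => ?_
  have : LocallyCompactSpace N := Manifold.locallyCompact_of_finiteDimensional J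
  obtain ⟨ι, hι, c, r, C, -, hC, hCV, hcov, -, hS⟩ := exists_chartBall_cover f
    (A := fun _ => univ) fun p => univ_mem
  obtain ⟨ε, hε, hprop⟩ := exists_pos_forall_isCompact_preimage hf hC hcov
  obtain ⟨S, hSo, hfS, hS⟩ := hS ε hε
  exact ⟨S, fun h hh => hprop _ h.isCkLip.1.continuous fun i q hq => (hS h hh i).2.1 q (hCV i hq),
    hSo, hfS⟩

/-- Maps close to a bi-Lipschitz homeomorphism are open on the interior. -/
theorem exists_isOpen_forall_openOnInterior (hJ : IsBoundaryModel J) (hmn : m = n)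
    (f : CkLip I J M N k) (g : CkLip J I N M k) (hgf : LeftInverse g.toFun f.toFun)
    (hfg : RightInverse g.toFun f.toFun) :
    ∃ S : Set (CkLip I J M N k), IsOpen S ∧ f ∈ S ∧ ∀ h ∈ S, OpenOnInterior I J h.toFun := by
  have hfc := f.isCkLip.1.continuous
  have hgc := g.isCkLip.1.continuous
  have hfe : ∀ p, ExpandingAt I J f.toFun p := fun p =>
    g.isCkLip.lipInCharts.exists_expanding hfc hgc hgf (IsManifold.chart_mem_maximalAtlas p)
      (IsManifold.chart_mem_maximalAtlas (f.toFun p))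
      (extend_mem_localDomain (mem_chart_source _ p) (mem_chart_source _ (f.toFun p)))
  choose K hK δ hδ hb using hfe
  obtain ⟨ι, -, c, r, C, hA, -, hCV, hcov, -, hS⟩ := exists_chartBall_cover f
    fun p => inter_mem (hK p) (localDomain_mem_nhdsWithin hfc
      (extend_mem_localDomain (mem_chart_source H p) (mem_chart_source H' (f.toFun p))))
  obtain ⟨S, hSo, hfS, hS⟩ := hS (fun i => Real.toNNReal (δ (c i) / 2))
    fun i => Real.toNNReal_pos.2 (half_pos (hδ _))
  refine ⟨S, hSo, hfS, fun h hh p hpi => ?_⟩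
  obtain ⟨i, hi⟩ := mem_iUnion.1 (hcov ▸ mem_univ p)
  have hp := hCV i hi
  set φ := chartAt H (c i)
  set ψ := chartAt H' (f.toFun (c i))
  have hpφ : p ∈ φ.source := by simpa using hp.1
  refine isInteriorPoint_and_nhds_le_map (I := I) h.isCkLip.1.continuous hpφ
    ((hS h hh).apply_mem_source hp) ?_
  have hx : φ.extend I p ∈ localDomain I φ ψ f.toFun := (hA i (extChartAt_mem_modelBall hp)).1.2
  have hfp : f.toFun p ∈ ψ.source := by
    have := hx.2
    rwa [φ.extend_left_inv hpφ] at this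
  have hy := localRep_mem_localDomain (J := J) hgf hx
  set G := localRep J I ψ φ g.toFun
  have hFx : localRep I J φ ψ f.toFun (φ.extend I p) = ψ.extend J (f.toFun p) := by
    simp only [localRep, comp_apply, φ.extend_left_inv hpφ]
  -- Invariance of the boundary, applied to the inverse map, shows that `f p` is interior; the
  -- half-space then plays no role near its coordinates.
  have hint : 𝓝[range J] (localRep I J φ ψ f.toFun (φ.extend I p)) =
      𝓝 (localRep I J φ ψ f.toFun (φ.extend I p)) := by
    rw [hFx]
    refine nhdsWithin_eq_nhds.2 (mem_interior_iff_mem_nhds.1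
      ((isInteriorPoint_iff_chartAt (I := J) (f.toFun (c i)) hfp).1 ?_))
    refine isInteriorPoint_of_biLipschitz (J := I) hJ hmn.symm hgc hfc hfg hgf g.isCkLip.lipInCharts
      f.isCkLip.lipInCharts ?_
    rwa [hgf p]
  have hGl : Tendsto G (𝓝 (localRep I J φ ψ f.toFun (φ.extend I p))) (𝓝[range I] (φ.extend I p)) := by
    have := tendsto_localRep (J := I) hgc hy.1
    rwa [hint, show localRep J I ψ φ g.toFun _ = _ from hy.2] at this
  have hgT : ∀ y ∈ G ⁻¹' modelBall I (c i) (r i) ∩ localDomain J ψ φ g.toFun,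
      G y ∈ modelBall I (c i) (r i) ∧ localRep I J φ ψ f.toFun (G y) = y := fun y hy =>
    ⟨hy.1, (localRep_mem_localDomain (J := I) hfg hy.2).2⟩
  -- Expansion by `δ` bounds the Lipschitz constant of the local inverse by `δ⁻¹`; against the
  -- tolerance `δ / 2` the product is `1 / 2`.
  refine nhds_le_map_of_lipschitz_sub (g := G) (c := Real.toNNReal (δ (c i))⁻¹)
    (inter_mem (hGl (modelBall_mem_nhdsWithin hp)) ?_) ?_ hGl hy.2 hgT (hS h hh i).2.2 ?_
  · rw [← hint]
    exact localDomain_mem_nhdsWithin hgc hy.1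
  · refine LipschitzOnWith.of_dist_le_mul fun y hy z hz => ?_
    have := hb (c i) _ (hA i hy.1).1.1 _ (hA i hz.1).1.1
    rw [repAt, (hgT y hy).2, (hgT z hz).2] at this
    rw [Real.coe_toNNReal _ (inv_nonneg.2 (hδ _).le), dist_eq_norm, dist_eq_norm,
      le_inv_mul_iff₀ (hδ _)]
    exact this
  · rw [← NNReal.coe_lt_coe, NNReal.coe_mul, Real.coe_toNNReal _ (inv_nonneg.2 (hδ _).le),
      Real.coe_toNNReal _ (half_pos (hδ _)).le, div_mul_eq_mul_div, mul_inv_cancel₀ (hδ _).ne']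
    norm_num

end Openness

end LipWhitney

namespace LipWhitney

/-! ### Diffeomorphisms -/

section Diffeos

variable {m n : ℕ} {H H' : Type*} [TopologicalSpace H] [TopologicalSpace H']
  {I : ModelWithCorners ℝ (EuclideanSpace ℝ (Fin m)) H}
  {J : ModelWithCorners ℝ (EuclideanSpace ℝ (Fin n)) H'}
  {M N : Type*} [TopologicalSpace M] [MetricSpace N] [ChartedSpace H M] [ChartedSpace H' N]
  [IsManifold I ∞ M] [IsManifold J ∞ N] {k : ℕ}

/-- Properness makes the range closed, so the map is onto; expansion makes the inverse locally
Lipschitz, and the inverse function theorem raises its regularity. Both results on diffeomorphisms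
end here. -/
theorem mem_diffeos_of_openOnInterior [Nonempty M] [ConnectedSpace N] (hI : IsBoundaryModel I)
    (hmn : m = n) {h : CkLip I J M N k} (he : IsEmbedding h.toFun) (hp : h ∈ properMaps I J M N k)
    (hb : h ∈ boundaryMaps I J M N k) (ho : OpenOnInterior I J h.toFun)
    (hexp : LocallyExpanding I J h.toFun) : h ∈ diffeos I J M N k := by
  have : LocallyCompactSpace N := Manifold.locallyCompact_of_finiteDimensional J
  have hprop : IsProperMap h.toFun := isProperMap_iff_isCompact_preimage.2
    ⟨he.continuous, fun K hK => hp K hK⟩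
  have hsurj := ho.surjective hprop.isClosedMap.isClosed_range hb
  let e := he.toHomeomorphOfSurjective hsurj
  have hgf : LeftInverse e.symm h.toFun := e.symm_apply_apply
  have hfg : RightInverse e.symm h.toFun := e.apply_symm_apply
  exact ⟨⟨e.symm, h.isCkLip.inverse hI e.symm.continuous hgf hfg
    (hexp.lipInCharts_inverse e.symm.continuous hfg) hmn⟩, hgf, hfg⟩

theorem isOpen_diffeos [T2Space M] [SecondCountableTopology M] [Nonempty M] [ConnectedSpace N]
    (hI : IsBoundaryModel I) (hJ : IsBoundaryModel J) :
    IsOpen {f : boundaryMaps I J M N k | (f : CkLip I J M N k) ∈ diffeos I J M N k} := by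
  refine isOpen_iff_forall_mem_open.2 ?_
  rintro ⟨f, hfb⟩ ⟨g, hgf, hfg⟩
  have hfc := f.isCkLip.1.continuous
  have hgc := g.isCkLip.1.continuous
  have hmn : m = n := eq_of_biLipschitz hI hJ hfc hgc hgf hfg f.isCkLip.lipInCharts
    g.isCkLip.lipInCharts
  let e : M ≃ₜ N := ⟨⟨f.toFun, g.toFun, hgf, hfg⟩, hfc, hgc⟩
  obtain ⟨S₁, hS₁, hfS₁, h₁⟩ := exists_isOpen_forall_isEmbedding f e.isEmbedding fun p =>
    g.isCkLip.lipInCharts.exists_expanding hfc hgc hgf (IsManifold.chart_mem_maximalAtlas p)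
      (IsManifold.chart_mem_maximalAtlas (f.toFun p))
      (extend_mem_localDomain (mem_chart_source _ p) (mem_chart_source _ (f.toFun p)))
  obtain ⟨S₂, hS₂, hfS₂, h₂⟩ := exists_isOpen_forall_openOnInterior hJ hmn f g hgf hfg
  have hfp : f ∈ properMaps I J M N k := fun K hK => e.isCompact_preimage.2 hK
  refine ⟨Subtype.val ⁻¹' (S₁ ∩ S₂ ∩ properMaps I J M N k), ?_,
    ((hS₁.inter hS₂).inter isOpen_properMaps).preimage continuous_subtype_val,
    ⟨⟨hfS₁, hfS₂⟩, hfp⟩⟩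
  rintro ⟨h, hb⟩ ⟨⟨hh₁, hh₂⟩, hp⟩
  exact mem_diffeos_of_openOnInterior hI hmn (h₁ h hh₁).1 hp hb (h₂ h hh₂) (h₁ h hh₁).2

theorem exists_lipschitzOnWith_pairBound {f : CkLip I J M N k}
    (hs : f ∈ submersions I J M N k) (hi : f ∈ immersions I J M N k) (p : M) :
    ∃ K ∈ 𝓝[range I] (extChartAt I p p), ∃ L : NNReal, ∃ δ > 0, ∃ δ' > 0,
      LipschitzOnWith L (repAt I J f.toFun p) K ∧
      PairBound (immPairs _ _) (repAt I J f.toFun p) K δ ∧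
      PairBound (subPairs _ _) (repAt I J f.toFun p) K δ' := by
  obtain ⟨r, hr, δ, hδ, h⟩ := HasClarkeRank.exists_pairBound_immPairs hi p
  obtain ⟨r', hr', δ', hδ', h'⟩ := HasClarkeRank.exists_pairBound_subPairs hs p
  obtain ⟨L, t, ht, hL⟩ := f.isCkLip.lipInCharts.lipAt f.isCkLip.1.continuous
    (IsManifold.chart_mem_maximalAtlas p) (IsManifold.chart_mem_maximalAtlas (f.toFun p))
    (extend_mem_localDomain (mem_chart_source H p) (mem_chart_source H' (f.toFun p)))
  refine ⟨t ∩ (Metric.ball (extChartAt I p p) (min r r') ∩ range I), inter_mem ht (inter_mem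
    (mem_nhdsWithin_of_mem_nhds (Metric.ball_mem_nhds _ (lt_min hr hr'))) self_mem_nhdsWithin),
    L, δ, hδ, δ', hδ', hL.mono inter_subset_left, h.mono ?_, h'.mono ?_⟩
  · exact fun x hx => ⟨Metric.ball_subset_ball (min_le_left _ _) hx.2.1, hx.2.2⟩
  · exact fun x hx => ⟨Metric.ball_subset_ball (min_le_right _ _) hx.2.1, hx.2.2⟩

theorem openOnInterior_of_mem_submersions {f : CkLip I J M N k}
    (hs : f ∈ submersions I J M N k) (hi : f ∈ immersions I J M N k) :
    OpenOnInterior I J f.toFun := by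
  intro p hp
  obtain ⟨K, hK, L, δ, hδ, δ', hδ', hL, h, h'⟩ := exists_lipschitzOnWith_pairBound hs hi p
  have hr : range I ∈ 𝓝 (extChartAt I p p) := mem_interior_iff_mem_nhds.1
    ((isInteriorPoint_iff_chartAt p (mem_chart_source H p)).1 hp)
  refine isInteriorPoint_and_nhds_le_map (I := I) f.isCkLip.1.continuous (mem_chart_source H p)
    (mem_chart_source H' (f.toFun p)) ?_
  rw [nhdsWithin_eq_nhds.2 hr] at hK
  rw [← extChartAt, nhdsWithin_eq_nhds.2 hr]
  exact h.nhds_le_map hL hK hδ hδ' h'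

/-- A submersion that is an immersion maps between manifolds of the same dimension. -/
theorem eq_of_mem_submersions [Nonempty M] (hI : IsBoundaryModel I) {f : CkLip I J M N k}
    (hs : f ∈ submersions I J M N k) (hi : f ∈ immersions I J M N k) : m = n := by
  refine le_antisymm ((locallyExpanding_of_expandingAt (HasClarkeRank.expandingAt hi)).finrank_le
    hI f.isCkLip.1.continuous f.isCkLip.lipInCharts) ?_
  obtain ⟨W, hW, W₀, hW₀, -, hWW⟩ :=
    exists_isPreconnected_interior_dense (I := I) (Classical.arbitrary M)
  obtain ⟨p, hp⟩ := closure_nonempty_iff.1 ⟨_, hWW (mem_of_mem_nhds hW)⟩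
  obtain ⟨K, hK, L, δ, hδ, δ', hδ', hL, h, h'⟩ := exists_lipschitzOnWith_pairBound hs hi p
  have hr : range I ∈ 𝓝 (extChartAt I p p) := mem_interior_iff_mem_nhds.1
    ((isInteriorPoint_iff_chartAt p (mem_chart_source H p)).1 (hW₀ hp))
  rw [nhdsWithin_eq_nhds.2 hr] at hK
  -- The image of `K` is a neighbourhood in dimension `n`, yet a Lipschitz image of a set of
  -- Hausdorff dimension at most `m`.
  have hd := Real.dimH_of_mem_nhds (h.nhds_le_map hL hK hδ hδ' h' (image_mem_map hK))
  have h1 := (hd.symm.trans_le hL.dimH_image_le).trans (dimH_mono (subset_univ K))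
  rw [Real.dimH_univ_eq_finrank] at h1
  simpa using h1

/-- For `k ≥ 1` the derivative is continuous, so the Clarke derivative contains at most the ordinary
one, which is bounded below because the inverse is Lipschitz. For `k = 0` a convex hull of
invertible derivatives may contain singular maps. -/
theorem hasClarkeRank_of_mem_diffeos (hI : IsBoundaryModel I)
    (hk : 1 ≤ k) {f : CkLip I J M N k} (hf : f ∈ diffeos I J M N k) {r : ℕ} (hr : r ≤ m) :
    HasClarkeRank I J M N k r f := by
  obtain ⟨g, hgf, hfg⟩ := hf
  intro φ hφ ψ hψ hmaps x hx
  have hfc := f.isCkLip.1.continuous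
  have hloc : localDomain I φ ψ f.toFun = (φ.extend I).target := by
    refine subset_antisymm (fun x hx => hx.1) fun x hx => ⟨hx, hmaps ?_⟩
    simpa only [φ.extend_source] using (φ.extend I).map_target hx
  have hx' : x ∈ localDomain I φ ψ f.toFun := hloc ▸ hx
  obtain ⟨K, hK, δ, hδ, hexp⟩ := g.isCkLip.lipInCharts.exists_expanding hfc
    g.isCkLip.1.continuous hgf hφ hψ hx'
  have hC := ContMDiff.contDiffOn_localRep f.isCkLip.1 (by exact_mod_cast le_top) hφ hψ
  rw [hloc] at hC
  have hu : UniqueDiffOn ℝ (φ.extend I).target := hloc ▸ (isLocallyConvexBody_localDomain hfc).uniqueDiffOn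
  have hcont := hC.continuousOn_fderivWithin hu (by exact_mod_cast hk)
  have hd := (hC x hx).differentiableWithinAt (by exact_mod_cast Nat.one_le_iff_ne_zero.1 hk)
  have hsub : clarkeDeriv (localRep I J φ ψ f.toFun) (φ.extend I).target x ⊆
      {fderivWithin ℝ (localRep I J φ ψ f.toFun) (φ.extend I).target x} := by
    refine convexHull_min ?_ (convex_singleton _)
    rintro A ⟨u, hu, hux, hA⟩
    exact tendsto_nhds_unique hA ((hcont x hx).tendsto.comp
      (tendsto_nhdsWithin_iff.2 ⟨hux, Eventually.of_forall fun i => (hu i).1⟩))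
  have hmem : (φ.extend I).target ∈ 𝓝[range I] x :=
    hloc ▸ localDomain_mem_nhdsWithin hfc hx'
  have hlow := hI.mul_norm_le_of_hasFDerivWithinAt (localDomain_subset_range hx')
    (hd.hasFDerivWithinAt.mono_of_mem_nhdsWithin hmem) hK hexp
  refine ⟨δ, hδ, fun A hA j hj => ?_⟩
  rw [mem_singleton_iff.1 (hsub hA)]
  exact (le_singularValues_iff _ hδ.le).2 hlow j (by simpa using hj.trans_le hr)

theorem inter_subset_diffeos [Nonempty M] [ConnectedSpace N] (hI : IsBoundaryModel I) :
    submersions I J M N k ∩ embeddings I J M N k ∩ properMaps I J M N k ∩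
      boundaryMaps I J M N k ⊆ diffeos I J M N k := fun _ ⟨⟨⟨hs, hi, he⟩, hp⟩, hb⟩ =>
  mem_diffeos_of_openOnInterior hI (eq_of_mem_submersions hI hs hi) he hp hb
    (openOnInterior_of_mem_submersions hs hi)
    (locallyExpanding_of_expandingAt (HasClarkeRank.expandingAt hi))

theorem diffeos_subset_inter [Nonempty M] (hI : IsBoundaryModel I) (hJ : IsBoundaryModel J)
    (hk : 1 ≤ k) : diffeos I J M N k ⊆ submersions I J M N k ∩ embeddings I J M N k ∩
      properMaps I J M N k ∩ boundaryMaps I J M N k := by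
  intro f hf
  obtain ⟨g, hgf, hfg⟩ := id hf
  have hfc := f.isCkLip.1.continuous
  have hgc := g.isCkLip.1.continuous
  have hmn : m = n := eq_of_biLipschitz hI hJ hfc hgc hgf hfg f.isCkLip.lipInCharts
    g.isCkLip.lipInCharts
  let e : M ≃ₜ N := ⟨⟨f.toFun, g.toFun, hgf, hfg⟩, hfc, hgc⟩
  have hr : ∀ r ≤ m, HasClarkeRank I J M N k r f := fun r hr =>
    hasClarkeRank_of_mem_diffeos hI hk hf hr
  refine ⟨⟨⟨hr n hmn.ge, hr m le_rfl, e.isEmbedding⟩, fun K hK => e.isCompact_preimage.2 hK⟩,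
    diffeos_subset_boundaryMaps hI hJ k hf⟩

end Diffeos

end LipWhitney

theorem mainTheorem3 {m n : ℕ} {H H' : Type*} [TopologicalSpace H] [TopologicalSpace H']
    (I : ModelWithCorners ℝ (EuclideanSpace ℝ (Fin m)) H)
    (J : ModelWithCorners ℝ (EuclideanSpace ℝ (Fin n)) H')
    (hI : LipWhitney.IsBoundaryModel I) (hJ : LipWhitney.IsBoundaryModel J)
    (M N : Type*) [TopologicalSpace M] [TopologicalSpace N]
    [ChartedSpace H M] [ChartedSpace H' N] [IsManifold I ∞ M] [IsManifold J ∞ N]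
    [T2Space M] [T2Space N] [SecondCountableTopology M] [SecondCountableTopology N]
    [ConnectedSpace M] [ConnectedSpace N] (k : ℕ) :
    -- the diffeomorphisms are an open subset of the boundary-preserving maps
    (LipWhitney.diffeos I J M N k ⊆ LipWhitney.boundaryMaps I J M N k ∧
      IsOpen {f : LipWhitney.boundaryMaps I J M N k |
        (f : LipWhitney.CkLip I J M N k) ∈ LipWhitney.diffeos I J M N k}) ∧
    -- openness in the space of all maps
    IsOpen (LipWhitney.submersions I J M N k) ∧
    IsOpen (LipWhitney.immersions I J M N k) ∧
    IsOpen (LipWhitney.embeddings I J M N k) ∧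
    IsOpen (LipWhitney.properMaps I J M N k) ∧
    -- diffeomorphisms and the intersection of these classes
    LipWhitney.submersions I J M N k ∩ LipWhitney.embeddings I J M N k ∩
        LipWhitney.properMaps I J M N k ∩ LipWhitney.boundaryMaps I J M N k ⊆
      LipWhitney.diffeos I J M N k ∧
    (1 ≤ k → LipWhitney.diffeos I J M N k =
      LipWhitney.submersions I J M N k ∩ LipWhitney.embeddings I J M N k ∩
        LipWhitney.properMaps I J M N k ∩ LipWhitney.boundaryMaps I J M N k) := by
  have : LocallyCompactSpace N := Manifold.locallyCompact_of_finiteDimensional J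
  -- The tolerances are measured in an auxiliary metric on `N` that induces its topology; the
  -- statement does not depend on it.
  obtain ⟨_, rfl⟩ := LipWhitney.exists_metricSpace_eq N
  exact ⟨⟨LipWhitney.diffeos_subset_boundaryMaps hI hJ k, LipWhitney.isOpen_diffeos hI hJ⟩,
    LipWhitney.isOpen_submersions hI, LipWhitney.isOpen_immersions hI,
    LipWhitney.isOpen_embeddings hI, LipWhitney.isOpen_properMaps,
    LipWhitney.inter_subset_diffeos hI,
    fun hk => (LipWhitney.diffeos_subset_inter hI hJ hk).antisymm
      (LipWhitney.inter_subset_diffeos hI)⟩
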